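/- For $n\ge 1$ let $\boldsymbol X=(X_1,\dots,X_n)$ have independent components $X_i\sim N(\theta_i,1)$ under $P_{\boldsymbol\theta}$, where $\boldsymbol\theta=\boldsymbol\theta^{(n)}\in\mathbb R^n$ is an unknown vector that may change with $n$, and let $s_\lambda(x)=\mathrm{sgn}(x)(|x|-\lambda)_+$ be the soft threshold function, applied to vectors componentwise. Let $\Phi$ be the standard normal distribution function and $\|\cdot\|$ the Euclidean norm. Fix constants $0<\alpha_2\le\alpha_1<1$ and put $$\xi_{j,k}=-\Phi^{-1}\Big(\frac{\alpha_j k}{2n}\Big)\ (j=1,2),\qquad N(t)=\#\{i\le n:|X_i|\ge t\},$$ $$\hat\xi_1=\min\{\xi_{1,k}:1\le k\le n,\ N(\xi_{1,k})\ge k\},\qquad \hat\xi_2=\max\{\xi_{2,k}:1\le k\le n,\ N(\xi_{2,k+1})<k+1\},$$ where $\hat\xi_1=\xi_{1,1}$ if the first set is empty. Let $\hat\lambda=\hat\lambda_n$ be a random threshold level that satisfies, almost surely for every $n\ge 1$, $$\sqrt{1+\delta_{1,n}}\,\hat\xi_1\le\hat\lambda\le\sqrt{1+\delta_{2,n}}\,\hat\xi_2,$$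 where $0\le\delta_{1,n}\le\delta_{2,n}$ are constants and $\delta_{2,n}\to0$. Suppose that, as $n\to\infty$, $$\log n\ \ll\ \inf_{\lambda\ge0}E_{\boldsymbol\theta}\|s_\lambda(\boldsymbol X)-\boldsymbol\theta\|^2\ \ll\ n,$$ where $a_n\ll b_n$ means $a_n=o(b_n)$. Then the expectations below are finite and $$\lim_{n\to\infty}\frac{E_{\boldsymbol\theta}\|s_{\hat\lambda}(\boldsymbol X)-\boldsymbol\theta\|^2}{E_{\boldsymbol\theta}\inf_{\lambda\ge0}\|s_\lambda(\boldsymbol X)-\boldsymbol\theta\|^2}=1 .$$ -/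

import Mathlib

open MeasureTheory ProbabilityTheory Filter Topology Asymptotics
open scoped NNReal

/-- The quantile function `Φ⁻¹` of the standard normal distribution, for levels `0 < p < 1`. -/
noncomputable def stdNormalQuantile (p : ℝ) : ℝ :=
  sInf {t : ℝ | p ≤ cdf (gaussianReal 0 1) t}

/-- The soft threshold function `s_lam(x) = sgn(x) (|x| - lam)_+`. -/
noncomputable def softThreshold (lam x : ℝ) : ℝ :=
  Real.sign x * max (|x| - lam) 0

/-- The squared Euclidean loss `‖s_lam(x) - θ‖²` of soft thresholding applied to each component. -/
noncomputable def softLoss {n : ℕ} (lam : ℝ) (x θ : Fin n → ℝ) : ℝ :=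
  ∑ i, (softThreshold lam (x i) - θ i) ^ 2

/-- The number `N(t)` of observations whose absolute value is at least `t`. -/
noncomputable def exceedCount {n : ℕ} (x : Fin n → ℝ) (t : ℝ) : ℕ :=
  (Finset.univ.filter fun i => t ≤ |x i|).card

/-- The candidate threshold level `ξ_k = -Φ⁻¹(α k / (2 n))` at nominal level `α`. -/
noncomputable def fdrLevel (α : ℝ) (n k : ℕ) : ℝ :=
  -stdNormalQuantile (α * k / (2 * n))

open Classical in
/-- The step-up (Benjamini-Hochberg) threshold `min {ξ_k : 1 ≤ k ≤ n, N(ξ_k) ≥ k}` at nominal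
level `α`.  When no hypothesis is rejected, that is, when the set is empty, the threshold is the
highest candidate level `ξ_1`. -/
noncomputable def stepUpThreshold (α : ℝ) {n : ℕ} (x : Fin n → ℝ) : ℝ :=
  if h : ((Finset.Icc 1 n).filter fun k => k ≤ exceedCount x (fdrLevel α n k)).Nonempty then
    Finset.inf' _ h (fdrLevel α n)
  else fdrLevel α n 1

open Classical in
/-- The step-down threshold `max {ξ_k : 1 ≤ k ≤ n, N(ξ_{k+1}) < k + 1}` at nominal level `α`.
For `n ≥ 1` and `0 < α < 1` the set is never empty, since it contains `k = n`; the `else` branch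
is only reached for `n = 0`. -/
noncomputable def stepDownThreshold (α : ℝ) {n : ℕ} (x : Fin n → ℝ) : ℝ :=
  if h : ((Finset.Icc 1 n).filter
      fun k => exceedCount x (fdrLevel α n (k + 1)) < k + 1).Nonempty then
    Finset.sup' _ h (fdrLevel α n)
  else 0

/-- The minimum risk `inf_{lam ≥ 0} E ‖s_lam(X) - θ‖²` over deterministic thresholds. -/
noncomputable def minSoftRisk {Ω : Type*} [MeasurableSpace Ω] (P : Measure Ω) {n : ℕ}
    (X : Ω → Fin n → ℝ) (θ : Fin n → ℝ) : ℝ :=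
  ⨅ lam : ℝ≥0, ∫ ω, softLoss (lam : ℝ) (X ω) θ ∂P

/-- The minimum loss `inf_{lam ≥ 0} ‖s_lam(x) - θ‖²` for given data `x`. -/
noncomputable def minSoftLoss {n : ℕ} (x θ : Fin n → ℝ) : ℝ :=
  ⨅ lam : ℝ≥0, softLoss (lam : ℝ) x θ

/-! Write ρ for the minimum risk, S for `signalSize θ` and g(t) for `meanExceed θ t`. At every
threshold a component costs at least a constant times min(θ_i², 1), so S = O(ρ). Let the reference
level a solve n P(|Z| ≥ a) = Aρ for a large constant A; then a → ∞ because ρ ≪ n. Gaussian tails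
change by at least a factor exp(δa²/2) over a relative step δ. Hence noise beyond λ₀ = (1+δ)a is
negligible against ρ, whereas noise alone exceeds (1-δ)a far more than ρ times.

Both the risk at λ₀ and the expected minimum loss are therefore ρ up to factors near one. A
threshold below (1-2δ)a pays about one unit for each exceedance of (1-δ)a, and for a larger
threshold the loss at λ₀ is at most slightly worse (`NormalMeans.softRisk_le_minSoftRisk`,
`NormalMeans.softRisk_sub_le_integral_minSoftLoss`).

It remains to confine the random threshold. A level ξ_k < a at nominal level α has k ≥ Aρ/α and
g(ξ_k) ≤ αk + S ≤ (1+α)k/2, so by a Chernoff bound the step-up threshold falls below a with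
probability at most n exp(-cρ) up to a constant. This beats every power of n because log n ≪ ρ. From
above, let k₀ be the last index with g(ξ_k) ≥ 4k. Monotone likelihood ratio makes g(ξ_j)/j
nonincreasing, so all earlier levels are rejected with high probability and the step-down threshold
is at most ξ_{k₀}. There g is comparable to its pure noise value, and monotone likelihood ratio
again bounds the cost of raising λ₀ to ξ_{k₀} by a multiple of n E(Z² - λ₀²)_+ (`softRisk_max_le`).

The dependence between threshold and data is handled without moment inequalities for the loss: on a
bad event the loss is multiplied by an exponential of the exceedance count that is at least one
there, and the expectation factors by independence (`NormalMeans.integral_mul_exp_count_le`). -/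

/-! ### Gaussian tails and excess moments -/

/-- The two-sided tail probability `P(|Z| ≥ t)` of a standard normal variable. -/
noncomputable def gaussTail (t : ℝ) : ℝ := (gaussianReal 0 1).real {z | t ≤ |z|}

theorem measurableSet_le_abs (t : ℝ) : MeasurableSet {z : ℝ | t ≤ |z|} :=
  measurableSet_le measurable_const measurable_id.abs

theorem integral_gaussianReal_tilt (θ : ℝ) (f : ℝ → ℝ) :
    ∫ x, f x ∂(gaussianReal θ 1) =
      ∫ z, f z * Real.exp (θ * z - θ ^ 2 / 2) ∂(gaussianReal 0 1) := by
  rw [integral_gaussianReal_eq_integral_smul one_ne_zero,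
    integral_gaussianReal_eq_integral_smul one_ne_zero]
  congr 1
  ext x
  simp only [gaussianPDFReal, smul_eq_mul, NNReal.coe_one, mul_one]
  have : Real.exp (-(x - θ) ^ 2 / 2) = Real.exp (-(x - 0) ^ 2 / 2) *
      Real.exp (θ * x - θ ^ 2 / 2) := by
    rw [← Real.exp_add]; congr 1; ring
  rw [this]; ring

theorem integral_stdGaussian_neg (f : ℝ → ℝ) :
    ∫ z, f (-z) ∂(gaussianReal 0 1) = ∫ z, f z ∂(gaussianReal 0 1) := by
  have h := gaussianReal_map_neg (μ := 0) (v := 1)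
  rw [neg_zero] at h
  conv_rhs => rw [← h]
  exact ((MeasurableEquiv.neg ℝ).measurableEmbedding.integral_map f).symm

theorem integral_gaussianReal_shift (θ : ℝ) (f : ℝ → ℝ) :
    ∫ x, f (x - θ) ∂(gaussianReal θ 1) = ∫ z, f z ∂(gaussianReal 0 1) := by
  have h := gaussianReal_map_sub_const (μ := θ) (v := 1) θ
  rw [sub_self] at h
  rw [← h]
  exact ((MeasurableEquiv.subRight θ).measurableEmbedding.integral_map f).symm

theorem integrable_gaussianReal_shift (θ : ℝ) {f : ℝ → ℝ}
    (hf : Integrable f (gaussianReal 0 1)) :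
    Integrable (fun x => f (x - θ)) (gaussianReal θ 1) := by
  have h := gaussianReal_map_sub_const (μ := θ) (v := 1) θ
  rw [sub_self] at h
  rw [← h] at hf
  exact ((MeasurableEquiv.subRight θ).measurableEmbedding.integrable_map_iff).1 hf

theorem integral_indicator_const' {α : Type*} [MeasurableSpace α] (μ : Measure α) {s : Set α}
    (hs : MeasurableSet s) : ∫ x, s.indicator (fun _ => (1 : ℝ)) x ∂μ = μ.real s := by
  rw [integral_indicator hs]; simp

theorem gaussTail_eq_integral (t : ℝ) :
    gaussTail t = ∫ z, {z : ℝ | t ≤ |z|}.indicator (fun _ => (1 : ℝ)) z ∂(gaussianReal 0 1) :=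
  (integral_indicator_const' _ (measurableSet_le_abs t)).symm

theorem gaussTail_nonneg (t : ℝ) : 0 ≤ gaussTail t := measureReal_nonneg
theorem gaussTail_le_one (t : ℝ) : gaussTail t ≤ 1 := measureReal_le_one
theorem gaussTail_anti {s t : ℝ} (h : s ≤ t) : gaussTail t ≤ gaussTail s :=
  measureReal_mono fun _ hz => h.trans hz
theorem gaussTail_of_nonpos {t : ℝ} (ht : t ≤ 0) : gaussTail t = 1 := by
  have : {z : ℝ | t ≤ |z|} = Set.univ := by
    ext z; simpa using ht.trans (abs_nonneg z)
  simp [gaussTail, this]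

theorem gaussTail_eq_two_mul {t : ℝ} (ht : 0 < t) :
    gaussTail t = 2 * (gaussianReal 0 1).real (Set.Ici t) := by
  have hsplit : {z : ℝ | t ≤ |z|} = Set.Ici t ∪ Set.Iic (-t) := by
    ext z; simp [le_abs, le_neg]
  have hneg : (gaussianReal 0 1).real (Set.Iic (-t)) = (gaussianReal 0 1).real (Set.Ici t) := by
    have h := gaussianReal_map_neg (μ := 0) (v := 1)
    rw [neg_zero] at h
    conv_rhs => rw [← h]
    rw [map_measureReal_apply measurable_neg measurableSet_Ici]
    congr 1; ext z; simp
  rw [gaussTail, hsplit, measureReal_union _ measurableSet_Iic, hneg, two_mul]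
  rw [Set.disjoint_left]; intro z h1 h2
  simp only [Set.mem_Ici, Set.mem_Iic] at h1 h2; linarith

theorem integrable_of_bdd {μ : Measure ℝ} [IsProbabilityMeasure μ] {f : ℝ → ℝ} (hf : Measurable f)
    {C : ℝ} (hC : ∀ x, |f x| ≤ C) : Integrable f μ :=
  Integrable.of_bound hf.aestronglyMeasurable C (Eventually.of_forall hC)

theorem integrable_mul_exp {f : ℝ → ℝ} (hf : Measurable f) {C : ℝ} (hC : ∀ x, |f x| ≤ C) (θ : ℝ) :
    Integrable (fun z => f z * Real.exp (θ * z - θ ^ 2 / 2)) (gaussianReal 0 1) := by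
  have h : Integrable (fun z : ℝ => Real.exp (θ * z - θ ^ 2 / 2)) (gaussianReal 0 1) := by
    have := (integrable_exp_mul_gaussianReal (μ := 0) (v := 1) θ).mul_const (Real.exp (-θ ^ 2 / 2))
    refine this.congr (Eventually.of_forall fun z => ?_)
    simp only; rw [← Real.exp_add]; congr 1; ring
  exact h.bdd_mul hf.aestronglyMeasurable (Eventually.of_forall hC)

/-- The two-sided tail decays at least geometrically, at a rate that grows with the level. -/
theorem gaussTail_add_le {a u : ℝ} (ha : 0 < a) (hu : 0 ≤ u) :
    gaussTail (a + u) ≤ Real.exp (-(a * u)) * gaussTail a := by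
  rw [gaussTail_eq_two_mul (by linarith), gaussTail_eq_two_mul ha]
  have key : (gaussianReal 0 1).real (Set.Ici (a + u)) ≤
      Real.exp (-(a * u)) * (gaussianReal 0 1).real (Set.Ici a) := by
    -- Translating by u turns the event into z ≥ a at the price of the density exp(-uz - u²/2),
    -- which is at most exp(-au) there.
    rw [← integral_indicator_const' _ measurableSet_Ici, ← integral_indicator_const' _ measurableSet_Ici,
      ← integral_gaussianReal_shift (-u), integral_gaussianReal_tilt, ← integral_const_mul]
    have hm : ∀ c : ℝ, Measurable ((Set.Ici c).indicator (fun _ => (1 : ℝ))) :=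
      fun c => measurable_const.indicator measurableSet_Ici
    have hb : ∀ c x : ℝ, |(Set.Ici c).indicator (fun _ => (1 : ℝ)) x| ≤ 1 := by
      intro c x; by_cases h : x ∈ Set.Ici c <;> simp [h]
    refine integral_mono (integrable_mul_exp ((hm _).comp (measurable_id.sub_const _)) (C := 1) (fun x => hb _ _) _)
      ((integrable_of_bdd (hm a) (hb a)).const_mul _) fun z => ?_
    simp only
    by_cases h : a ≤ z
    · have h1 : z - -u ∈ Set.Ici (a + u) := by simp only [Set.mem_Ici]; linarith
      have h2 : z ∈ Set.Ici a := h
      simp only [h1, h2, Set.indicator_of_mem, one_mul, mul_one]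
      refine Real.exp_le_exp.2 ?_
      nlinarith [mul_le_mul_of_nonneg_right h hu, sq_nonneg u]
    · have h1 : z - -u ∉ Set.Ici (a + u) := by simp only [Set.mem_Ici]; intro h'; apply h; linarith
      have h2 : z ∉ Set.Ici a := h
      rw [Set.indicator_of_notMem h1, Set.indicator_of_notMem h2]; simp
  linarith

theorem gaussTail_le_exp (t : ℝ) (ht : 0 ≤ t) : gaussTail t ≤ Real.exp (-(t ^ 2 / 4)) := by
  rcases ht.eq_or_lt with rfl | ht
  · simpa using gaussTail_le_one 0
  have h := gaussTail_add_le (a := t / 2) (u := t / 2) (by linarith) (by linarith)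
  have e1 : t / 2 + t / 2 = t := by ring
  have e2 : t / 2 * (t / 2) = t ^ 2 / 4 := by ring
  rw [e1, e2] at h
  nlinarith [gaussTail_le_one (t / 2), Real.exp_pos (-(t ^ 2 / 4))]

theorem gaussTail_pos (t : ℝ) : 0 < gaussTail t := by
  have : 0 < (gaussianReal 0 1) (Set.Ioi t) := by
    rw [pos_iff_ne_zero]
    intro h
    have := gaussianReal_absolutelyContinuous' 0 (v := 1) one_ne_zero h
    simp at this
  have h2 : (0 : ℝ) < (gaussianReal 0 1).real (Set.Ioi t) :=
    ENNReal.toReal_pos this.ne' (measure_ne_top _ _)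
  exact h2.trans_le (measureReal_mono fun z hz => (le_of_lt hz).trans (le_abs_self z))

theorem continuous_gaussTail : Continuous gaussTail := by
  rw [show gaussTail = fun t => ∫ z, {z : ℝ | t ≤ |z|}.indicator (fun _ => (1 : ℝ)) z
    ∂(gaussianReal 0 1) from funext gaussTail_eq_integral]
  rw [continuous_iff_continuousAt]
  intro t
  have hna : NullSingletonClass (gaussianReal 0 1) := nullSingletonClass_gaussianReal one_ne_zero
  refine continuousAt_of_dominated (bound := fun _ => 1)
    (Eventually.of_forall fun s => ?_) (Eventually.of_forall fun s => ?_) (integrable_const _) ?_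
  · exact (measurable_const.indicator (measurableSet_le_abs s)).aestronglyMeasurable
  · refine Eventually.of_forall fun z => ?_
    by_cases h : z ∈ {z : ℝ | s ≤ |z|} <;> simp only [h, Set.indicator_of_mem, Set.indicator_of_notMem, not_false_eq_true] <;> simp
  · have h0 : ∀ c : ℝ, ∀ᵐ z ∂(gaussianReal 0 1), z ≠ c := fun c => by
      rw [ae_iff]; simp
    filter_upwards [h0 t, h0 (-t)] with z hz1 hz2
    have hne : t ≠ |z| := by
      intro h
      rcases abs_choice z with h' | h' <;> rw [h'] at h
      · exact hz1 h.symm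
      · exact hz2 (by linarith)
    have : ∀ᶠ s in 𝓝 t, {z : ℝ | s ≤ |z|}.indicator (fun _ => (1 : ℝ)) z =
        {z : ℝ | t ≤ |z|}.indicator (fun _ => (1 : ℝ)) z := by
      rcases lt_or_gt_of_ne hne with h | h
      · filter_upwards [eventually_lt_nhds h] with s hs
        rw [Set.indicator_of_mem (by exact hs.le), Set.indicator_of_mem (by exact h.le)]
      · filter_upwards [eventually_gt_nhds h] with s hs
        rw [Set.indicator_of_notMem (by simpa using hs), Set.indicator_of_notMem (by simpa using h)]
    exact tendsto_const_nhds.congr' (this.mono fun s hs => hs.symm)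

theorem tendsto_gaussTail : Tendsto gaussTail atTop (𝓝 0) := by
  have h : Tendsto (fun t : ℝ => Real.exp (-(t ^ 2 / 4))) atTop (𝓝 0) := by
    refine Real.tendsto_exp_neg_atTop_nhds_zero.comp ?_
    exact (tendsto_pow_atTop (two_ne_zero)).atTop_div_const (by norm_num)
  refine tendsto_of_tendsto_of_tendsto_of_le_of_le' tendsto_const_nhds h
    (Eventually.of_forall gaussTail_nonneg) ?_
  filter_upwards [eventually_ge_atTop 0] with t ht using gaussTail_le_exp t ht

theorem exists_gaussTail_eq {p : ℝ} (hp : 0 < p) (hp1 : p ≤ 1) : ∃ a, 0 ≤ a ∧ gaussTail a = p := by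
  obtain ⟨b, hb, hb0⟩ := ((tendsto_gaussTail.eventually (gt_mem_nhds hp)).and
    (eventually_ge_atTop 0)).exists
  have := intermediate_value_Icc' hb0 continuous_gaussTail.continuousOn
  obtain ⟨a, ha, rfl⟩ := this (show p ∈ _ from ⟨hb.le, by rwa [gaussTail_of_nonpos le_rfl]⟩)
  exact ⟨a, ha.1, rfl⟩

theorem integrable_sq_stdGaussian : Integrable (fun z : ℝ => z ^ 2) (gaussianReal 0 1) :=
  (memLp_id_gaussianReal 2).integrable_sq

theorem integrable_abs_stdGaussian : Integrable (fun z : ℝ => |z|) (gaussianReal 0 1) :=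
  ((memLp_id_gaussianReal 1).integrable (by norm_num)).abs

theorem integral_sq_stdGaussian : ∫ z : ℝ, z ^ 2 ∂(gaussianReal 0 1) = 1 := by
  have h := variance_fun_id_gaussianReal (μ := 0) (v := 1)
  rw [variance_eq_integral measurable_id'.aemeasurable] at h
  simpa using h

/-- Layer cake: by `gaussTail_add_le` the excess over a has a tail dominated by that of an
exponential variable of rate a, whose moments are Gamma integrals. -/
theorem integral_excess_rpow_le {a p : ℝ} (ha : 0 < a) (hp : 0 < p)
    (hint : Integrable (fun z : ℝ => max (|z| - a) 0 ^ p) (gaussianReal 0 1)) :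
    ∫ z, max (|z| - a) 0 ^ p ∂(gaussianReal 0 1) ≤
      p * (gaussTail a * ((1 / a) ^ p * Real.Gamma p)) := by
  have hI := Real.integral_rpow_mul_exp_neg_mul_Ioi hp ha
  have hnn : ∀ t ∈ Set.Ioi (0 : ℝ), 0 ≤ t ^ (p - 1) * Real.exp (-(a * t)) := fun t ht =>
    mul_nonneg (Real.rpow_nonneg (le_of_lt ht) _) (Real.exp_pos _).le
  have hII : IntegrableOn (fun t : ℝ => t ^ (p - 1) * Real.exp (-(a * t))) (Set.Ioi 0) := by
    -- A non-integrable function would have Bochner integral zero, but the known value is positive.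
    by_contra h
    have h0 := integral_undef h
    rw [hI] at h0
    have : 0 < (1 / a) ^ p * Real.Gamma p :=
      mul_pos (Real.rpow_pos_of_pos (by positivity) _) (Real.Gamma_pos_of_pos hp)
    linarith
  have hf : 0 ≤ᵐ[gaussianReal 0 1] fun z : ℝ => max (|z| - a) 0 :=
    Eventually.of_forall fun z => le_max_right _ _
  have hm : AEMeasurable (fun z : ℝ => max (|z| - a) 0) (gaussianReal 0 1) := by fun_prop
  have hlc := lintegral_rpow_eq_lintegral_meas_le_mul (gaussianReal 0 1) hf hm hp
  have hle : ∫⁻ z, ENNReal.ofReal (max (|z| - a) 0 ^ p) ∂(gaussianReal 0 1) ≤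
      ENNReal.ofReal (p * (gaussTail a * ((1 / a) ^ p * Real.Gamma p))) := by
    rw [hlc, ENNReal.ofReal_mul hp.le]
    gcongr
    rw [← hI, ENNReal.ofReal_mul (gaussTail_nonneg a),
      ofReal_integral_eq_lintegral_ofReal hII
        ((ae_restrict_iff' measurableSet_Ioi).2 (Eventually.of_forall hnn)),
      ← lintegral_const_mul' _ _ ENNReal.ofReal_ne_top]
    refine setLIntegral_mono' measurableSet_Ioi fun t ht => ?_
    have ht : 0 < t := ht
    have hset : {z : ℝ | t ≤ max (|z| - a) 0} = {z : ℝ | a + t ≤ |z|} := by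
      ext z
      simp only [Set.mem_ofPred_eq, le_max_iff]
      constructor
      · rintro (h | h) <;> linarith
      · intro h; left; linarith
    rw [hset, ← ofReal_measureReal, ← ENNReal.ofReal_mul measureReal_nonneg,
      ← ENNReal.ofReal_mul (gaussTail_nonneg a)]
    refine ENNReal.ofReal_le_ofReal ?_
    have := gaussTail_add_le ha ht.le
    have h2 : 0 ≤ t ^ (p - 1) := Real.rpow_nonneg ht.le _
    calc gaussTail (a + t) * t ^ (p - 1) ≤ (Real.exp (-(a * t)) * gaussTail a) * t ^ (p - 1) := by
          gcongr
      _ = _ := by ring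
  rw [← ofReal_integral_eq_lintegral_ofReal hint (Eventually.of_forall fun z =>
    Real.rpow_nonneg (le_max_right _ _) _)] at hle
  refine (ENNReal.ofReal_le_ofReal_iff ?_).1 hle
  have := gaussTail_nonneg a
  have := Real.Gamma_pos_of_pos hp
  positivity

/-- The second moment of the excess of `|Z|` over the level `a`. -/
noncomputable def gaussExcess (a : ℝ) : ℝ := ∫ z, max (|z| - a) 0 ^ 2 ∂(gaussianReal 0 1)

/-- The expected excess of `Z ^ 2` over the level `a ^ 2`. -/
noncomputable def gaussSqExcess (a : ℝ) : ℝ := ∫ z, max (z ^ 2 - a ^ 2) 0 ∂(gaussianReal 0 1)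

theorem excess_sq_le {a : ℝ} (ha : 0 ≤ a) (z : ℝ) : max (|z| - a) 0 ^ 2 ≤ z ^ 2 := by
  rw [← sq_abs z]
  have := abs_nonneg z
  exact pow_le_pow_left₀ (le_max_right _ _) (max_le (by linarith) this) 2

theorem integrable_excess_sq {a : ℝ} (ha : 0 ≤ a) :
    Integrable (fun z : ℝ => max (|z| - a) 0 ^ 2) (gaussianReal 0 1) := by
  refine integrable_sq_stdGaussian.mono' (by fun_prop) (Eventually.of_forall fun z => ?_)
  rw [Real.norm_of_nonneg (by positivity)]
  exact excess_sq_le ha z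

theorem integrable_excess {a : ℝ} (ha : 0 ≤ a) :
    Integrable (fun z : ℝ => max (|z| - a) 0) (gaussianReal 0 1) := by
  refine integrable_abs_stdGaussian.mono' (by fun_prop) (Eventually.of_forall fun z => ?_)
  rw [Real.norm_of_nonneg (le_max_right _ _)]
  exact max_le (by linarith) (abs_nonneg z)

theorem integrable_sq_excess (a : ℝ) :
    Integrable (fun z : ℝ => max (z ^ 2 - a ^ 2) 0) (gaussianReal 0 1) := by
  refine integrable_sq_stdGaussian.mono' (by fun_prop) (Eventually.of_forall fun z => ?_)
  rw [Real.norm_of_nonneg (le_max_right _ _)]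
  exact max_le (by nlinarith [sq_nonneg a]) (sq_nonneg z)

theorem gaussExcess_nonneg (a : ℝ) : 0 ≤ gaussExcess a := integral_nonneg fun _ => by positivity
theorem gaussSqExcess_nonneg (a : ℝ) : 0 ≤ gaussSqExcess a :=
  integral_nonneg fun _ => le_max_right _ _

theorem gaussExcess_anti {a b : ℝ} (ha : 0 ≤ a) (h : a ≤ b) : gaussExcess b ≤ gaussExcess a :=
  integral_mono (integrable_excess_sq (ha.trans h)) (integrable_excess_sq ha) fun z =>
    pow_le_pow_left₀ (le_max_right _ _) (max_le_max (by linarith) le_rfl) 2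

/-- The gain a⁻² over the tail makes this excess negligible already at the reference level itself.
-/
theorem gaussExcess_le {a : ℝ} (ha : 0 < a) : gaussExcess a ≤ 2 / a ^ 2 * gaussTail a := by
  have h := integral_excess_rpow_le ha (p := 2) (by norm_num)
    (by simpa using integrable_excess_sq ha.le)
  simp only [Real.rpow_two, Real.Gamma_two, mul_one] at h
  refine h.trans (le_of_eq ?_)
  field_simp

/-- Expand z² - a² = (|z| - a)² + 2a(|z| - a) beyond a. The cross term has the order of the tail
itself, with no gain; this is why the reference threshold must lie slightly above a. -/
theorem gaussSqExcess_le {a : ℝ} (ha : 0 < a) :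
    gaussSqExcess a ≤ (2 + 2 / a ^ 2) * gaussTail a := by
  have h2 := gaussExcess_le ha
  have h1 := integral_excess_rpow_le ha (p := 1) (by norm_num)
    (by simpa using integrable_excess ha.le)
  simp only [Real.rpow_one, Real.Gamma_one, mul_one, one_mul] at h1
  have e : ∀ z : ℝ, max (z ^ 2 - a ^ 2) 0 = max (|z| - a) 0 ^ 2 + 2 * a * max (|z| - a) 0 := by
    intro z
    rw [← sq_abs z]
    rcases le_total (|z|) a with h | h
    · rw [max_eq_right (by nlinarith [abs_nonneg z]), max_eq_right (by linarith)]; ring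
    · rw [max_eq_left (by nlinarith [abs_nonneg z]), max_eq_left (by linarith)]; ring
  have : gaussSqExcess a = gaussExcess a + 2 * a * ∫ z, max (|z| - a) 0 ∂(gaussianReal 0 1) := by
    rw [gaussSqExcess, gaussExcess, ← integral_const_mul, ← integral_add (integrable_excess_sq ha.le)
      ((integrable_excess ha.le).const_mul _)]
    exact integral_congr_ae (Eventually.of_forall e)
  rw [this]
  have h3 : 2 * a * ∫ z, max (|z| - a) 0 ∂(gaussianReal 0 1) ≤ 2 * a * (gaussTail a * (1 / a)) := by
    gcongr
  have h4 : 2 * a * (gaussTail a * (1 / a)) = 2 * gaussTail a := by field_simp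
  linarith

/-! ### Likelihood ratio of |X| and exceedance probabilities -/

/-- The likelihood ratio of `|X|`, `X ~ N(θ, 1)`, with respect to `|Z|`. -/
noncomputable def absLR (θ z : ℝ) : ℝ := Real.cosh (θ * z) * Real.exp (-(θ ^ 2 / 2))

theorem integrable_mul_absLR {f : ℝ → ℝ} (hf : Measurable f) {C : ℝ} (hC : ∀ x, |f x| ≤ C) (θ : ℝ) :
    Integrable (fun z => f z * absLR θ z) (gaussianReal 0 1) := by
  have h := ((integrable_mul_exp hf hC θ).add (integrable_mul_exp hf hC (-θ))).const_mul (1 / 2)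
  refine h.congr (Eventually.of_forall fun z => ?_)
  simp only [absLR, Real.cosh_eq, Pi.add_apply, sub_eq_add_neg, Real.exp_add, neg_mul, neg_sq]
  ring

/-- Averaging the tilted integral with its reflection replaces the exponential by cosh, a ratio that
increases in |z|. -/
theorem integral_even_gaussianReal {f : ℝ → ℝ} (hf : Measurable f) {C : ℝ} (hC : ∀ x, |f x| ≤ C)
    (heven : ∀ x, f (-x) = f x) (θ : ℝ) :
    ∫ x, f x ∂(gaussianReal θ 1) = ∫ z, f z * absLR θ z ∂(gaussianReal 0 1) := by
  have h1 := integral_gaussianReal_tilt θ f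
  have h2 := h1
  rw [← integral_stdGaussian_neg] at h2
  have h3 : ∫ z, f (-z) * Real.exp (θ * -z - θ ^ 2 / 2) ∂(gaussianReal 0 1) =
      ∫ z, f z * Real.exp ((-θ) * z - (-θ) ^ 2 / 2) ∂(gaussianReal 0 1) := by
    congr 1; ext z; rw [heven]; congr 2; ring
  rw [h3] at h2
  have h4 : ∫ x, f x ∂(gaussianReal θ 1) = (1 / 2) * (∫ x, f x ∂(gaussianReal θ 1) +
    ∫ x, f x ∂(gaussianReal θ 1)) := by ring
  rw [h4]
  conv_lhs => rw [show ∀ a b : ℝ, (1/2 : ℝ) * (a + b) = 1/2 * (a + b) from fun _ _ => rfl]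
  nth_rewrite 1 [h1]
  rw [h2, ← integral_add (integrable_mul_exp hf hC θ) (integrable_mul_exp hf hC (-θ)),
    ← integral_const_mul]
  congr 1; ext z
  simp only [absLR, Real.cosh_eq, sub_eq_add_neg, Real.exp_add, neg_mul, neg_sq]
  ring

/-- The probability `P(|X| ≥ t)` for `X ~ N(θ, 1)`. -/
noncomputable def exceedProb (θ t : ℝ) : ℝ := (gaussianReal θ 1).real {x | t ≤ |x|}

theorem exceedProb_nonneg (θ t : ℝ) : 0 ≤ exceedProb θ t := measureReal_nonneg
theorem exceedProb_le_one (θ t : ℝ) : exceedProb θ t ≤ 1 := measureReal_le_one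
theorem exceedProb_anti (θ : ℝ) {s t : ℝ} (h : s ≤ t) : exceedProb θ t ≤ exceedProb θ s :=
  measureReal_mono fun _ hz => h.trans hz
theorem exceedProb_of_nonpos (θ : ℝ) {t : ℝ} (ht : t ≤ 0) : exceedProb θ t = 1 := by
  have : {z : ℝ | t ≤ |z|} = Set.univ := by
    ext z; simpa using ht.trans (abs_nonneg z)
  simp [exceedProb, this]

theorem exceedProb_eq_integral (θ t : ℝ) :
    exceedProb θ t = ∫ z, {z : ℝ | t ≤ |z|}.indicator (fun _ => (1 : ℝ)) z ∂(gaussianReal θ 1) :=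
  (integral_indicator_const' _ (measurableSet_le_abs t)).symm

theorem abs_indicator_one_le (s : Set ℝ) (x : ℝ) : |s.indicator (fun _ => (1 : ℝ)) x| ≤ 1 := by
  by_cases h : x ∈ s <;> simp [h]

theorem exceedProb_eq_integral_absLR (θ t : ℝ) :
    exceedProb θ t = ∫ z, {z : ℝ | t ≤ |z|}.indicator (fun _ => (1 : ℝ)) z * absLR θ z
      ∂(gaussianReal 0 1) := by
  rw [exceedProb_eq_integral]
  refine integral_even_gaussianReal (measurable_const.indicator (measurableSet_le_abs t))
    (abs_indicator_one_le _) (fun x => ?_) θ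
  simp [Set.indicator]

theorem integrable_absLR (θ : ℝ) : Integrable (absLR θ) (gaussianReal 0 1) := by
  simpa using integrable_mul_absLR (f := fun _ => 1) measurable_const (C := 1) (by simp) θ

theorem integral_absLR (θ : ℝ) : ∫ z, absLR θ z ∂(gaussianReal 0 1) = 1 := by
  have := integral_even_gaussianReal (f := fun _ => 1) measurable_const (C := 1) (by simp) (by simp) θ
  simpa using this.symm

theorem integral_cosh (θ : ℝ) :
    ∫ z, Real.cosh (θ * z) ∂(gaussianReal 0 1) = Real.exp (θ ^ 2 / 2) := by
  have h := integral_absLR θ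
  simp only [absLR] at h
  rw [integral_mul_const, Real.exp_neg] at h
  have := (Real.exp_pos (θ ^ 2 / 2)).ne'
  field_simp at h
  exact h

theorem integrable_cosh (θ : ℝ) :
    Integrable (fun z => Real.cosh (θ * z)) (gaussianReal 0 1) := by
  refine ((integrable_absLR θ).mul_const (Real.exp (θ ^ 2 / 2))).congr
    (Eventually.of_forall fun z => ?_)
  simp only [absLR]
  rw [mul_assoc, ← Real.exp_add]; simp

/-- A mean shift `θ` raises the exceedance probability by at most `min (θ ^ 2) 1`. -/
theorem exceedProb_le (θ t : ℝ) : exceedProb θ t ≤ gaussTail t + min (θ ^ 2) 1 := by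
  rcases le_total 1 (θ ^ 2) with h | h
  · rw [min_eq_right h]; linarith [exceedProb_le_one θ t, gaussTail_nonneg t]
  rw [min_eq_left h, exceedProb_eq_integral_absLR, gaussTail_eq_integral]
  set I := {z : ℝ | t ≤ |z|}.indicator (fun _ => (1 : ℝ)) with hI
  have hIm : Measurable I := measurable_const.indicator (measurableSet_le_abs t)
  have hIb := abs_indicator_one_le {z : ℝ | t ≤ |z|}
  have hc1 : Integrable (fun z => Real.cosh (θ * z) - 1) (gaussianReal 0 1) :=
    (integrable_cosh θ).sub (integrable_const 1)
  -- The ratio exceeds one by at most cosh(θz) - 1, whose mean exp(θ²/2) - 1 is at most θ² when θ² ≤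
  -- 1.
  have : ∫ z, I z * absLR θ z ∂(gaussianReal 0 1) ≤
      ∫ z, I z ∂(gaussianReal 0 1) + ∫ z, (Real.cosh (θ * z) - 1) ∂(gaussianReal 0 1) := by
    rw [← integral_add (integrable_of_bdd hIm hIb) hc1]
    refine integral_mono (integrable_mul_absLR hIm hIb θ)
      ((integrable_of_bdd hIm hIb).add hc1) fun z => ?_
    have h1 : absLR θ z ≤ Real.cosh (θ * z) :=
      mul_le_of_le_one_right (Real.cosh_pos _).le (Real.exp_le_one_iff.2 (by nlinarith [sq_nonneg θ]))
    have h2 := Real.one_le_cosh (θ * z)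
    by_cases hz : t ≤ |z|
    · have : I z = 1 := Set.indicator_of_mem (show z ∈ {z : ℝ | t ≤ |z|} from hz) _
      simp only [this]; linarith
    · have : I z = 0 := Set.indicator_of_notMem (show z ∉ {z : ℝ | t ≤ |z|} from hz) _
      simp only [this]; linarith
  refine this.trans ?_
  rw [integral_sub (integrable_cosh θ) (integrable_const 1), integral_cosh]
  simp only [integral_const, probReal_univ, smul_eq_mul, mul_one]
  have hx : Real.exp (θ ^ 2 / 2) ≤ 1 + θ ^ 2 := by
    have := Real.abs_exp_sub_one_le (x := θ ^ 2 / 2) (by rw [abs_of_nonneg (by positivity)]; linarith)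
    rw [abs_of_nonneg (by positivity : 0 ≤ θ ^ 2 / 2)] at this
    linarith [le_abs_self (Real.exp (θ ^ 2 / 2) - 1)]
  linarith

/-- Monotone likelihood ratio comparison: an even function that is constant beyond the level `t`
grows under a mean shift by at most the factor by which `P(|X| ≥ t)` grows. -/
theorem integral_mul_gaussTail_le {f : ℝ → ℝ} (hf : Measurable f) (h0 : ∀ x, 0 ≤ f x) {c t : ℝ}
    (ht : 0 ≤ t) (heven : ∀ x, f (-x) = f x) (hc : ∀ x, t ≤ |x| → f x = c) (hle : ∀ x, f x ≤ c)
    (θ : ℝ) :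
    (∫ x, f x ∂(gaussianReal θ 1)) * gaussTail t ≤
      exceedProb θ t * ∫ z, f z ∂(gaussianReal 0 1) := by
  have hC : ∀ x, |f x| ≤ c := fun x => by rw [abs_of_nonneg (h0 x)]; exact hle x
  set I := {z : ℝ | t ≤ |z|}.indicator (fun _ => (1 : ℝ)) with hI
  have hIm : Measurable I := measurable_const.indicator (measurableSet_le_abs t)
  have hIb : ∀ x, |I x| ≤ 1 := abs_indicator_one_le {z : ℝ | t ≤ |z|}
  have hI01 : ∀ z, I z = 0 ∨ I z = 1 := fun z => by
    by_cases h : z ∈ {z : ℝ | t ≤ |z|} <;> simp [hI, h]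
  have hImem : ∀ z, I z = 1 ↔ t ≤ |z| := fun z => by
    by_cases h : t ≤ |z|
    · simp [hI, h]
    · simp [hI, h]
  -- The ratio at the boundary separates the two regions: it is at most H where |z| < t and at least
  -- H beyond. Since f - cI lives on the first region and I on the second, weighting by the ratio
  -- favours I.
  set H := absLR θ t with hH
  have hHle : ∀ z, I z = 0 → absLR θ z ≤ H := fun z hz => by
    have : |z| < t := by
      by_contra h; rw [(hImem z).2 (not_lt.1 h)] at hz; norm_num at hz
    refine mul_le_mul_of_nonneg_right (Real.cosh_le_cosh.2 ?_) (Real.exp_pos _).le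
    rw [abs_mul, abs_mul, abs_of_nonneg ht]
    exact mul_le_mul_of_nonneg_left this.le (abs_nonneg θ)
  have hHge : ∀ z, I z = 1 → H ≤ absLR θ z := fun z hz => by
    have : t ≤ |z| := (hImem z).1 hz
    refine mul_le_mul_of_nonneg_right (Real.cosh_le_cosh.2 ?_) (Real.exp_pos _).le
    rw [abs_mul, abs_mul, abs_of_nonneg ht]
    exact mul_le_mul_of_nonneg_left this (abs_nonneg θ)
  have hgm : Measurable (fun z => f z - c * I z) := hf.sub (hIm.const_mul c)
  have hg0 : ∀ z, 0 ≤ f z - c * I z := fun z => by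
    rcases hI01 z with h | h
    · rw [h]; simpa using h0 z
    · rw [h, hc z ((hImem z).1 h)]; simp
  have hgI : ∀ z, I z = 1 → f z - c * I z = 0 := fun z h => by
    rw [h, hc z ((hImem z).1 h)]; simp
  have hgb : ∀ z, |f z - c * I z| ≤ c := fun z => by
    rw [abs_of_nonneg (hg0 z)]
    rcases hI01 z with h | h
    · rw [h]; simpa using hle z
    · rw [hgI z h]; exact (h0 z).trans (hle z)
  have iI := integrable_of_bdd (μ := gaussianReal 0 1) hIm hIb
  have iIL := integrable_mul_absLR hIm hIb θ
  have ig := integrable_of_bdd (μ := gaussianReal 0 1) hgm hgb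
  have igL := integrable_mul_absLR hgm hgb θ
  rw [integral_even_gaussianReal hf hC heven θ, exceedProb_eq_integral_absLR, gaussTail_eq_integral]
  have e1 : ∫ z, f z * absLR θ z ∂(gaussianReal 0 1) =
      ∫ z, (f z - c * I z) * absLR θ z ∂(gaussianReal 0 1) +
        c * ∫ z, I z * absLR θ z ∂(gaussianReal 0 1) := by
    rw [← integral_const_mul, ← integral_add igL (iIL.const_mul c)]
    congr 1; ext z; ring
  have e2 : ∫ z, f z ∂(gaussianReal 0 1) = ∫ z, (f z - c * I z) ∂(gaussianReal 0 1) +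
        c * ∫ z, I z ∂(gaussianReal 0 1) := by
    rw [← integral_const_mul, ← integral_add ig (iI.const_mul c)]
    congr 1; ext z; ring
  have a1 : ∫ z, (f z - c * I z) * absLR θ z ∂(gaussianReal 0 1) ≤
      H * ∫ z, (f z - c * I z) ∂(gaussianReal 0 1) := by
    rw [← integral_const_mul]
    refine integral_mono igL (ig.const_mul H) fun z => ?_
    simp only
    rcases hI01 z with h | h
    · rw [mul_comm H]; exact mul_le_mul_of_nonneg_left (hHle z h) (hg0 z)
    · rw [hgI z h]; simp
  have a2 : H * ∫ z, I z ∂(gaussianReal 0 1) ≤ ∫ z, I z * absLR θ z ∂(gaussianReal 0 1) := by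
    rw [← integral_const_mul]
    refine integral_mono (iI.const_mul H) iIL fun z => ?_
    simp only
    rcases hI01 z with h | h
    · rw [h]; simp
    · rw [h]; simpa using hHge z h
  have n1 : 0 ≤ ∫ z, (f z - c * I z) ∂(gaussianReal 0 1) := integral_nonneg hg0
  have n2 : 0 ≤ ∫ z, I z ∂(gaussianReal 0 1) := by
    rw [← gaussTail_eq_integral]; exact gaussTail_nonneg t
  rw [e1, e2]
  nlinarith [mul_le_mul_of_nonneg_right a1 n2, mul_le_mul_of_nonneg_right a2 n1]

/-- Thus the exceedance probability relative to pure noise is nondecreasing in the level; applied to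
indicators, the comparison above needs nothing more. -/
theorem exceedProb_mul_gaussTail_le {s t : ℝ} (ht : 0 ≤ t) (hst : s ≤ t) (θ : ℝ) :
    exceedProb θ s * gaussTail t ≤ exceedProb θ t * gaussTail s := by
  rw [exceedProb_eq_integral θ s, gaussTail_eq_integral s]
  refine integral_mul_gaussTail_le (c := 1) (measurable_const.indicator (measurableSet_le_abs s))
    (fun x => Set.indicator_nonneg (fun _ _ => zero_le_one) x) ht
    (fun x => by simp [Set.indicator]) (fun x hx => Set.indicator_of_mem (show x ∈ {z : ℝ | s ≤ |z|} from hst.trans hx) _)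
    (fun x => le_of_abs_le (abs_indicator_one_le _ x)) θ

theorem gaussTail_le_exceedProb (θ t : ℝ) : gaussTail t ≤ exceedProb θ t := by
  rcases le_total t 0 with ht | ht
  · rw [gaussTail_of_nonpos ht, exceedProb_of_nonpos θ ht]
  · have := exceedProb_mul_gaussTail_le (s := 0) ht ht θ
    rwa [gaussTail_of_nonpos le_rfl, exceedProb_of_nonpos θ le_rfl, one_mul, mul_one] at this

/-! ### Candidate levels and the two multiple testing thresholds -/

theorem gaussTail_strictAnti {s t : ℝ} (hs : 0 < s) (h : s < t) : gaussTail t < gaussTail s := by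
  have h1 := gaussTail_add_le hs (sub_nonneg.2 h.le)
  rw [add_sub_cancel] at h1
  have h2 : Real.exp (-(s * (t - s))) < 1 := by
    rw [Real.exp_lt_one_iff]; nlinarith [mul_pos hs (sub_pos.2 h)]
  nlinarith [gaussTail_pos s]

theorem lt_of_gaussTail_lt {s t : ℝ} (h : gaussTail s < gaussTail t) : t < s := by
  by_contra hle
  exact absurd (gaussTail_anti (not_lt.1 hle)) (not_le.2 h)

theorem cdf_stdGaussian_neg {t : ℝ} (ht : 0 < t) :
    cdf (gaussianReal 0 1) (-t) = gaussTail t / 2 := by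
  have hneg : (gaussianReal 0 1).real (Set.Iic (-t)) = (gaussianReal 0 1).real (Set.Ici t) := by
    have h := gaussianReal_map_neg (μ := 0) (v := 1)
    rw [neg_zero] at h
    conv_rhs => rw [← h]
    rw [map_measureReal_apply measurable_neg measurableSet_Ici]
    congr 1; ext z; simp
  rw [cdf_eq_real, hneg, gaussTail_eq_two_mul ht]; ring

/-- Strict decrease of the tail at positive levels shows that the set defining the infimum is
exactly the half-line from -a. -/
theorem stdNormalQuantile_half {a : ℝ} (ha : 0 < a) :
    stdNormalQuantile (gaussTail a / 2) = -a := by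
  have : {t : ℝ | gaussTail a / 2 ≤ cdf (gaussianReal 0 1) t} = Set.Ici (-a) := by
    ext t
    simp only [Set.mem_ofPred_eq, Set.mem_Ici]
    constructor
    · intro h
      by_contra hlt
      have hlt : a < -t := by linarith [not_le.1 hlt]
      have h1 := cdf_stdGaussian_neg (ha.trans hlt)
      rw [neg_neg] at h1
      have h2 := gaussTail_strictAnti ha hlt
      linarith
    · intro h
      rw [← cdf_stdGaussian_neg ha]
      exact monotone_cdf _ h
  rw [stdNormalQuantile, this, csInf_Ici]

/-- The tail equation determines the level and is the form in which quantiles enter everything that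
follows. Positivity holds because αk/n < 1. -/
theorem fdrLevel_spec {α : ℝ} (h0 : 0 < α) (h1 : α < 1) {n k : ℕ} (hk : 1 ≤ k) (hkn : k ≤ n) :
    0 < fdrLevel α n k ∧ gaussTail (fdrLevel α n k) = α * k / n := by
  have hn : (0 : ℝ) < n := by exact_mod_cast hk.trans hkn
  have hk' : (0 : ℝ) < k := by exact_mod_cast hk
  have hkn' : (k : ℝ) ≤ n := by exact_mod_cast hkn
  have hp : α * k / n < 1 := by
    rw [div_lt_one hn]; nlinarith
  obtain ⟨a, ha, hq⟩ := exists_gaussTail_eq (p := α * k / n) (by positivity) hp.le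
  have ha' : 0 < a := by
    rcases ha.eq_or_lt with rfl | h
    · rw [gaussTail_of_nonpos le_rfl] at hq; linarith
    · exact h
  have : fdrLevel α n k = a := by
    rw [fdrLevel, show α * k / (2 * n) = gaussTail a / 2 by rw [hq]; field_simp,
      stdNormalQuantile_half ha', neg_neg]
  rw [this]
  exact ⟨ha', hq⟩

theorem fdrLevel_anti {α : ℝ} (h0 : 0 < α) (h1 : α < 1) {n j k : ℕ} (hj : 1 ≤ j) (hjk : j ≤ k)
    (hkn : k ≤ n) : fdrLevel α n k ≤ fdrLevel α n j := by
  rcases hjk.eq_or_lt with rfl | h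
  · exact le_rfl
  refine (lt_of_gaussTail_lt ?_).le
  rw [(fdrLevel_spec h0 h1 hj (hjk.trans hkn)).2, (fdrLevel_spec h0 h1 (hj.trans hjk) hkn).2]
  have hn : (0 : ℝ) < n := by exact_mod_cast hj.trans (hjk.trans hkn)
  have : (j : ℝ) < k := by exact_mod_cast h
  gcongr

theorem stepUpThreshold_nonneg {α : ℝ} (h0 : 0 < α) (h1 : α < 1) {n : ℕ} (hn : 1 ≤ n)
    (x : Fin n → ℝ) : 0 ≤ stepUpThreshold α x := by
  unfold stepUpThreshold
  split_ifs with h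
  · refine (Finset.le_inf'_iff _ _).2 fun k hk => ?_
    rw [Finset.mem_filter, Finset.mem_Icc] at hk
    exact (fdrLevel_spec h0 h1 hk.1.1 hk.1.2).1.le
  · exact (fdrLevel_spec h0 h1 le_rfl hn).1.le

/-- The step-up threshold is at least `a` if no level below `a` is rejected. -/
theorem le_stepUpThreshold {α : ℝ} {n : ℕ} {x : Fin n → ℝ} {a : ℝ} (ha1 : a ≤ fdrLevel α n 1)
    (hlow : ∀ k ∈ Finset.Icc 1 n, fdrLevel α n k < a → exceedCount x (fdrLevel α n k) < k) :
    a ≤ stepUpThreshold α x := by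
  unfold stepUpThreshold
  split_ifs with h
  · refine (Finset.le_inf'_iff _ _).2 fun k hk => ?_
    rw [Finset.mem_filter] at hk
    by_contra hlt
    exact absurd hk.2 (not_le.2 (hlow k hk.1 (not_le.1 hlt)))
  · exact ha1

/-- The step-down threshold is at most the level `k₀` if all earlier levels are rejected. -/
theorem stepDownThreshold_le {α : ℝ} (h0 : 0 < α) (h1 : α < 1) {n : ℕ} {x : Fin n → ℝ} {k₀ : ℕ}
    (hk₀ : 1 ≤ k₀) (hk₀n : k₀ ≤ n)
    (hhigh : ∀ j ∈ Finset.Icc 2 k₀, j ≤ exceedCount x (fdrLevel α n j)) :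
    stepDownThreshold α x ≤ fdrLevel α n k₀ := by
  unfold stepDownThreshold
  split_ifs with h
  · refine (Finset.sup'_le_iff _ _).2 fun k hk => ?_
    rw [Finset.mem_filter, Finset.mem_Icc] at hk
    refine fdrLevel_anti h0 h1 hk₀ ?_ hk.1.2
    by_contra hlt
    -- The step-down rule at k tests level k + 1, so only the indices from 2 to k₀ matter and the
    -- first level is never examined.
    have := hhigh (k + 1) (Finset.mem_Icc.2 ⟨by omega, by omega⟩)
    omega
  · exact (fdrLevel_spec h0 h1 hk₀ hk₀n).1.le

/-! ### Pointwise comparison of losses in one component -/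

/-- The loss of soft thresholding in a single component. -/
noncomputable def coordLoss (lam x θ : ℝ) : ℝ := (softThreshold lam x - θ) ^ 2

theorem coordLoss_nonneg (lam x θ : ℝ) : 0 ≤ coordLoss lam x θ := sq_nonneg _

theorem softThreshold_neg (lam x : ℝ) : softThreshold lam (-x) = -softThreshold lam x := by
  simp [softThreshold, Real.sign_neg]

theorem coordLoss_neg (lam x θ : ℝ) : coordLoss lam (-x) (-θ) = coordLoss lam x θ := by
  rw [coordLoss, coordLoss, softThreshold_neg]; ring

theorem softThreshold_of_abs_le {lam x : ℝ} (h : |x| ≤ lam) : softThreshold lam x = 0 := by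
  rw [softThreshold, max_eq_right (by linarith), mul_zero]

theorem softThreshold_of_le {lam x : ℝ} (h0 : 0 ≤ lam) (h : lam ≤ x) :
    softThreshold lam x = x - lam := by
  rcases (h0.trans h).eq_or_lt with rfl | hx
  · rw [softThreshold_of_abs_le (by simpa using h0)]; linarith
  · rw [softThreshold, Real.sign_of_pos hx, abs_of_pos hx, max_eq_left (by linarith), one_mul]

theorem softThreshold_of_le_neg {lam x : ℝ} (h0 : 0 ≤ lam) (h : x ≤ -lam) :
    softThreshold lam x = x + lam := by
  have := softThreshold_of_le (x := -x) h0 (by linarith)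
  rw [softThreshold_neg] at this
  linarith

/-- Reduction of a statement about the loss in one component to a nonnegative mean. -/
theorem forall_of_nonneg_mean {p : ℝ → ℝ → Prop} (h : ∀ x θ, 0 ≤ θ → p x θ)
    (hneg : ∀ x θ, p (-x) (-θ) → p x θ) (x θ : ℝ) : p x θ := by
  rcases le_total 0 θ with hθ | hθ
  · exact h x θ hθ
  · exact hneg x θ (h _ _ (by linarith))

theorem coordLoss_of_abs_le {lam x : ℝ} (θ : ℝ) (h : |x| ≤ lam) : coordLoss lam x θ = θ ^ 2 := by
  rw [coordLoss, softThreshold_of_abs_le h]; ring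
theorem coordLoss_of_le {lam x : ℝ} (θ : ℝ) (h0 : 0 ≤ lam) (h : lam ≤ x) :
    coordLoss lam x θ = (x - θ - lam) ^ 2 := by
  rw [coordLoss, softThreshold_of_le h0 h]; ring
theorem coordLoss_of_le_neg {lam x : ℝ} (θ : ℝ) (h0 : 0 ≤ lam) (h : x ≤ -lam) :
    coordLoss lam x θ = (x - θ + lam) ^ 2 := by
  rw [coordLoss, softThreshold_of_le_neg h0 h]; ring

/-- For a nonnegative mean and a very negative observation a larger threshold is better. -/
theorem coordLoss_le_of_le_neg {lam lam' x θ : ℝ} (h0 : 0 ≤ lam) (hl : lam ≤ lam') (hθ : 0 ≤ θ)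
    (h : x ≤ -lam) : coordLoss lam' x θ ≤ coordLoss lam x θ := by
  rw [coordLoss_of_le_neg θ h0 h]
  rcases le_total x (-lam') with h' | h'
  · rw [coordLoss_of_le_neg θ (h0.trans hl) h']; nlinarith
  · rw [coordLoss_of_abs_le θ (abs_le.2 ⟨by linarith, by linarith⟩)]; nlinarith

/-- Lowering the threshold from `lam'` to `lam` costs at most the excess noise over `lam`. -/
theorem coordLoss_le_add_excess {lam lam' : ℝ} (h0 : 0 ≤ lam) (hl : lam ≤ lam') (x θ : ℝ) :
    coordLoss lam x θ ≤ coordLoss lam' x θ + max (|x - θ| - lam) 0 ^ 2 := by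
  revert x θ
  refine forall_of_nonneg_mean (fun x θ hθ => ?_) fun x θ h => by
    rwa [coordLoss_neg, coordLoss_neg, show -x - -θ = -(x - θ) by ring, abs_neg] at h
  have hm := le_max_right (|x - θ| - lam) 0
  rcases le_total (|x|) lam with hx | hx
  · rw [coordLoss_of_abs_le θ hx, coordLoss_of_abs_le θ (hx.trans hl)]
    nlinarith
  rcases le_total x 0 with hx0 | hx0
  · rw [abs_of_nonpos hx0] at hx
    rw [coordLoss_of_le_neg θ h0 (by linarith), abs_of_nonpos (by linarith),
      max_eq_left (by linarith)]
    nlinarith [coordLoss_nonneg lam' x θ]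
  · rw [abs_of_nonneg hx0] at hx
    rw [coordLoss_of_le θ h0 hx]
    rcases le_total lam (x - θ) with hz | hz
    · rw [abs_of_nonneg (by linarith), max_eq_left (by linarith)]
      nlinarith [coordLoss_nonneg lam' x θ]
    · rcases le_total lam' x with h' | h'
      · rw [coordLoss_of_le θ (h0.trans hl) h']; nlinarith
      · rw [coordLoss_of_abs_le θ (abs_le.2 ⟨by linarith, h'⟩)]; nlinarith

/-- Raising the threshold by a factor `1 + κ` raises the loss by a factor near one, up to terms
that are small unless the noise is of the order of the threshold. -/
theorem coordLoss_le_mul_add {lam lam' κ : ℝ} (h0 : 0 < lam) (hl : lam ≤ lam')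
    (hκ : lam' ≤ (1 + κ) * lam) (hκ2 : κ ≤ 1 / 2) (x θ : ℝ) :
    coordLoss lam' x θ ≤ (1 + 2 * κ) ^ 2 * coordLoss lam x θ +
      (min (θ ^ 2) (lam ^ 2) * {z : ℝ | lam / 2 ≤ |z|}.indicator (fun _ => (1 : ℝ)) (x - θ) +
      max (|x - θ| - lam') 0 ^ 2) := by
  have hκ0 : 0 ≤ κ := by nlinarith
  revert x θ
  refine forall_of_nonneg_mean (fun x θ hθ => ?_) fun x θ h => by
    have hs : {z : ℝ | lam / 2 ≤ |z|}.indicator (fun _ => (1 : ℝ)) (-(x - θ)) =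
      {z : ℝ | lam / 2 ≤ |z|}.indicator (fun _ => (1 : ℝ)) (x - θ) := by
        simp only [Set.indicator, Set.mem_ofPred_eq, abs_neg]
    rwa [coordLoss_neg, coordLoss_neg, show -x - -θ = -(x - θ) by ring, abs_neg, neg_sq, hs] at h
  have hone : 1 ≤ (1 + 2 * κ) ^ 2 := by nlinarith
  have hI : 0 ≤ {z : ℝ | lam / 2 ≤ |z|}.indicator (fun _ => (1 : ℝ)) (x - θ) :=
    Set.indicator_nonneg (fun _ _ => zero_le_one) _
  have hm : 0 ≤ max (|x - θ| - lam') 0 ^ 2 := by positivity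
  have hmin : 0 ≤ min (θ ^ 2) (lam ^ 2) := by positivity
  have hrest := add_nonneg (mul_nonneg hmin hI) hm
  rcases le_total (|x|) lam with hx | hx
  · rw [coordLoss_of_abs_le θ hx, coordLoss_of_abs_le θ (hx.trans hl)]
    nlinarith [sq_nonneg θ]
  rcases le_total x 0 with hx0 | hx0
  · rw [abs_of_nonpos hx0] at hx
    have := coordLoss_le_of_le_neg h0.le hl hθ (x := x) (by linarith)
    nlinarith [coordLoss_nonneg lam x θ]
  rw [abs_of_nonneg hx0] at hx
  rw [coordLoss_of_le θ h0.le hx]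
  -- If the noise is at most lam / 2, the error lam - (x - θ) is at least lam / 2, so adding κ lam
  -- enlarges it by a factor of at most 1 + 2κ. Larger positive noise is paid for by the remainder
  -- terms, where κ ≤ 1/2 keeps lam' - lam / 2 below lam.
  rcases le_or_gt (lam / 2) (|x - θ|) with hz | hz
  · rcases le_total (x - θ) (lam / 2) with hz1 | hz1
    · -- the noise is at most `lam / 2`, hence at most `-lam / 2`
      have key : coordLoss lam' x θ ≤ ((1 + 2 * κ) * (lam - (x - θ))) ^ 2 := by
        rcases le_total lam' x with h' | h'
        · rw [coordLoss_of_le θ (h0.le.trans hl) h', ← neg_sq]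
          exact pow_le_pow_left₀ (by linarith) (by nlinarith) 2
        · rw [coordLoss_of_abs_le θ (abs_le.2 ⟨by linarith, h'⟩)]
          exact pow_le_pow_left₀ hθ (by nlinarith) 2
      nlinarith
    · have hone' : {z : ℝ | lam / 2 ≤ |z|}.indicator (fun _ => (1 : ℝ)) (x - θ) = 1 :=
        Set.indicator_of_mem (show x - θ ∈ {z : ℝ | lam / 2 ≤ |z|} from hz) _
      rw [hone', mul_one]
      have hnn := mul_nonneg (sq_nonneg (1 + 2 * κ)) (sq_nonneg (x - θ - lam))
      rcases le_total lam' x with h' | h'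
      · rw [coordLoss_of_le θ (h0.le.trans hl) h']
        rcases le_total lam' (x - θ) with hz2 | hz2
        · rw [abs_of_nonneg (by linarith), max_eq_left (by linarith)]; linarith
        · have : (x - θ - lam') ^ 2 ≤ min (θ ^ 2) (lam ^ 2) := by
            rw [← neg_sq]
            exact le_min (pow_le_pow_left₀ (by linarith) (by linarith) 2)
              (pow_le_pow_left₀ (by linarith) (by nlinarith) 2)
          linarith
      · rw [coordLoss_of_abs_le θ (abs_le.2 ⟨by linarith, h'⟩)]
        have : θ ^ 2 ≤ min (θ ^ 2) (lam ^ 2) :=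
          le_min le_rfl (pow_le_pow_left₀ hθ (by nlinarith) 2)
        linarith
  · have hz1 := (abs_lt.1 hz).2
    have key : coordLoss lam' x θ ≤ ((1 + 2 * κ) * (lam - (x - θ))) ^ 2 := by
      rcases le_total lam' x with h' | h'
      · rw [coordLoss_of_le θ (h0.le.trans hl) h', ← neg_sq]
        exact pow_le_pow_left₀ (by linarith) (by nlinarith) 2
      · rw [coordLoss_of_abs_le θ (abs_le.2 ⟨by linarith, h'⟩)]
        exact pow_le_pow_left₀ hθ (by nlinarith) 2
    nlinarith

/-- Raising the threshold from `lam` to `lam'` costs at most a multiple of the truncated excess of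
the squared observation. -/
theorem coordLoss_le_add_sq_excess {lam lam' : ℝ} (h0 : 0 ≤ lam) (hl : lam ≤ lam') (x θ : ℝ) :
    coordLoss lam' x θ ≤ coordLoss lam x θ +
      (3 * max (min (x ^ 2) (lam' ^ 2) - lam ^ 2) 0 + max (|x - θ| - lam) 0 ^ 2) := by
  revert x θ
  refine forall_of_nonneg_mean (fun x θ hθ => ?_) fun x θ h => by
    rwa [coordLoss_neg, coordLoss_neg, show -x - -θ = -(x - θ) by ring, abs_neg, neg_sq] at h
  have hm1 : 0 ≤ max (min (x ^ 2) (lam' ^ 2) - lam ^ 2) 0 := le_max_right _ _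
  have hm2 : 0 ≤ max (|x - θ| - lam) 0 ^ 2 := by positivity
  rcases le_total (|x|) lam with hx | hx
  · rw [coordLoss_of_abs_le θ hx, coordLoss_of_abs_le θ (hx.trans hl)]
    linarith
  rcases le_total x 0 with hx0 | hx0
  · rw [abs_of_nonpos hx0] at hx
    have := coordLoss_le_of_le_neg h0 hl hθ (x := x) (by linarith)
    linarith
  rw [abs_of_nonneg hx0] at hx
  rw [coordLoss_of_le θ h0 hx]
  -- the loss at `lam'` is the loss at `m = min x lam'`
  obtain ⟨m, hlm, hm', hml⟩ : ∃ m, lam ≤ m ∧ min (x ^ 2) (lam' ^ 2) = m ^ 2 ∧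
      coordLoss lam' x θ = (x - θ - m) ^ 2 := by
    rcases le_total lam' x with h' | h'
    · exact ⟨lam', hl, min_eq_right (pow_le_pow_left₀ (h0.trans hl) h' 2),
        coordLoss_of_le θ (h0.trans hl) h'⟩
    · refine ⟨x, hx, min_eq_left (pow_le_pow_left₀ hx0 h' 2), ?_⟩
      rw [coordLoss_of_abs_le θ (abs_le.2 ⟨by linarith, h'⟩)]; ring
  rw [hml, hm', max_eq_left (by nlinarith)]
  rcases le_total (-lam) (x - θ) with hz | hz
  · nlinarith
  · rw [abs_of_nonpos (by linarith), max_eq_left (by linarith)]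
    nlinarith [sq_nonneg (-(x - θ) - lam - (m - lam))]

/-- Noise of at most -1 and shrinkage pull a nonnegative mean the same way: the estimate is at most
zero, or it misses θ by at least one. The probability of such noise is the constant in
`min_mul_le_coordRisk`. -/
theorem coordLoss_ge_of_le_neg_one {lam x θ : ℝ} (h0 : 0 ≤ lam) (hθ : 0 ≤ θ) (hz : x - θ ≤ -1) :
    min (θ ^ 2) 1 ≤ coordLoss lam x θ := by
  rcases le_total (|x|) lam with hx | hx
  · rw [coordLoss_of_abs_le θ hx]; exact min_le_left _ _
  rcases le_total x 0 with hx0 | hx0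
  · rw [abs_of_nonpos hx0] at hx
    rw [coordLoss_of_le_neg θ h0 (by linarith)]
    exact (min_le_left _ _).trans (by nlinarith)
  · rw [abs_of_nonneg hx0] at hx
    rw [coordLoss_of_le θ h0 hx]
    exact (min_le_right _ _).trans (by nlinarith)

theorem one_le_coordLoss {lam x θ : ℝ} (h0 : 0 ≤ lam) (hθ : |θ| ≤ 1) (hx : lam + 2 ≤ |x|) :
    1 ≤ coordLoss lam x θ := by
  have := abs_le.1 hθ
  rcases le_total x 0 with hx0 | hx0
  · rw [abs_of_nonpos hx0] at hx
    rw [coordLoss_of_le_neg θ h0 (by linarith)]; nlinarith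
  · rw [abs_of_nonneg hx0] at hx
    rw [coordLoss_of_le θ h0 (by linarith)]; nlinarith

theorem coordLoss_le_sq {lam : ℝ} (h0 : 0 ≤ lam) (x θ : ℝ) :
    coordLoss lam x θ ≤ (lam + |x - θ|) ^ 2 := by
  revert x θ
  refine forall_of_nonneg_mean (fun x θ hθ => ?_) fun x θ h => by
    rwa [coordLoss_neg, show -x - -θ = -(x - θ) by ring, abs_neg] at h
  have hz := abs_le.1 (le_refl |x - θ|)
  rcases le_total (|x|) lam with hx | hx
  · rw [coordLoss_of_abs_le θ hx]
    have := abs_le.1 hx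
    exact pow_le_pow_left₀ hθ (by linarith) 2
  rcases le_total x 0 with hx0 | hx0
  · rw [abs_of_nonpos hx0] at hx
    rw [coordLoss_of_le_neg θ h0 (by linarith)]
    exact sq_le_sq' (by linarith) (by linarith)
  · rw [abs_of_nonneg hx0] at hx
    rw [coordLoss_of_le θ h0 hx]
    exact sq_le_sq' (by linarith) (by linarith)

theorem measurable_real_sign : Measurable Real.sign := by
  unfold Real.sign
  exact Measurable.ite measurableSet_Iio measurable_const
    (Measurable.ite measurableSet_Ioi measurable_const measurable_const)

theorem measurable_softThreshold : Measurable fun p : ℝ × ℝ => softThreshold p.1 p.2 := by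
  unfold softThreshold
  exact (measurable_real_sign.comp measurable_snd).mul (by fun_prop)

theorem measurable_coordLoss (lam θ : ℝ) : Measurable fun x => coordLoss lam x θ :=
  ((measurable_softThreshold.comp (measurable_const.prodMk measurable_id)).sub_const θ).pow_const 2

theorem softLoss_eq_sum {n : ℕ} (lam : ℝ) (x θ : Fin n → ℝ) :
    softLoss lam x θ = ∑ i, coordLoss lam (x i) (θ i) := rfl

theorem softLoss_nonneg {n : ℕ} (lam : ℝ) (x θ : Fin n → ℝ) : 0 ≤ softLoss lam x θ :=
  Finset.sum_nonneg fun _ _ => sq_nonneg _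

theorem integrable_sq_shift (θ : ℝ) :
    Integrable (fun x : ℝ => (x - θ) ^ 2) (gaussianReal θ 1) :=
  integrable_gaussianReal_shift θ integrable_sq_stdGaussian

theorem integral_sq_shift (θ : ℝ) : ∫ x : ℝ, (x - θ) ^ 2 ∂(gaussianReal θ 1) = 1 :=
  (integral_gaussianReal_shift θ _).trans integral_sq_stdGaussian

theorem integrable_coordLoss {lam : ℝ} (h0 : 0 ≤ lam) (θ : ℝ) :
    Integrable (fun x => coordLoss lam x θ) (gaussianReal θ 1) := by
  have h : Integrable (fun x : ℝ => 2 * lam ^ 2 + 2 * (x - θ) ^ 2) (gaussianReal θ 1) :=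
    (integrable_const _).add ((integrable_sq_shift θ).const_mul 2)
  refine h.mono' (measurable_coordLoss lam θ).aestronglyMeasurable (Eventually.of_forall fun x => ?_)
  rw [Real.norm_of_nonneg (coordLoss_nonneg _ _ _)]
  refine (coordLoss_le_sq h0 x θ).trans ?_
  rw [← sq_abs (x - θ)]
  nlinarith [sq_nonneg (lam - |x - θ|)]

/-! ### Risk, signal size and expected exceedances -/

/-- The risk of soft thresholding in a single component. -/
noncomputable def coordRisk (lam θ : ℝ) : ℝ := ∫ x, coordLoss lam x θ ∂(gaussianReal θ 1)

/-- The risk of soft thresholding with a deterministic threshold. -/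
noncomputable def softRisk {n : ℕ} (lam : ℝ) (θ : Fin n → ℝ) : ℝ := ∑ i, coordRisk lam (θ i)

/-- The expected number of observations whose absolute value is at least `t`. -/
noncomputable def meanExceed {n : ℕ} (θ : Fin n → ℝ) (t : ℝ) : ℝ := ∑ i, exceedProb (θ i) t

/-- The size `∑ min (θ_i ^ 2) 1` of the mean vector. -/
noncomputable def signalSize {n : ℕ} (θ : Fin n → ℝ) : ℝ := ∑ i, min (θ i ^ 2) 1

theorem coordRisk_nonneg (lam θ : ℝ) : 0 ≤ coordRisk lam θ :=
  integral_nonneg fun _ => coordLoss_nonneg _ _ _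
theorem softRisk_nonneg {n : ℕ} (lam : ℝ) (θ : Fin n → ℝ) : 0 ≤ softRisk lam θ :=
  Finset.sum_nonneg fun _ _ => coordRisk_nonneg _ _
theorem signalSize_nonneg {n : ℕ} (θ : Fin n → ℝ) : 0 ≤ signalSize θ :=
  Finset.sum_nonneg fun _ _ => by positivity
theorem meanExceed_nonneg {n : ℕ} (θ : Fin n → ℝ) (t : ℝ) : 0 ≤ meanExceed θ t :=
  Finset.sum_nonneg fun _ _ => exceedProb_nonneg _ _
theorem meanExceed_anti {n : ℕ} (θ : Fin n → ℝ) {s t : ℝ} (h : s ≤ t) :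
    meanExceed θ t ≤ meanExceed θ s :=
  Finset.sum_le_sum fun _ _ => exceedProb_anti _ h
theorem meanExceed_le_card {n : ℕ} (θ : Fin n → ℝ) (t : ℝ) : meanExceed θ t ≤ n := by
  refine (Finset.sum_le_sum fun i _ => exceedProb_le_one (θ i) t).trans ?_
  simp
theorem meanExceed_le {n : ℕ} (θ : Fin n → ℝ) (t : ℝ) :
    meanExceed θ t ≤ n * gaussTail t + signalSize θ := by
  refine (Finset.sum_le_sum fun i _ => exceedProb_le (θ i) t).trans ?_
  simp [Finset.sum_add_distrib, signalSize]
theorem le_meanExceed {n : ℕ} (θ : Fin n → ℝ) (t : ℝ) : n * gaussTail t ≤ meanExceed θ t := by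
  refine le_trans ?_ (Finset.sum_le_sum fun i _ => gaussTail_le_exceedProb (θ i) t)
  simp
theorem meanExceed_mul_gaussTail_le {n : ℕ} (θ : Fin n → ℝ) {s t : ℝ} (ht : 0 ≤ t) (hst : s ≤ t) :
    meanExceed θ s * gaussTail t ≤ meanExceed θ t * gaussTail s := by
  rw [meanExceed, meanExceed, Finset.sum_mul, Finset.sum_mul]
  exact Finset.sum_le_sum fun i _ => exceedProb_mul_gaussTail_le ht hst (θ i)

theorem coordRisk_neg (lam θ : ℝ) : coordRisk lam (-θ) = coordRisk lam θ := by
  have h := gaussianReal_map_neg (μ := θ) (v := 1)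
  rw [coordRisk, coordRisk, ← h]
  refine ((MeasurableEquiv.neg ℝ).measurableEmbedding.integral_map _).trans ?_
  simp [coordLoss_neg]

/-- The risk in each component is at least of the order of `min (θ ^ 2) 1`. -/
theorem min_mul_le_coordRisk {lam : ℝ} (h0 : 0 ≤ lam) (θ : ℝ) :
    gaussTail 1 / 2 * min (θ ^ 2) 1 ≤ coordRisk lam θ := by
  wlog hθ : 0 ≤ θ generalizing θ
  · have := this (-θ) (by linarith)
    rwa [neg_sq, coordRisk_neg] at this
  have hm : MeasurableSet {z : ℝ | z ≤ -1} := measurableSet_Iic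
  have hp : (gaussianReal 0 1).real {z : ℝ | z ≤ -1} = gaussTail 1 / 2 := by
    rw [← cdf_stdGaussian_neg one_pos, cdf_eq_real]; rfl
  have h1 := integral_gaussianReal_shift θ ({z : ℝ | z ≤ -1}.indicator fun _ => (1 : ℝ))
  rw [integral_indicator_const' _ hm, hp] at h1
  have hi : Integrable (fun x => {z : ℝ | z ≤ -1}.indicator (fun _ => (1 : ℝ)) (x - θ))
      (gaussianReal θ 1) :=
    integrable_of_bdd ((measurable_const.indicator hm).comp (measurable_id.sub_const θ))
      (C := 1) fun x => abs_indicator_one_le _ _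
  rw [← h1, ← integral_mul_const]
  refine integral_mono (hi.mul_const _) (integrable_coordLoss h0 θ) fun x => ?_
  simp only
  by_cases hx : x - θ ≤ -1
  · rw [Set.indicator_of_mem (show x - θ ∈ {z : ℝ | z ≤ -1} from hx), one_mul]
    exact coordLoss_ge_of_le_neg_one h0 hθ hx
  · rw [Set.indicator_of_notMem (show x - θ ∉ {z : ℝ | z ≤ -1} from hx), zero_mul]
    exact coordLoss_nonneg _ _ _

theorem signalSize_le {n : ℕ} {lam : ℝ} (h0 : 0 ≤ lam) (θ : Fin n → ℝ) :
    signalSize θ ≤ 2 / gaussTail 1 * softRisk lam θ := by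
  have hq := gaussTail_pos 1
  have : gaussTail 1 / 2 * signalSize θ ≤ softRisk lam θ := by
    rw [signalSize, Finset.mul_sum]
    exact Finset.sum_le_sum fun i _ => min_mul_le_coordRisk h0 (θ i)
  rw [div_mul_eq_mul_div, le_div_iff₀ hq]
  linarith

theorem integrable_excess_shift {a : ℝ} (ha : 0 ≤ a) (θ : ℝ) :
    Integrable (fun x : ℝ => max (|x - θ| - a) 0 ^ 2) (gaussianReal θ 1) :=
  integrable_gaussianReal_shift θ (integrable_excess_sq ha)

theorem integral_excess_shift (a θ : ℝ) :
    ∫ x, max (|x - θ| - a) 0 ^ 2 ∂(gaussianReal θ 1) = gaussExcess a :=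
  integral_gaussianReal_shift θ fun z => max (|z| - a) 0 ^ 2

theorem integrable_tail_shift (t θ : ℝ) :
    Integrable (fun x : ℝ => {z : ℝ | t ≤ |z|}.indicator (fun _ => (1 : ℝ)) (x - θ))
      (gaussianReal θ 1) :=
  integrable_of_bdd ((measurable_const.indicator (measurableSet_le_abs t)).comp
    (measurable_id.sub_const θ)) (C := 1) fun _ => abs_indicator_one_le _ _

theorem integral_tail_shift (t θ : ℝ) :
    ∫ x, {z : ℝ | t ≤ |z|}.indicator (fun _ => (1 : ℝ)) (x - θ) ∂(gaussianReal θ 1) =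
      gaussTail t :=
  (integral_gaussianReal_shift θ _).trans (gaussTail_eq_integral t).symm

/-- Lets all remainders be measured by `signalSize`, whose definition does not involve the
threshold. -/
theorem min_sq_le_mul {θ lam T : ℝ} (hT : 1 ≤ T) (h0 : 0 ≤ lam) (h : lam ≤ T) :
    min (θ ^ 2) (lam ^ 2) ≤ T ^ 2 * min (θ ^ 2) 1 := by
  have hT2 : 1 ≤ T ^ 2 := by nlinarith
  rcases le_total (θ ^ 2) 1 with h1 | h1
  · rw [min_eq_left h1]
    exact (min_le_left _ _).trans (by nlinarith [sq_nonneg θ])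
  · rw [min_eq_right h1, mul_one]
    exact (min_le_right _ _).trans (pow_le_pow_left₀ h0 h 2)

theorem softRisk_le_mul_add {n : ℕ} {lam lam' κ : ℝ} (h1 : 1 ≤ lam) (hl : lam ≤ lam')
    (hκ : lam' ≤ (1 + κ) * lam) (hκ2 : κ ≤ 1 / 2) (θ : Fin n → ℝ) :
    softRisk lam' θ ≤ (1 + 2 * κ) ^ 2 * softRisk lam θ +
      (signalSize θ * (lam ^ 2 * gaussTail (lam / 2)) + n * gaussExcess lam') := by
  have h0 : 0 < lam := by linarith
  have : ∀ i, coordRisk lam' (θ i) ≤ (1 + 2 * κ) ^ 2 * coordRisk lam (θ i) +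
      (min (θ i ^ 2) 1 * (lam ^ 2 * gaussTail (lam / 2)) + gaussExcess lam') := fun i => by
    have hA := integrable_coordLoss h0.le (θ i)
    have hA' := integrable_coordLoss (h0.le.trans hl) (θ i)
    have hB := (integrable_tail_shift (lam / 2) (θ i)).const_mul (min (θ i ^ 2) (lam ^ 2))
    have hC := integrable_excess_shift (h0.le.trans hl) (θ i)
    have hBC : Integrable (fun x => min (θ i ^ 2) (lam ^ 2) *
        {z : ℝ | lam / 2 ≤ |z|}.indicator (fun _ => (1 : ℝ)) (x - θ i) +
        max (|x - θ i| - lam') 0 ^ 2) (gaussianReal (θ i) 1) := hB.add hC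
    calc coordRisk lam' (θ i) ≤ ∫ x, ((1 + 2 * κ) ^ 2 * coordLoss lam x (θ i) +
        (min (θ i ^ 2) (lam ^ 2) *
          {z : ℝ | lam / 2 ≤ |z|}.indicator (fun _ => (1 : ℝ)) (x - θ i) +
        max (|x - θ i| - lam') 0 ^ 2)) ∂(gaussianReal (θ i) 1) :=
          integral_mono hA' ((hA.const_mul _).add hBC) fun x =>
            coordLoss_le_mul_add h0 hl hκ hκ2 x (θ i)
      _ = (1 + 2 * κ) ^ 2 * coordRisk lam (θ i) +
          (min (θ i ^ 2) (lam ^ 2) * gaussTail (lam / 2) + gaussExcess lam') := by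
          rw [integral_add (hA.const_mul _) hBC, integral_add hB hC, integral_const_mul,
            integral_const_mul, integral_tail_shift, integral_excess_shift, coordRisk]
      _ ≤ _ := by
          have h2 := mul_le_mul_of_nonneg_right (min_sq_le_mul (θ := θ i) h1 h0.le le_rfl)
            (gaussTail_nonneg (lam / 2))
          linarith
  refine (Finset.sum_le_sum fun i _ => this i).trans (le_of_eq ?_)
  simp [Finset.sum_add_distrib, softRisk, signalSize, Finset.mul_sum, Finset.sum_mul]

/-- Raising the threshold to a level at which the expected number of exceedances is comparable to
that of pure noise hardly increases the risk. -/
theorem softRisk_max_le {n : ℕ} {lam ξ B : ℝ} (h0 : 0 ≤ lam) (hξ : 0 ≤ ξ) (hB : 0 ≤ B)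
    (θ : Fin n → ℝ) (hexc : meanExceed θ ξ ≤ B * gaussTail ξ) :
    softRisk (max ξ lam) θ ≤ softRisk lam θ + (3 * B * gaussSqExcess lam + n * gaussExcess lam) := by
  have hw := gaussSqExcess_nonneg lam
  have hv := gaussExcess_nonneg lam
  rcases le_total ξ lam with h | h
  · rw [max_eq_right h]
    have : 0 ≤ 3 * B * gaussSqExcess lam + n * gaussExcess lam := by positivity
    linarith
  rw [max_eq_left h]
  -- Truncation at ξ makes f constant beyond ξ, as the likelihood ratio comparison requires.
  -- Removing it under the null law only enlarges the bound.
  set f : ℝ → ℝ := fun x => max (min (x ^ 2) (ξ ^ 2) - lam ^ 2) 0 with hf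
  have hfm : Measurable f := by fun_prop
  have hf0 : ∀ x, 0 ≤ f x := fun x => le_max_right _ _
  have hfc : ∀ x, f x ≤ max (ξ ^ 2 - lam ^ 2) 0 := fun x =>
    max_le_max (by linarith [min_le_right (x ^ 2) (ξ ^ 2)]) le_rfl
  have hfi : ∀ η, Integrable f (gaussianReal η 1) := fun η =>
    integrable_of_bdd hfm fun x => by rw [abs_of_nonneg (hf0 x)]; exact hfc x
  have hmlr : ∀ i, (∫ x, f x ∂(gaussianReal (θ i) 1)) * gaussTail ξ ≤
      exceedProb (θ i) ξ * gaussSqExcess lam := fun i => by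
    refine (integral_mul_gaussTail_le hfm hf0 hξ (fun x => by simp [hf]) (fun x hx => ?_) hfc
      (θ i)).trans ?_
    · have : ξ ^ 2 ≤ x ^ 2 := by rw [← sq_abs x]; exact pow_le_pow_left₀ hξ hx 2
      simp only [hf, min_eq_right this]
    · refine mul_le_mul_of_nonneg_left ?_ (exceedProb_nonneg _ _)
      exact integral_mono (hfi 0) (integrable_sq_excess lam) fun x =>
        max_le_max (by linarith [min_le_left (x ^ 2) (ξ ^ 2)]) le_rfl
  have hsum : ∑ i, ∫ x, f x ∂(gaussianReal (θ i) 1) ≤ B * gaussSqExcess lam := by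
    have h1 : (∑ i, ∫ x, f x ∂(gaussianReal (θ i) 1)) * gaussTail ξ ≤
        meanExceed θ ξ * gaussSqExcess lam := by
      rw [meanExceed, Finset.sum_mul, Finset.sum_mul]
      exact Finset.sum_le_sum fun i _ => hmlr i
    have h2 := mul_le_mul_of_nonneg_right hexc hw
    refine le_of_mul_le_mul_right ?_ (gaussTail_pos ξ)
    linarith
  have hc : ∀ i, coordRisk ξ (θ i) ≤ coordRisk lam (θ i) +
      (3 * ∫ x, f x ∂(gaussianReal (θ i) 1) + gaussExcess lam) := fun i => by
    have hA := integrable_coordLoss h0 (θ i)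
    have hA' := integrable_coordLoss hξ (θ i)
    have hB := (hfi (θ i)).const_mul 3
    have hC := integrable_excess_shift h0 (θ i)
    have hBC : Integrable (fun x => 3 * f x + max (|x - θ i| - lam) 0 ^ 2)
      (gaussianReal (θ i) 1) := hB.add hC
    rw [coordRisk, coordRisk, ← integral_excess_shift lam (θ i), ← integral_const_mul,
      ← integral_add hB hC, ← integral_add hA hBC]
    exact integral_mono hA' (hA.add hBC) fun x => coordLoss_le_add_sq_excess h0 h x (θ i)
  refine (Finset.sum_le_sum fun i _ => hc i).trans ?_
  simp only [Finset.sum_add_distrib, ← Finset.mul_sum, Finset.sum_const, Finset.card_univ,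
    Fintype.card_fin, nsmul_eq_mul]
  rw [softRisk]
  linarith

/-! ### The normal means model and exponential moments of the exceedance count -/

/-- The data `X` have independent components `X_i ~ N(θ_i, 1)` under `P`. -/
structure NormalMeans {Ω : Type*} [MeasurableSpace Ω] (P : Measure Ω) {n : ℕ} (X : Ω → Fin n → ℝ)
    (θ : Fin n → ℝ) : Prop where
  measurable : Measurable X
  indep : iIndepFun (fun i ω => X ω i) P
  law : ∀ i, HasLaw (fun ω => X ω i) (gaussianReal (θ i) 1) P

namespace NormalMeans

variable {Ω : Type*} [MeasurableSpace Ω] {P : Measure Ω} {n : ℕ}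
  {X : Ω → Fin n → ℝ} {θ : Fin n → ℝ}

theorem measurable_apply (h : NormalMeans P X θ) (i : Fin n) : Measurable fun ω => X ω i :=
  (measurable_pi_apply i).comp h.measurable

theorem integral_comp (h : NormalMeans P X θ) (i : Fin n) {f : ℝ → ℝ} (hf : Measurable f) :
    ∫ ω, f (X ω i) ∂P = ∫ x, f x ∂(gaussianReal (θ i) 1) :=
  (h.law i).integral_comp hf.aestronglyMeasurable

theorem integrable_comp (h : NormalMeans P X θ) (i : Fin n) {f : ℝ → ℝ}
    (hf : Integrable f (gaussianReal (θ i) 1)) : Integrable (fun ω => f (X ω i)) P := by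
  have := hf
  rw [← (h.law i).map_eq] at this
  exact this.comp_aemeasurable (h.law i).aemeasurable

theorem integrable_softLoss (h : NormalMeans P X θ) {lam : ℝ} (h0 : 0 ≤ lam) :
    Integrable (fun ω => softLoss lam (X ω) θ) P :=
  integrable_finsetSum _ fun i _ => h.integrable_comp i (integrable_coordLoss h0 (θ i))

theorem integral_sum_comp (h : NormalMeans P X θ) {f : Fin n → ℝ → ℝ} (hf : ∀ i, Measurable (f i))
    (hi : ∀ i, Integrable (f i) (gaussianReal (θ i) 1)) :
    ∫ ω, ∑ i, f i (X ω i) ∂P = ∑ i, ∫ x, f i x ∂(gaussianReal (θ i) 1) := by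
  rw [integral_finsetSum _ fun i _ => h.integrable_comp i (hi i)]
  exact Finset.sum_congr rfl fun i _ => h.integral_comp i (hf i)

theorem integral_softLoss (h : NormalMeans P X θ) {lam : ℝ} (h0 : 0 ≤ lam) :
    ∫ ω, softLoss lam (X ω) θ ∂P = softRisk lam θ :=
  h.integral_sum_comp (fun i => measurable_coordLoss lam (θ i))
    fun i => integrable_coordLoss h0 (θ i)

end NormalMeans

theorem exceedCount_eq_sum {n : ℕ} (x : Fin n → ℝ) (t : ℝ) :
    (exceedCount x t : ℝ) = ∑ i, {z : ℝ | t ≤ |z|}.indicator (fun _ => (1 : ℝ)) (x i) := by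
  simp [exceedCount, Set.indicator]

theorem exceedCount_le {n : ℕ} (x : Fin n → ℝ) (t : ℝ) : exceedCount x t ≤ n := by
  simpa [exceedCount] using Finset.card_filter_le (Finset.univ : Finset (Fin n)) fun i => t ≤ |x i|

theorem exp_mul_indicator (s : ℝ) (A : Set ℝ) (x : ℝ) :
    Real.exp (s * A.indicator (fun _ => (1 : ℝ)) x) =
      1 + (Real.exp s - 1) * A.indicator (fun _ => (1 : ℝ)) x := by
  by_cases h : x ∈ A <;> simp [h]

theorem integral_exp_mul_indicator (s t θ : ℝ) :
    ∫ x, Real.exp (s * {z : ℝ | t ≤ |z|}.indicator (fun _ => (1 : ℝ)) x) ∂(gaussianReal θ 1) =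
      1 + (Real.exp s - 1) * exceedProb θ t := by
  have hi : Integrable ({z : ℝ | t ≤ |z|}.indicator (fun _ => (1 : ℝ))) (gaussianReal θ 1) :=
    integrable_of_bdd (measurable_const.indicator (measurableSet_le_abs t)) (abs_indicator_one_le _)
  simp_rw [exp_mul_indicator]
  rw [integral_add (integrable_const _) (hi.const_mul _), integral_const_mul,
    exceedProb_eq_integral]
  simp

namespace NormalMeans

variable {Ω : Type*} [MeasurableSpace Ω] {P : Measure Ω} {n : ℕ}
  {X : Ω → Fin n → ℝ} {θ : Fin n → ℝ}

theorem measurable_exceedCount (h : NormalMeans P X θ) (t : ℝ) :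
    Measurable fun ω => (exceedCount (X ω) t : ℝ) := by
  simp_rw [exceedCount_eq_sum]
  exact Finset.measurable_sum _ fun i _ =>
    (measurable_const.indicator (measurableSet_le_abs t)).comp (h.measurable_apply i)

theorem exp_count_le (s c t : ℝ) (x : Fin n → ℝ) :
    Real.exp (s * exceedCount x t + c) ≤ Real.exp (|s| * n + c) := by
  refine Real.exp_le_exp.2 ?_
  have h1 : (exceedCount x t : ℝ) ≤ n := by exact_mod_cast exceedCount_le x t
  have h2 : (0 : ℝ) ≤ exceedCount x t := by positivity
  nlinarith [le_abs_self s, abs_nonneg s]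

theorem integrable_mul_exp_count (h : NormalMeans P X θ) {g : Ω → ℝ} (hg : Integrable g P)
    (s c t : ℝ) : Integrable (fun ω => g ω * Real.exp (s * exceedCount (X ω) t + c)) P := by
  refine hg.mul_bdd (c := Real.exp (|s| * n + c)) ?_ (Eventually.of_forall fun ω => ?_)
  · exact (Real.measurable_exp.comp
      (((h.measurable_exceedCount t).const_mul s).add_const c)).aestronglyMeasurable
  · rw [Real.norm_of_nonneg (Real.exp_pos _).le]
    exact exp_count_le s c t (X ω)

/-- Exponential moments of the number of exceedances, decoupled from a single component. -/
theorem integral_mul_exp_count_le (h : NormalMeans P X θ) (i : Fin n) {f : ℝ → ℝ}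
    (hf : Measurable f) (hf0 : ∀ x, 0 ≤ f x) (hfi : Integrable f (gaussianReal (θ i) 1)) {s : ℝ}
    (hs : s ≤ 1) (t : ℝ) :
    ∫ ω, f (X ω i) * Real.exp (s * exceedCount (X ω) t) ∂P ≤
      (∫ x, f x ∂(gaussianReal (θ i) 1)) * Real.exp (1 + (Real.exp s - 1) * meanExceed θ t) := by
  set I := {z : ℝ | t ≤ |z|}.indicator (fun _ => (1 : ℝ)) with hI
  have hIm : Measurable I := measurable_const.indicator (measurableSet_le_abs t)
  -- The factor f is attached to component i, so the whole integrand is a product over independent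
  -- components.
  set G : Fin n → ℝ → ℝ := fun k x => (if k = i then f x else 1) * Real.exp (s * I x) with hG
  have hGm : ∀ k, Measurable (G k) := fun k => by
    by_cases hk : k = i
    · simp only [hG, hk, if_true]; fun_prop
    · simp only [hG, hk, if_false]; fun_prop
  have hprod : ∀ ω, f (X ω i) * Real.exp (s * exceedCount (X ω) t) = ∏ k, G k (X ω k) := fun ω => by
    rw [exceedCount_eq_sum, Finset.mul_sum, Real.exp_sum, Finset.prod_mul_distrib]
    congr 1
    rw [Finset.prod_ite_eq' Finset.univ i fun k => f (X ω k)]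
    simp
  simp_rw [hprod]
  have hind : iIndepFun (fun k ω => G k (X ω k)) P := h.indep.comp G hGm
  rw [hind.integral_fun_prod_eq_prod_integral fun k =>
    ((hGm k).comp (h.measurable_apply k)).aestronglyMeasurable]
  have hfac : ∀ k, ∫ ω, G k (X ω k) ∂P ≤
      (if k = i then (∫ x, f x ∂(gaussianReal (θ i) 1)) * Real.exp 1 else 1) *
        Real.exp ((Real.exp s - 1) * exceedProb (θ k) t) := fun k => by
    rw [h.integral_comp k (hGm k)]
    by_cases hk : k = i
    · subst hk
      simp only [hG, if_true]
      have hp0 := exceedProb_nonneg (θ k) t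
      have hp1 := exceedProb_le_one (θ k) t
      -- In component i, f and the indicator are dependent, so the exponential is bounded by max 1
      -- (exp s). The extra 1 in the final exponent pays for this, since the probability lies in [0,
      -- 1] and s ≤ 1.
      have hmul : ∫ x, f x * Real.exp (s * I x) ∂(gaussianReal (θ k) 1) ≤
          (∫ x, f x ∂(gaussianReal (θ k) 1)) * max 1 (Real.exp s) := by
        rw [← integral_mul_const]
        have hb : ∀ x, Real.exp (s * I x) ≤ max 1 (Real.exp s) := fun x => by
          by_cases hx : x ∈ {z : ℝ | t ≤ |z|}
          · rw [hI, Set.indicator_of_mem hx]; simp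
          · rw [hI, Set.indicator_of_notMem hx]; simp
        refine integral_mono (hfi.mul_bdd (c := max 1 (Real.exp s)) (by fun_prop)
          (Eventually.of_forall fun x => ?_)) (hfi.mul_const _) fun x =>
            mul_le_mul_of_nonneg_left (hb x) (hf0 x)
        rw [Real.norm_of_nonneg (Real.exp_pos _).le]; exact hb x
      refine hmul.trans ?_
      rw [mul_assoc, ← Real.exp_add]
      refine mul_le_mul_of_nonneg_left (max_le ?_ ?_) (integral_nonneg hf0)
      · refine Real.one_le_exp ?_
        nlinarith [Real.exp_pos s]
      · refine Real.exp_le_exp.2 ?_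
        rcases le_total 0 s with h0 | h0
        · have := Real.one_le_exp h0; nlinarith
        · have := Real.exp_pos s; nlinarith
    · simp only [hG, hk, if_false, one_mul]
      rw [integral_exp_mul_indicator, add_comm]
      exact Real.add_one_le_exp _
  refine (Finset.prod_le_prod (fun k _ => ?_) fun k _ => hfac k).trans (le_of_eq ?_)
  · refine integral_nonneg fun ω => mul_nonneg ?_ (Real.exp_pos _).le
    split_ifs
    · exact hf0 _
    · exact zero_le_one
  · rw [Finset.prod_mul_distrib, Finset.prod_ite_eq' Finset.univ i, ← Real.exp_sum,
      ← Finset.mul_sum, Real.exp_add]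
    simp [meanExceed, mul_assoc]

theorem integral_sum_mul_exp_count_le (h : NormalMeans P X θ) {f : Fin n → ℝ → ℝ}
    (hf : ∀ i, Measurable (f i)) (hf0 : ∀ i x, 0 ≤ f i x)
    (hfi : ∀ i, Integrable (f i) (gaussianReal (θ i) 1)) {s : ℝ} (hs : s ≤ 1) (c t : ℝ) :
    ∫ ω, (∑ i, f i (X ω i)) * Real.exp (s * exceedCount (X ω) t + c) ∂P ≤
      (∑ i, ∫ x, f i x ∂(gaussianReal (θ i) 1)) *
        Real.exp (1 + c + (Real.exp s - 1) * meanExceed θ t) := by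
  simp_rw [Finset.sum_mul]
  rw [integral_finsetSum _ fun i _ =>
    h.integrable_mul_exp_count (h.integrable_comp i (hfi i)) s c t]
  refine Finset.sum_le_sum fun i _ => ?_
  simp_rw [Real.exp_add _ c, ← mul_assoc]
  rw [integral_mul_const]
  refine (mul_le_mul_of_nonneg_right (h.integral_mul_exp_count_le i (hf i) (hf0 i) (hfi i) hs t)
    (Real.exp_pos c).le).trans (le_of_eq ?_)
  rw [mul_assoc, ← Real.exp_add]
  congr 2; ring

theorem integral_softLoss_mul_exp_count_le (h : NormalMeans P X θ) {lam : ℝ} (h0 : 0 ≤ lam) {s : ℝ}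
    (hs : s ≤ 1) (c t : ℝ) :
    ∫ ω, softLoss lam (X ω) θ * Real.exp (s * exceedCount (X ω) t + c) ∂P ≤
      softRisk lam θ * Real.exp (1 + c + (Real.exp s - 1) * meanExceed θ t) :=
  h.integral_sum_mul_exp_count_le (fun i => measurable_coordLoss lam (θ i))
    (fun i x => coordLoss_nonneg lam x (θ i)) (fun i => integrable_coordLoss h0 (θ i)) hs c t

theorem integral_sq_mul_exp_count_le (h : NormalMeans P X θ) {s : ℝ} (hs : s ≤ 1) (c t : ℝ) :
    ∫ ω, (∑ i, (X ω i - θ i) ^ 2) * Real.exp (s * exceedCount (X ω) t + c) ∂P ≤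
      n * Real.exp (1 + c + (Real.exp s - 1) * meanExceed θ t) := by
  have := h.integral_sum_mul_exp_count_le (f := fun i x => (x - θ i) ^ 2)
    (fun i => by fun_prop) (fun i x => sq_nonneg _) (fun i => integrable_sq_shift (θ i)) hs c t
  simpa [integral_sq_shift] using this

end NormalMeans

/-! ### Minimum loss and minimum risk -/

theorem continuous_softLoss {n : ℕ} (x θ : Fin n → ℝ) :
    Continuous fun lam : ℝ => softLoss lam x θ := by
  unfold softLoss softThreshold
  fun_prop

theorem measurable_softLoss {n : ℕ} (lam : ℝ) (θ : Fin n → ℝ) :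
    Measurable fun x : Fin n → ℝ => softLoss lam x θ :=
  Finset.measurable_sum _ fun i _ => (measurable_coordLoss lam (θ i)).comp (measurable_pi_apply i)

theorem bddBelow_softLoss {n : ℕ} (x θ : Fin n → ℝ) :
    BddBelow (Set.range fun lam : ℝ≥0 => softLoss (lam : ℝ) x θ) :=
  ⟨0, by rintro _ ⟨lam, rfl⟩; exact softLoss_nonneg _ _ _⟩

/-- Continuity in the threshold reduces the infimum to a countable dense set. -/
theorem measurable_minSoftLoss {n : ℕ} (θ : Fin n → ℝ) :
    Measurable fun x : Fin n → ℝ => minSoftLoss x θ := by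
  obtain ⟨s, hsc, hsd⟩ := TopologicalSpace.exists_countable_dense ℝ≥0
  have : Countable s := hsc
  have heq : (fun x : Fin n → ℝ => minSoftLoss x θ) =
      fun x => ⨅ lam : s, softLoss ((lam : ℝ≥0) : ℝ) x θ := by
    ext x
    exact (hsd.ciInf' (f := fun lam : ℝ≥0 => softLoss (lam : ℝ) x θ)
      ((continuous_softLoss x θ).comp NNReal.continuous_coe)).symm
  rw [heq]
  exact Measurable.iInf fun lam => measurable_softLoss _ θ

theorem minSoftLoss_nonneg {n : ℕ} (x θ : Fin n → ℝ) : 0 ≤ minSoftLoss x θ :=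
  Real.iInf_nonneg fun _ => softLoss_nonneg _ _ _

theorem minSoftLoss_le {n : ℕ} {lam : ℝ} (h0 : 0 ≤ lam) (x θ : Fin n → ℝ) :
    minSoftLoss x θ ≤ softLoss lam x θ :=
  ciInf_le (bddBelow_softLoss x θ) ⟨lam, h0⟩

theorem le_minSoftLoss {n : ℕ} {x θ : Fin n → ℝ} {c : ℝ}
    (h : ∀ lam, 0 ≤ lam → c ≤ softLoss lam x θ) : c ≤ minSoftLoss x θ :=
  le_ciInf fun lam => h lam lam.2

namespace NormalMeans

variable {Ω : Type*} [MeasurableSpace Ω] {P : Measure Ω} {n : ℕ}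
  {X : Ω → Fin n → ℝ} {θ : Fin n → ℝ}

theorem integrable_minSoftLoss (h : NormalMeans P X θ) :
    Integrable (fun ω => minSoftLoss (X ω) θ) P := by
  refine (h.integrable_softLoss le_rfl).mono'
    ((measurable_minSoftLoss θ).comp h.measurable).aestronglyMeasurable
    (Eventually.of_forall fun ω => ?_)
  rw [Real.norm_of_nonneg (minSoftLoss_nonneg _ _)]
  exact minSoftLoss_le le_rfl _ _

theorem minSoftRisk_eq (h : NormalMeans P X θ) :
    minSoftRisk P X θ = ⨅ lam : ℝ≥0, softRisk (lam : ℝ) θ := by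
  unfold minSoftRisk
  congr 1; ext lam
  exact h.integral_softLoss lam.2

theorem minSoftRisk_le (h : NormalMeans P X θ) {lam : ℝ} (h0 : 0 ≤ lam) :
    minSoftRisk P X θ ≤ softRisk lam θ := by
  rw [h.minSoftRisk_eq]
  exact ciInf_le (f := fun lam : ℝ≥0 => softRisk (lam : ℝ) θ)
    ⟨0, by rintro _ ⟨lam, rfl⟩; exact softRisk_nonneg _ _⟩ ⟨lam, h0⟩

theorem le_minSoftRisk (h : NormalMeans P X θ) {c : ℝ} (hc : ∀ lam, 0 ≤ lam → c ≤ softRisk lam θ) :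
    c ≤ minSoftRisk P X θ := by
  rw [h.minSoftRisk_eq]
  exact le_ciInf fun lam => hc lam lam.2

theorem signalSize_le_minSoftRisk (h : NormalMeans P X θ) :
    signalSize θ ≤ 2 / gaussTail 1 * minSoftRisk P X θ := by
  have hq := gaussTail_pos 1
  have : gaussTail 1 / 2 * signalSize θ ≤ minSoftRisk P X θ := h.le_minSoftRisk fun lam h0 => by
    have := signalSize_le h0 θ
    rw [div_mul_eq_mul_div, le_div_iff₀ hq] at this
    linarith
  rw [div_mul_eq_mul_div, le_div_iff₀ hq]
  linarith

end NormalMeans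

/-! ### The reference threshold is nearly optimal, in risk and in loss -/

/-- A small threshold incurs a loss for nearly every large observation. -/
theorem exceedCount_sub_le_softLoss {n : ℕ} {lam b : ℝ} (h0 : 0 ≤ lam) (hb : lam + 2 ≤ b)
    (x θ : Fin n → ℝ) : (exceedCount x b : ℝ) - signalSize θ ≤ softLoss lam x θ := by
  rw [exceedCount_eq_sum, signalSize, ← Finset.sum_sub_distrib, softLoss_eq_sum]
  refine Finset.sum_le_sum fun i _ => ?_
  have hnn := coordLoss_nonneg lam (x i) (θ i)
  -- A component with |θ_i| ≥ 1 contributes a full unit to `signalSize`, which cancels its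
  -- indicator; the others really lose one unit when they exceed b.
  rcases le_total (|θ i|) 1 with h1 | h1
  · have hmin : 0 ≤ min (θ i ^ 2) 1 := by positivity
    by_cases hx : b ≤ |x i|
    · rw [Set.indicator_of_mem (show x i ∈ {z : ℝ | b ≤ |z|} from hx)]
      linarith [one_le_coordLoss h0 h1 (hb.trans hx)]
    · rw [Set.indicator_of_notMem (show x i ∉ {z : ℝ | b ≤ |z|} from hx)]
      linarith
  · have : 1 ≤ θ i ^ 2 := by rw [← sq_abs]; nlinarith
    rw [min_eq_right this]
    linarith [le_of_abs_le (abs_indicator_one_le {z : ℝ | b ≤ |z|} (x i))]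

/-- The remainder term in the comparison of the loss at a reference threshold with the loss at
other thresholds that are not much smaller. -/
noncomputable def compareRem {n : ℕ} (μ lam₀ : ℝ) (x θ : Fin n → ℝ) : ℝ :=
  ∑ i, (lam₀ ^ 2 * min (θ i ^ 2) 1 *
    {z : ℝ | μ / 2 ≤ |z|}.indicator (fun _ => (1 : ℝ)) (x i - θ i) +
    max (|x i - θ i| - lam₀) 0 ^ 2)

theorem compareRem_nonneg {n : ℕ} (μ lam₀ : ℝ) (x θ : Fin n → ℝ) : 0 ≤ compareRem μ lam₀ x θ :=
  Finset.sum_nonneg fun i _ => add_nonneg (mul_nonneg (by positivity)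
    (Set.indicator_nonneg (fun _ _ => zero_le_one) _)) (by positivity)

theorem softLoss_le_mul_add_compareRem {n : ℕ} {μ lam lam₀ κ : ℝ} (h1 : 1 ≤ μ) (hμ : μ ≤ lam)
    (hμ₀ : μ ≤ lam₀) (hκ : lam₀ ≤ (1 + κ) * μ) (hκ2 : κ ≤ 1 / 2) (x θ : Fin n → ℝ) :
    softLoss lam₀ x θ ≤ (1 + 2 * κ) ^ 2 * softLoss lam x θ + compareRem μ lam₀ x θ := by
  have hκ0 : 0 ≤ κ := by nlinarith
  rw [softLoss_eq_sum, softLoss_eq_sum, compareRem, Finset.mul_sum, ← Finset.sum_add_distrib]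
  refine Finset.sum_le_sum fun i _ => ?_
  have hI : 0 ≤ {z : ℝ | μ / 2 ≤ |z|}.indicator (fun _ => (1 : ℝ)) (x i - θ i) :=
    Set.indicator_nonneg (fun _ _ => zero_le_one) _
  -- Below `lam₀` the assumption μ ≤ lam bounds the ratio of thresholds. Above it, lowering the
  -- threshold costs only excess noise.
  rcases le_total lam lam₀ with h | h
  · refine (coordLoss_le_mul_add (by linarith) h (by nlinarith) hκ2 (x i) (θ i)).trans ?_
    have h2 := min_sq_le_mul (θ := θ i) (by linarith : (1 : ℝ) ≤ lam₀) (by linarith) h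
    have h3 : {z : ℝ | lam / 2 ≤ |z|}.indicator (fun _ => (1 : ℝ)) (x i - θ i) ≤
        {z : ℝ | μ / 2 ≤ |z|}.indicator (fun _ => (1 : ℝ)) (x i - θ i) :=
      Set.indicator_le_indicator_of_subset
        (fun z hz => le_trans (by linarith) (show lam / 2 ≤ |z| from hz))
        (fun _ => zero_le_one) _
    have h4 := mul_le_mul h2 h3 (Set.indicator_nonneg (fun _ _ => zero_le_one) _) (by positivity)
    linarith
  · have h2 := coordLoss_le_add_excess (by linarith : 0 ≤ lam₀) h (x i) (θ i)
    have h3 : 1 ≤ (1 + 2 * κ) ^ 2 := by nlinarith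
    have h4 := mul_nonneg (mul_nonneg (sq_nonneg lam₀) (by positivity : 0 ≤ min (θ i ^ 2) 1)) hI
    have h5 := mul_le_mul_of_nonneg_right h3 (coordLoss_nonneg lam (x i) (θ i))
    linarith

/-- A loss above the level `c` is controlled by the excess noise and by products of losses in
different components. -/
theorem softLoss_le_of_lt {n : ℕ} {lam c : ℝ} (h0 : 0 ≤ lam) (hc : 0 < c) (hc2 : 16 * lam ^ 2 ≤ c)
    (x θ : Fin n → ℝ) (hY : c < softLoss lam x θ) :
    softLoss lam x θ ≤ 8 * ∑ i, max ((x i - θ i) ^ 2 - lam ^ 2) 0 +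
      2 / c * ∑ i, ∑ k ∈ Finset.univ.erase i, coordLoss lam (x i) (θ i) * coordLoss lam (x k) (θ k) := by
  set l : Fin n → ℝ := fun i => coordLoss lam (x i) (θ i) with hl
  have hl0 : ∀ i, 0 ≤ l i := fun i => coordLoss_nonneg _ _ _
  have hsum : softLoss lam x θ = ∑ i, l i := rfl
  rw [hsum, Finset.mul_sum, Finset.mul_sum, ← Finset.sum_add_distrib]
  rw [hsum] at hY
  refine Finset.sum_le_sum fun i _ => ?_
  rw [← Finset.mul_sum]
  have herase : ∑ k ∈ Finset.univ.erase i, l k = ∑ k, l k - l i :=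
    (Finset.sum_erase_eq_sub (Finset.mem_univ i))
  rw [herase]
  have hm : 0 ≤ max ((x i - θ i) ^ 2 - lam ^ 2) 0 := le_max_right _ _
  -- If l i ≤ c / 2 the other components together exceed c / 2, so the product term dominates l i.
  -- Otherwise l i ≥ 8 lam², which forces the squared noise well above lam².
  rcases le_total (l i) (c / 2) with h | h
  · have : l i ≤ 2 / c * (l i * (∑ k, l k - l i)) := by
      rw [div_mul_eq_mul_div, le_div_iff₀ hc]
      nlinarith [hl0 i]
    linarith
  · have h1 : l i ≤ 2 * lam ^ 2 + 2 * (x i - θ i) ^ 2 := by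
      refine (coordLoss_le_sq h0 (x i) (θ i)).trans ?_
      rw [← sq_abs (x i - θ i)]
      nlinarith [sq_nonneg (lam - |x i - θ i|)]
    have h2 : l i ≤ 8 * max ((x i - θ i) ^ 2 - lam ^ 2) 0 := by
      nlinarith [le_max_left ((x i - θ i) ^ 2 - lam ^ 2) 0]
    have h3 : 0 ≤ 2 / c * (l i * (∑ k, l k - l i)) := by
      rw [← herase]
      exact mul_nonneg (by positivity) (mul_nonneg (hl0 i) (Finset.sum_nonneg fun k _ => hl0 k))
    linarith

namespace NormalMeans

variable {Ω : Type*} [MeasurableSpace Ω] {P : Measure Ω} {n : ℕ}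
  {X : Ω → Fin n → ℝ} {θ : Fin n → ℝ}

theorem integrable_compareRem (h : NormalMeans P X θ) (μ : ℝ) {lam₀ : ℝ} (h0 : 0 ≤ lam₀) :
    Integrable (fun ω => compareRem μ lam₀ (X ω) θ) P :=
  integrable_finsetSum _ fun i _ => h.integrable_comp i
    (((integrable_tail_shift (μ / 2) (θ i)).const_mul _).add (integrable_excess_shift h0 (θ i)))

theorem integral_compareRem (h : NormalMeans P X θ) (μ : ℝ) {lam₀ : ℝ} (h0 : 0 ≤ lam₀) :
    ∫ ω, compareRem μ lam₀ (X ω) θ ∂P =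
      signalSize θ * (lam₀ ^ 2 * gaussTail (μ / 2)) + n * gaussExcess lam₀ := by
  unfold compareRem
  have hA : ∀ i, Integrable (fun x => lam₀ ^ 2 * min (θ i ^ 2) 1 *
    {z : ℝ | μ / 2 ≤ |z|}.indicator (fun _ => (1 : ℝ)) (x - θ i)) (gaussianReal (θ i) 1) :=
    fun i => (integrable_tail_shift (μ / 2) (θ i)).const_mul _
  have hB := fun i => integrable_excess_shift h0 (θ i)
  rw [h.integral_sum_comp (f := fun i x => lam₀ ^ 2 * min (θ i ^ 2) 1 *
    {z : ℝ | μ / 2 ≤ |z|}.indicator (fun _ => (1 : ℝ)) (x - θ i) + max (|x - θ i| - lam₀) 0 ^ 2)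
    (fun i => ?_) fun i => (hA i).add (hB i)]
  · have : ∀ i, ∫ x, (lam₀ ^ 2 * min (θ i ^ 2) 1 *
        {z : ℝ | μ / 2 ≤ |z|}.indicator (fun _ => (1 : ℝ)) (x - θ i) +
        max (|x - θ i| - lam₀) 0 ^ 2) ∂(gaussianReal (θ i) 1) =
        min (θ i ^ 2) 1 * (lam₀ ^ 2 * gaussTail (μ / 2)) + gaussExcess lam₀ := fun i => by
      rw [integral_add (hA i) (hB i), integral_const_mul, integral_tail_shift,
        integral_excess_shift]
      ring
    rw [Finset.sum_congr rfl fun i _ => this i]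
    simp [Finset.sum_add_distrib, signalSize, Finset.sum_mul]
  · exact (((measurable_const.indicator (measurableSet_le_abs _)).comp
      (measurable_id.sub_const _)).const_mul _).add (by fun_prop)

theorem integral_exceedCount (h : NormalMeans P X θ) (t : ℝ) :
    ∫ ω, (exceedCount (X ω) t : ℝ) ∂P = meanExceed θ t := by
  simp_rw [exceedCount_eq_sum]
  rw [h.integral_sum_comp (f := fun _ => {z : ℝ | t ≤ |z|}.indicator (fun _ => (1 : ℝ)))
    (fun i => measurable_const.indicator (measurableSet_le_abs t)) fun i =>
      integrable_of_bdd (measurable_const.indicator (measurableSet_le_abs t))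
        (abs_indicator_one_le _)]
  simp_rw [← exceedProb_eq_integral]
  rfl

theorem integrable_exceedCount (h : NormalMeans P X θ) (t : ℝ) :
    Integrable (fun ω => (exceedCount (X ω) t : ℝ)) P := by
  simp_rw [exceedCount_eq_sum]
  exact integrable_finsetSum _ fun i _ => h.integrable_comp i
    (integrable_of_bdd (measurable_const.indicator (measurableSet_le_abs t))
        (abs_indicator_one_le _))

/-- The risk at a reference threshold is nearly minimal. -/
theorem softRisk_le_minSoftRisk [IsProbabilityMeasure P] (h : NormalMeans P X θ) {μ b lam₀ κ : ℝ}
    (h1 : 1 ≤ μ) (hb : μ + 2 ≤ b) (hμ₀ : μ ≤ lam₀) (hκ : lam₀ ≤ (1 + κ) * μ) (hκ2 : κ ≤ 1 / 2)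
    (hlarge : minSoftRisk P X θ < meanExceed θ b - signalSize θ) :
    softRisk lam₀ θ ≤ (1 + 2 * κ) ^ 2 * minSoftRisk P X θ +
      (signalSize θ * (lam₀ ^ 2 * gaussTail (μ / 2)) + n * gaussExcess lam₀) := by
  have hκ0 : 0 ≤ κ := by nlinarith
  set K := (1 + 2 * κ) ^ 2 with hK
  have hKpos : 0 < K := by positivity
  set w := signalSize θ * (lam₀ ^ 2 * gaussTail (μ / 2)) + n * gaussExcess lam₀ with hw
  -- Thresholds up to μ are bounded below by the first entry, the others by the second. The first
  -- exceeds the minimum risk by assumption, so only the second can be active.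
  have hmin : min (meanExceed θ b - signalSize θ) ((softRisk lam₀ θ - w) / K) ≤
      minSoftRisk P X θ := h.le_minSoftRisk fun lam h0 => by
    rcases le_total lam μ with hl | hl
    · refine (min_le_left _ _).trans ?_
      have h2 : ∫ ω, ((exceedCount (X ω) b : ℝ) - signalSize θ) ∂P ≤
          ∫ ω, softLoss lam (X ω) θ ∂P :=
        integral_mono ((h.integrable_exceedCount b).sub (integrable_const _))
          (h.integrable_softLoss h0) fun ω =>
            exceedCount_sub_le_softLoss h0 (by linarith) (X ω) θ
      rw [integral_sub (h.integrable_exceedCount b) (integrable_const _),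
        h.integral_exceedCount, h.integral_softLoss h0] at h2
      simpa using h2
    · refine (min_le_right _ _).trans ?_
      have hl0 : 0 ≤ lam₀ := by linarith
      have h2 : ∫ ω, softLoss lam₀ (X ω) θ ∂P ≤
          ∫ ω, (K * softLoss lam (X ω) θ + compareRem μ lam₀ (X ω) θ) ∂P :=
        integral_mono (h.integrable_softLoss hl0) (((h.integrable_softLoss h0).const_mul K).add
          (h.integrable_compareRem μ hl0)) fun ω =>
            softLoss_le_mul_add_compareRem h1 hl hμ₀ hκ hκ2 (X ω) θ
      rw [integral_add ((h.integrable_softLoss h0).const_mul K) (h.integrable_compareRem μ hl0),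
        integral_const_mul, h.integral_softLoss h0, h.integral_softLoss hl0,
        h.integral_compareRem μ hl0] at h2
      rw [div_le_iff₀ hKpos]
      linarith
  rcases min_le_iff.1 hmin with h2 | h2
  · linarith
  · rw [div_le_iff₀ hKpos] at h2
    linarith

theorem integrable_coordLoss_mul (h : NormalMeans P X θ) {lam : ℝ} (h0 : 0 ≤ lam) {i k : Fin n}
    (hik : i ≠ k) :
    Integrable (fun ω => coordLoss lam (X ω i) (θ i) * coordLoss lam (X ω k) (θ k)) P :=
  ((h.indep.indepFun hik).comp (measurable_coordLoss lam (θ i))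
    (measurable_coordLoss lam (θ k))).integrable_mul
    (h.integrable_comp i (integrable_coordLoss h0 (θ i)))
    (h.integrable_comp k (integrable_coordLoss h0 (θ k)))

theorem integral_coordLoss_mul (h : NormalMeans P X θ) (lam : ℝ) {i k : Fin n} (hik : i ≠ k) :
    ∫ ω, coordLoss lam (X ω i) (θ i) * coordLoss lam (X ω k) (θ k) ∂P =
      coordRisk lam (θ i) * coordRisk lam (θ k) := by
  have hind := (h.indep.indepFun hik).comp (measurable_coordLoss lam (θ i))
    (measurable_coordLoss lam (θ k))
  have := hind.integral_fun_mul_eq_mul_integral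
    ((measurable_coordLoss lam (θ i)).comp (h.measurable_apply i)).aestronglyMeasurable
    ((measurable_coordLoss lam (θ k)).comp (h.measurable_apply k)).aestronglyMeasurable
  refine this.trans ?_
  congr 1
  · exact h.integral_comp i (measurable_coordLoss lam (θ i))
  · exact h.integral_comp k (measurable_coordLoss lam (θ k))

/-- The expected minimum loss is nearly as large as the risk at a reference threshold. -/
theorem softRisk_sub_le_integral_minSoftLoss (h : NormalMeans P X θ)
    {μ b lam₀ κ c : ℝ} (h1 : 1 ≤ μ) (hb : μ + 2 ≤ b) (hμ₀ : μ ≤ lam₀) (hκ : lam₀ ≤ (1 + κ) * μ)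
    (hκ2 : κ ≤ 1 / 2) (hc : 0 < c) (hc2 : 16 * lam₀ ^ 2 ≤ c) :
    softRisk lam₀ θ - (signalSize θ * (lam₀ ^ 2 * gaussTail (μ / 2)) + n * gaussExcess lam₀) -
      softRisk lam₀ θ * Real.exp (1 + (c + signalSize θ) - 3 / 5 * meanExceed θ b) -
      8 * n * gaussSqExcess lam₀ - 2 / c * softRisk lam₀ θ ^ 2 ≤
      (1 + 2 * κ) ^ 2 * ∫ ω, minSoftLoss (X ω) θ ∂P := by
  have hκ0 : 0 ≤ κ := by nlinarith
  have hl0 : 0 ≤ lam₀ := by linarith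
  set K := (1 + 2 * κ) ^ 2 with hK
  have hK1 : 1 ≤ K := by rw [hK]; nlinarith
  have hKpos : 0 < K := by positivity
  set S := signalSize θ with hS
  set Y : Ω → ℝ := fun ω => softLoss lam₀ (X ω) θ with hYdef
  set W : Ω → ℝ := fun ω => compareRem μ lam₀ (X ω) θ with hWdef
  set E : Ω → ℝ := fun ω => Y ω * Real.exp (-1 * exceedCount (X ω) b + (c + S)) with hEdef
  set T1 : Ω → ℝ := fun ω => ∑ i, max ((X ω i - θ i) ^ 2 - lam₀ ^ 2) 0 with hT1
  set T2 : Ω → ℝ := fun ω => ∑ i, ∑ k ∈ Finset.univ.erase i,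
    coordLoss lam₀ (X ω i) (θ i) * coordLoss lam₀ (X ω k) (θ k) with hT2
  have iY : Integrable Y P := h.integrable_softLoss hl0
  have iW : Integrable W P := h.integrable_compareRem μ hl0
  have iE : Integrable E P := h.integrable_mul_exp_count iY _ _ _
  have iq : ∀ i, Integrable (fun x : ℝ => max ((x - θ i) ^ 2 - lam₀ ^ 2) 0)
    (gaussianReal (θ i) 1) := fun i =>
      integrable_gaussianReal_shift (θ i) (integrable_sq_excess lam₀)
  have iT1 : Integrable T1 P := integrable_finsetSum _ fun i _ => h.integrable_comp i (iq i)
  have iT2 : Integrable T2 P := integrable_finsetSum _ fun i _ => integrable_finsetSum _ fun k hk =>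
    h.integrable_coordLoss_mul hl0 (Finset.ne_of_mem_erase hk).symm
  have eT1 : ∫ ω, T1 ω ∂P = n * gaussSqExcess lam₀ := by
    rw [hT1, h.integral_sum_comp (f := fun i x => max ((x - θ i) ^ 2 - lam₀ ^ 2) 0)
      (fun i => by fun_prop) iq]
    have : ∀ i, ∫ x, max ((x - θ i) ^ 2 - lam₀ ^ 2) 0 ∂(gaussianReal (θ i) 1) =
      gaussSqExcess lam₀ := fun i =>
        integral_gaussianReal_shift (θ i) fun z => max (z ^ 2 - lam₀ ^ 2) 0
    simp [this]
  have eT2 : ∫ ω, T2 ω ∂P ≤ softRisk lam₀ θ ^ 2 := by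
    rw [hT2, integral_finsetSum _ fun i _ => integrable_finsetSum _ fun k hk =>
      h.integrable_coordLoss_mul hl0 (Finset.ne_of_mem_erase hk).symm, sq, softRisk,
      Finset.sum_mul_sum]
    refine Finset.sum_le_sum fun i _ => ?_
    rw [integral_finsetSum _ fun k hk =>
      h.integrable_coordLoss_mul hl0 (Finset.ne_of_mem_erase hk).symm]
    refine (Finset.sum_congr rfl fun k hk =>
      h.integral_coordLoss_mul lam₀ (Finset.ne_of_mem_erase hk).symm).le.trans ?_
    exact Finset.sum_le_sum_of_subset_of_nonneg (Finset.erase_subset _ _) fun k _ _ =>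
      mul_nonneg (coordRisk_nonneg _ _) (coordRisk_nonneg _ _)
  have eE : ∫ ω, E ω ∂P ≤
      softRisk lam₀ θ * Real.exp (1 + (c + S) - 3 / 5 * meanExceed θ b) := by
    refine (h.integral_softLoss_mul_exp_count_le hl0 (by norm_num) (c + S) b).trans ?_
    refine mul_le_mul_of_nonneg_left (Real.exp_le_exp.2 ?_) (softRisk_nonneg _ _)
    -- The weight has s = -1, and 3/5 is a rational lower bound for 1 - 1/e.
    have he : Real.exp (-1) ≤ 2 / 5 := by
      rw [Real.exp_neg, inv_le_comm₀ (Real.exp_pos _) (by norm_num)]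
      linarith [Real.exp_one_gt_d9]
    nlinarith [meanExceed_nonneg θ b]
  -- For lam ≤ μ the loss is at least N(b) - S. This reaches Y unless Y exceeds c, which T1 and T2
  -- absorb, or N(b) < c + S, where the weight in E is at least one. For lam ≥ μ the remainder W
  -- suffices.
  have hpt : ∀ ω, Y ω - W ω - E ω - 8 * T1 ω - 2 / c * T2 ω ≤ K * minSoftLoss (X ω) θ := by
    intro ω
    have hY0 : 0 ≤ Y ω := softLoss_nonneg _ _ _
    have hW0 : 0 ≤ W ω := compareRem_nonneg _ _ _ _
    have hE0 : 0 ≤ E ω := mul_nonneg hY0 (Real.exp_pos _).le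
    have hT10 : 0 ≤ T1 ω := Finset.sum_nonneg fun _ _ => le_max_right _ _
    have hT20 : 0 ≤ 2 / c * T2 ω := mul_nonneg (by positivity)
      (Finset.sum_nonneg fun _ _ => Finset.sum_nonneg fun _ _ =>
        mul_nonneg (coordLoss_nonneg _ _ _) (coordLoss_nonneg _ _ _))
    rw [mul_comm K, ← div_le_iff₀ hKpos]
    refine le_minSoftLoss fun lam hlam => ?_
    rw [div_le_iff₀ hKpos, mul_comm]
    have hL0 := softLoss_nonneg lam (X ω) θ
    rcases le_total lam μ with hl | hl
    · have hN := exceedCount_sub_le_softLoss hlam (by linarith : lam + 2 ≤ b) (X ω) θ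
      have hLK : softLoss lam (X ω) θ ≤ K * softLoss lam (X ω) θ := le_mul_of_one_le_left hL0 hK1
      rcases lt_or_ge c (Y ω) with hcY | hcY
      · have := softLoss_le_of_lt hl0 hc hc2 (X ω) θ hcY
        have hYT : Y ω ≤ 8 * T1 ω + 2 / c * T2 ω := this
        linarith
      · rcases le_total (c + S) (exceedCount (X ω) b) with hN2 | hN2
        · linarith
        · have : Y ω ≤ E ω := le_mul_of_one_le_right hY0 (Real.one_le_exp (by linarith))
          linarith
    · have := softLoss_le_mul_add_compareRem h1 hl hμ₀ hκ hκ2 (X ω) θ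
      have hYW : Y ω ≤ K * softLoss lam (X ω) θ + W ω := this
      linarith
  have hint := integral_mono ((((iY.sub iW).sub iE).sub (iT1.const_mul 8)).sub
    (iT2.const_mul (2 / c))) (h.integrable_minSoftLoss.const_mul K) hpt
  rw [integral_const_mul] at hint
  have hsplit : ∫ ω, (Y ω - W ω - E ω - 8 * T1 ω - 2 / c * T2 ω) ∂P =
      ∫ ω, Y ω ∂P - ∫ ω, W ω ∂P - ∫ ω, E ω ∂P - 8 * ∫ ω, T1 ω ∂P - 2 / c * ∫ ω, T2 ω ∂P := by
    have i1 : Integrable (fun ω => Y ω - W ω) P := iY.sub iW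
    have i2 : Integrable (fun ω => Y ω - W ω - E ω) P := i1.sub iE
    have i3 : Integrable (fun ω => Y ω - W ω - E ω - 8 * T1 ω) P := i2.sub (iT1.const_mul 8)
    rw [integral_sub i3 (iT2.const_mul (2 / c)), integral_sub i2 (iT1.const_mul 8),
      integral_sub i1 iE, integral_sub iY iW, integral_const_mul, integral_const_mul]
  have eY : ∫ ω, Y ω ∂P = softRisk lam₀ θ := h.integral_softLoss hl0
  have eW := h.integral_compareRem μ hl0 (θ := θ)
  have hint' : ∫ ω, (Y ω - W ω - E ω - 8 * T1 ω - 2 / c * T2 ω) ∂P ≤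
    K * ∫ ω, minSoftLoss (X ω) θ ∂P := hint
  rw [hsplit, eY, eT1] at hint'
  have eW' : ∫ ω, W ω ∂P = S * (lam₀ ^ 2 * gaussTail (μ / 2)) + n * gaussExcess lam₀ := eW
  have h2c : 2 / c * ∫ ω, T2 ω ∂P ≤ 2 / c * softRisk lam₀ θ ^ 2 :=
    mul_le_mul_of_nonneg_left eT2 (by positivity)
  rw [eW'] at hint'
  linarith

end NormalMeans

/-! ### Confining the random threshold -/

theorem softLoss_le_add_excess {n : ℕ} {lam lam' : ℝ} (h0 : 0 ≤ lam) (hl : lam ≤ lam')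
    (x θ : Fin n → ℝ) :
    softLoss lam x θ ≤ softLoss lam' x θ + ∑ i, max (|x i - θ i| - lam) 0 ^ 2 := by
  rw [softLoss_eq_sum, softLoss_eq_sum, ← Finset.sum_add_distrib]
  exact Finset.sum_le_sum fun i _ => coordLoss_le_add_excess h0 hl (x i) (θ i)

/-- A crude form for rare events on which no positive lower bound on the threshold is available. -/
theorem softLoss_le_add_sq {n : ℕ} {lam lam' : ℝ} (h0 : 0 ≤ lam) (hl : lam ≤ lam')
    (x θ : Fin n → ℝ) :
    softLoss lam x θ ≤ softLoss lam' x θ + ∑ i, (x i - θ i) ^ 2 :=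
  (softLoss_le_add_excess h0 hl x θ).trans (add_le_add le_rfl
    (Finset.sum_le_sum fun i _ => excess_sq_le h0 (x i - θ i)))

/-- The index at which the expected number of exceedances becomes comparable to the level index. -/
theorem exists_levelIndex {n : ℕ} (hn : 1 ≤ n) (θ : Fin n → ℝ) {α M : ℝ} (h0 : 0 < α) (h1 : α < 1)
    (hM : 1 ≤ M) : ∃ k₀, 1 ≤ k₀ ∧ k₀ ≤ n ∧ meanExceed θ (fdrLevel α n k₀) ≤ 8 * M * k₀ ∧
      (k₀ = 1 ∨ (4 * M ≤ meanExceed θ (fdrLevel α n 1) ∧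
        ∀ j ∈ Finset.Icc 2 k₀, 4 * (j : ℝ) ≤ meanExceed θ (fdrLevel α n j))) := by
  classical
  set g : ℕ → ℝ := fun k => meanExceed θ (fdrLevel α n k) with hg
  rcases lt_or_ge (g 1) (4 * M) with hlt | hge
  · exact ⟨1, le_rfl, hn, by simp only [Nat.cast_one]; linarith, Or.inl rfl⟩
  -- The largest index with 4j ≤ g(ξ_j) is taken. Failure at k₀ + 1 gives g(ξ_{k₀}) < 4(k₀ + 1) ≤
  -- 8k₀; if k₀ = n, the trivial bound g ≤ n is enough.
  set s := (Finset.Icc 1 n).filter fun j : ℕ => 4 * (j : ℝ) ≤ g j with hs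
  have hne : s.Nonempty := ⟨1, by
    rw [hs, Finset.mem_filter, Finset.mem_Icc]
    exact ⟨⟨le_rfl, hn⟩, by simp only [Nat.cast_one]; linarith⟩⟩
  set k₀ := s.max' hne with hk₀
  have hk₀s : k₀ ∈ s := s.max'_mem hne
  rw [hs, Finset.mem_filter, Finset.mem_Icc] at hk₀s
  obtain ⟨⟨hk1, hkn⟩, hk4⟩ := hk₀s
  have hk1' : (1 : ℝ) ≤ k₀ := by exact_mod_cast hk1
  refine ⟨k₀, hk1, hkn, ?_, Or.inr ⟨hge, fun j hj => ?_⟩⟩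
  · rcases hkn.eq_or_lt with heq | hlt
    · have h2 := meanExceed_le_card θ (fdrLevel α n k₀)
      have h3 : (n : ℝ) = k₀ := by exact_mod_cast heq.symm
      nlinarith
    · have h2 : g k₀ ≤ g (k₀ + 1) :=
        meanExceed_anti θ (fdrLevel_anti h0 h1 hk1 (Nat.le_succ _) hlt)
      have h3 : g (k₀ + 1) < 4 * ((k₀ + 1 : ℕ) : ℝ) := by
        by_contra hcon
        have : k₀ + 1 ∈ s := by
          rw [hs, Finset.mem_filter, Finset.mem_Icc]
          exact ⟨⟨by omega, hlt⟩, not_lt.1 hcon⟩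
        have := s.le_max' _ this
        omega
      push_cast at h3
      have : g k₀ ≤ 8 * M * k₀ := by nlinarith
      exact this
  · rw [Finset.mem_Icc] at hj
    obtain ⟨hj0, hjq⟩ := fdrLevel_spec h0 h1 (by omega : 1 ≤ j) (hj.2.trans hkn)
    obtain ⟨hk0, hkq⟩ := fdrLevel_spec h0 h1 hk1 hkn
    -- Tails at the levels are proportional to the indices, so g(ξ_j)/j is nonincreasing and the
    -- inequality at k₀ passes to every smaller index.
    have hmlr := meanExceed_mul_gaussTail_le θ hj0.le
      (fdrLevel_anti h0 h1 (by omega : 1 ≤ j) hj.2 hkn)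
    rw [hjq, hkq] at hmlr
    have hn' : (0 : ℝ) < n := by exact_mod_cast hn
    have hαn : 0 < α / n := by positivity
    have h5 : g k₀ * j ≤ g j * k₀ := by
      have : α / n * (g k₀ * j) ≤ α / n * (g j * k₀) := by
        calc α / n * (g k₀ * j) = g k₀ * (α * j / n) := by ring
          _ ≤ g j * (α * k₀ / n) := hmlr
          _ = _ := by ring
      exact le_of_mul_le_mul_left this hαn
    have hj' : (0 : ℝ) ≤ j := by positivity
    have h6 : 4 * (j : ℝ) * k₀ ≤ g j * k₀ := by nlinarith
    exact le_of_mul_le_mul_right h6 (by linarith)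

theorem sum_exp_one_sub_le (k₀ : ℕ) : ∑ j ∈ Finset.Icc 2 k₀, Real.exp (1 - (j : ℝ)) ≤ 1 := by
  have he : Real.exp (-1) ≤ 1 / 2 := by
    rw [Real.exp_neg, inv_le_comm₀ (Real.exp_pos _) (by norm_num)]
    linarith [Real.exp_one_gt_d9]
  -- The induction needs the room exp(-k): each new term uses at most half of it, since exp(-1) ≤
  -- 1/2.
  have : ∀ k : ℕ, ∑ j ∈ Finset.Icc 2 (k + 1), Real.exp (1 - (j : ℝ)) ≤ 1 - Real.exp (-(k : ℝ)) := by
    intro k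
    induction k with
    | zero => simp
    | succ k ih =>
      rw [Finset.sum_Icc_succ_top (by omega)]
      have e1 : Real.exp (1 - ((k + 1 + 1 : ℕ) : ℝ)) = Real.exp (-(k : ℝ)) * Real.exp (-1) := by
        rw [← Real.exp_add]; congr 1; push_cast; ring
      have e2 : Real.exp (-((k + 1 : ℕ) : ℝ)) = Real.exp (-(k : ℝ)) * Real.exp (-1) := by
        rw [← Real.exp_add]; congr 1; push_cast; ring
      rw [e1, e2]
      nlinarith [Real.exp_pos (-(k : ℝ))]
  rcases k₀ with _ | k
  · simp
  · exact (this k).trans (by linarith [Real.exp_pos (-(k : ℝ))])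

/-- With s = (1 - α)/4 the mean factor (1 + α)/2 is 1 - 2s, and exp s - 1 ≤ s + s² leaves at most
-s². This is the Chernoff exponent per unit of k on the step-up side. -/
theorem exp_sub_one_mul_sub_le {α : ℝ} (h0 : 0 < α) (h1 : α < 1) :
    (Real.exp ((1 - α) / 4) - 1) * ((1 + α) / 2) - (1 - α) / 4 ≤ -((1 - α) ^ 2 / 16) := by
  set s := (1 - α) / 4 with hs
  have hs0 : 0 < s := by rw [hs]; linarith
  have hs1 : s ≤ 1 := by rw [hs]; linarith
  have h2 : Real.exp s - 1 ≤ s + s ^ 2 := by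
    have := Real.abs_exp_sub_one_sub_id_le (x := s) (by rw [abs_of_pos hs0]; exact hs1)
    linarith [le_abs_self (Real.exp s - 1 - s)]
  have hα : α = 1 - 4 * s := by rw [hs]; ring
  rw [hα]
  nlinarith

namespace NormalMeans

variable {Ω : Type*} [MeasurableSpace Ω] {P : Measure Ω} {n : ℕ}
  {X : Ω → Fin n → ℝ} {θ : Fin n → ℝ}

theorem integrable_sum_sq (h : NormalMeans P X θ) :
    Integrable (fun ω => ∑ i, (X ω i - θ i) ^ 2) P :=
  integrable_finsetSum _ fun i _ => h.integrable_comp i (integrable_sq_shift (θ i))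

theorem integrable_sum_excess (h : NormalMeans P X θ) {a : ℝ} (ha : 0 ≤ a) :
    Integrable (fun ω => ∑ i, max (|X ω i - θ i| - a) 0 ^ 2) P :=
  integrable_finsetSum _ fun i _ => h.integrable_comp i (integrable_excess_shift ha (θ i))

theorem integral_sum_excess (h : NormalMeans P X θ) {a : ℝ} (ha : 0 ≤ a) :
    ∫ ω, ∑ i, max (|X ω i - θ i| - a) 0 ^ 2 ∂P = n * gaussExcess a := by
  rw [h.integral_sum_comp (f := fun i x => max (|x - θ i| - a) 0 ^ 2) (fun i => by fun_prop)
    fun i => integrable_excess_shift ha (θ i)]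
  simp [integral_excess_shift]

theorem integrable_softLoss_random (h : NormalMeans P X θ) {lamHat : Ω → ℝ}
    (hm : Measurable lamHat) {lam' : ℝ} (hb : ∀ᵐ ω ∂P, 0 ≤ lamHat ω ∧ lamHat ω ≤ lam')
    (h0 : 0 ≤ lam') : Integrable (fun ω => softLoss (lamHat ω) (X ω) θ) P := by
  refine ((h.integrable_softLoss h0).add h.integrable_sum_sq).mono' ?_ ?_
  · refine (Finset.measurable_sum _ fun i _ => ?_).aestronglyMeasurable
    exact ((measurable_softThreshold.comp (hm.prodMk (h.measurable_apply i))).sub_const _).pow_const 2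
  · filter_upwards [hb] with ω hω
    rw [Real.norm_of_nonneg (softLoss_nonneg _ _ _)]
    exact softLoss_le_add_sq hω.1 hω.2 (X ω) θ

/-- The risk of a random threshold between a step-up and an inflated step-down threshold. -/
theorem integral_softLoss_random_le (h : NormalMeans P X θ) (hn : 1 ≤ n) {α₁ α₂ : ℝ}
    (hα₁ : 0 < α₁) (hα₁1 : α₁ < 1) (hα₂ : 0 < α₂) (hα₂1 : α₂ < 1) {lamHat : Ω → ℝ}
    (hm : Measurable lamHat) {a lam₀ κ : ℝ} (ha : 0 ≤ a) (hlam₀ : a ≤ lam₀) (hκ : 0 ≤ κ)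
    (hb : ∀ᵐ ω ∂P, stepUpThreshold α₁ (X ω) ≤ lamHat ω ∧
      lamHat ω ≤ (1 + κ) * stepDownThreshold α₂ (X ω))
    (ha1 : a ≤ fdrLevel α₁ n 1) {k₀ : ℕ} (hk1 : 1 ≤ k₀) (hkn : k₀ ≤ n) {s : ℝ} (hs0 : 0 ≤ s)
    (hs1 : s ≤ 1) :
    ∫ ω, softLoss (lamHat ω) (X ω) θ ∂P ≤
      softRisk ((1 + κ) * max (fdrLevel α₂ n k₀) lam₀) θ + n * gaussExcess a +
      softRisk ((1 + κ) * max (fdrLevel α₂ n 1) lam₀) θ *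
        ∑ j ∈ Finset.Icc 2 k₀, Real.exp (1 + j - 3 / 5 * meanExceed θ (fdrLevel α₂ n j)) +
      (softRisk ((1 + κ) * max (fdrLevel α₂ n 1) lam₀) θ + n) *
        ∑ k ∈ (Finset.Icc 1 n).filter (fun k => fdrLevel α₁ n k < a),
          Real.exp (1 + -(s * k) + (Real.exp s - 1) * meanExceed θ (fdrLevel α₁ n k)) := by
  set lamP := (1 + κ) * max (fdrLevel α₂ n k₀) lam₀ with hlamP
  set lamM := (1 + κ) * max (fdrLevel α₂ n 1) lam₀ with hlamM
  have hk1' : (0 : ℝ) ≤ 1 + κ := by linarith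
  have hPM0 : 0 ≤ lamP := mul_nonneg hk1' (le_max_of_le_right (ha.trans hlam₀))
  have hM0 : 0 ≤ lamM := mul_nonneg hk1' (le_max_of_le_right (ha.trans hlam₀))
  set K := (Finset.Icc 1 n).filter (fun k => fdrLevel α₁ n k < a) with hK
  set J := Finset.Icc 2 k₀ with hJ
  -- `Lo k` is at least one when a too low level k is rejected, and `Hi j` when level j is not, so
  -- they replace the indicators of the two kinds of failure.
  set Lo : ℕ → Ω → ℝ := fun k ω =>
    Real.exp (s * exceedCount (X ω) (fdrLevel α₁ n k) + -(s * k)) with hLo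
  set Hi : ℕ → Ω → ℝ := fun j ω =>
    Real.exp (-1 * exceedCount (X ω) (fdrLevel α₂ n j) + j) with hHi
  have hLo0 : ∀ k ω, 0 ≤ Lo k ω := fun k ω => (Real.exp_pos _).le
  have hHi0 : ∀ k ω, 0 ≤ Hi k ω := fun k ω => (Real.exp_pos _).le
  set Y : Ω → ℝ := fun ω => softLoss lamM (X ω) θ with hY
  set Q : Ω → ℝ := fun ω => ∑ i, (X ω i - θ i) ^ 2 with hQ
  set V : Ω → ℝ := fun ω => ∑ i, max (|X ω i - θ i| - a) 0 ^ 2 with hV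
  have hY0 : ∀ ω, 0 ≤ Y ω := fun ω => softLoss_nonneg _ _ _
  have hQ0 : ∀ ω, 0 ≤ Q ω := fun ω => Finset.sum_nonneg fun _ _ => sq_nonneg _
  have hV0 : ∀ ω, 0 ≤ V ω := fun ω => Finset.sum_nonneg fun _ _ => by positivity
  have iY : Integrable Y P := h.integrable_softLoss hM0
  have iP : Integrable (fun ω => softLoss lamP (X ω) θ) P := h.integrable_softLoss hPM0
  have iQ : Integrable Q P := h.integrable_sum_sq
  have iV : Integrable V P := h.integrable_sum_excess ha
  have iYHi : ∀ j ∈ J, Integrable (fun ω => Y ω * Hi j ω) P := fun j _ =>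
    h.integrable_mul_exp_count iY _ _ _
  have iYLo : ∀ k ∈ K, Integrable (fun ω => Y ω * Lo k ω) P := fun k _ =>
    h.integrable_mul_exp_count iY _ _ _
  have iQLo : ∀ k ∈ K, Integrable (fun ω => Q ω * Lo k ω) P := fun k _ =>
    h.integrable_mul_exp_count iQ _ _ _
  have hrange : ∀ᵐ ω ∂P, 0 ≤ lamHat ω ∧ lamHat ω ≤ lamM := by
    filter_upwards [hb] with ω hω
    refine ⟨(stepUpThreshold_nonneg hα₁ hα₁1 hn (X ω)).trans hω.1, hω.2.trans ?_⟩
    refine mul_le_mul_of_nonneg_left (le_max_of_le_left ?_) hk1'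
    exact stepDownThreshold_le hα₂ hα₂1 le_rfl hn (by simp)
  -- Without failures the threshold lies in [a, lamP]. If only the step-down bound fails it still
  -- lies in [a, lamM]; if the step-up bound fails, only 0 remains as lower end and all squared
  -- noise Q is charged.
  have hpt : ∀ᵐ ω ∂P, softLoss (lamHat ω) (X ω) θ ≤ softLoss lamP (X ω) θ + V ω +
      ∑ j ∈ J, Y ω * Hi j ω + (∑ k ∈ K, Y ω * Lo k ω + ∑ k ∈ K, Q ω * Lo k ω) := by
    filter_upwards [hb, hrange] with ω hω hrω
    have n1 : 0 ≤ ∑ j ∈ J, Y ω * Hi j ω :=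
      Finset.sum_nonneg fun j _ => mul_nonneg (hY0 ω) (hHi0 j ω)
    have n2 : 0 ≤ ∑ k ∈ K, Y ω * Lo k ω :=
      Finset.sum_nonneg fun j _ => mul_nonneg (hY0 ω) (hLo0 j ω)
    have n3 : 0 ≤ ∑ k ∈ K, Q ω * Lo k ω :=
      Finset.sum_nonneg fun j _ => mul_nonneg (hQ0 ω) (hLo0 j ω)
    have n4 : 0 ≤ softLoss lamP (X ω) θ := softLoss_nonneg _ _ _
    have n5 := hV0 ω
    by_cases hlow : ∀ k ∈ K, exceedCount (X ω) (fdrLevel α₁ n k) < k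
    · have hle : a ≤ lamHat ω := by
        refine (le_stepUpThreshold ha1 fun k hk hka => hlow k ?_).trans hω.1
        rw [hK, Finset.mem_filter]; exact ⟨hk, hka⟩
      have hVle : ∑ i, max (|X ω i - θ i| - lamHat ω) 0 ^ 2 ≤ V ω :=
        Finset.sum_le_sum fun i _ =>
          pow_le_pow_left₀ (le_max_right _ _) (max_le_max (by linarith) le_rfl) 2
      by_cases hhigh : ∀ j ∈ J, j ≤ exceedCount (X ω) (fdrLevel α₂ n j)
      · have hle2 : lamHat ω ≤ lamP := by
          refine hω.2.trans (mul_le_mul_of_nonneg_left (le_max_of_le_left ?_) hk1')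
          exact stepDownThreshold_le hα₂ hα₂1 hk1 hkn hhigh
        have := softLoss_le_add_excess hrω.1 hle2 (X ω) θ
        linarith
      · push Not at hhigh
        obtain ⟨j, hj, hjlt⟩ := hhigh
        have h1 : 1 ≤ Hi j ω := Real.one_le_exp (by
          have : (exceedCount (X ω) (fdrLevel α₂ n j) : ℝ) ≤ j := by exact_mod_cast hjlt.le
          linarith)
        have h2 : Y ω * Hi j ω ≤ ∑ j ∈ J, Y ω * Hi j ω :=
          Finset.single_le_sum (f := fun j => Y ω * Hi j ω)
            (fun j _ => mul_nonneg (hY0 ω) (hHi0 j ω)) hj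
        have h3 : Y ω ≤ Y ω * Hi j ω := le_mul_of_one_le_right (hY0 ω) h1
        have h4 : softLoss (lamHat ω) (X ω) θ ≤ Y ω + _ :=
          softLoss_le_add_excess hrω.1 hrω.2 (X ω) θ
        linarith
    · push Not at hlow
      obtain ⟨k, hk, hkle⟩ := hlow
      have h1 : 1 ≤ Lo k ω := Real.one_le_exp (by
        have : (k : ℝ) ≤ exceedCount (X ω) (fdrLevel α₁ n k) := by exact_mod_cast hkle
        nlinarith)
      have h2 : Y ω * Lo k ω ≤ ∑ k ∈ K, Y ω * Lo k ω :=
        Finset.single_le_sum (f := fun k => Y ω * Lo k ω)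
          (fun j _ => mul_nonneg (hY0 ω) (hLo0 j ω)) hk
      have h3 : Y ω ≤ Y ω * Lo k ω := le_mul_of_one_le_right (hY0 ω) h1
      have h2' : Q ω * Lo k ω ≤ ∑ k ∈ K, Q ω * Lo k ω :=
        Finset.single_le_sum (f := fun k => Q ω * Lo k ω)
          (fun j _ => mul_nonneg (hQ0 ω) (hLo0 j ω)) hk
      have h3' : Q ω ≤ Q ω * Lo k ω := le_mul_of_one_le_right (hQ0 ω) h1
      have h4 : softLoss (lamHat ω) (X ω) θ ≤ Y ω + Q ω :=
        softLoss_le_add_sq hrω.1 hrω.2 (X ω) θ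
      linarith
  have i1 : Integrable (fun ω => softLoss lamP (X ω) θ + V ω) P := iP.add iV
  have i2 : Integrable (fun ω => ∑ j ∈ J, Y ω * Hi j ω) P := integrable_finsetSum _ iYHi
  have i3 : Integrable (fun ω => ∑ k ∈ K, Y ω * Lo k ω) P := integrable_finsetSum _ iYLo
  have i4 : Integrable (fun ω => ∑ k ∈ K, Q ω * Lo k ω) P := integrable_finsetSum _ iQLo
  have i12 : Integrable (fun ω => softLoss lamP (X ω) θ + V ω + ∑ j ∈ J, Y ω * Hi j ω) P := i1.add i2
  have i34 : Integrable (fun ω => ∑ k ∈ K, Y ω * Lo k ω + ∑ k ∈ K, Q ω * Lo k ω) P := i3.add i4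
  refine (integral_mono_ae (h.integrable_softLoss_random hm hrange hM0) (i12.add i34) hpt).trans ?_
  have hsplit : ∫ ω, (softLoss lamP (X ω) θ + V ω +
      ∑ j ∈ J, Y ω * Hi j ω + (∑ k ∈ K, Y ω * Lo k ω + ∑ k ∈ K, Q ω * Lo k ω)) ∂P =
      softRisk lamP θ + n * gaussExcess a + ∑ j ∈ J, ∫ ω, Y ω * Hi j ω ∂P +
      (∑ k ∈ K, ∫ ω, Y ω * Lo k ω ∂P + ∑ k ∈ K, ∫ ω, Q ω * Lo k ω ∂P) := by
    rw [integral_add i12 i34, integral_add i1 i2, integral_add iP iV, integral_add i3 i4,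
      integral_finsetSum _ iYHi, integral_finsetSum _ iYLo, integral_finsetSum _ iQLo,
      h.integral_softLoss hPM0, h.integral_sum_excess ha]
  refine hsplit.le.trans ?_
  rw [add_mul, Finset.mul_sum, Finset.mul_sum, Finset.mul_sum]
  refine add_le_add (add_le_add le_rfl (Finset.sum_le_sum fun j _ => ?_))
    (add_le_add (Finset.sum_le_sum fun k _ => ?_) (Finset.sum_le_sum fun k _ => ?_))
  · refine (h.integral_softLoss_mul_exp_count_le hM0 (by norm_num) (j : ℝ)
      (fdrLevel α₂ n j)).trans ?_
    refine mul_le_mul_of_nonneg_left (Real.exp_le_exp.2 ?_) (softRisk_nonneg _ _)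
    have he : Real.exp (-1) ≤ 2 / 5 := by
      rw [Real.exp_neg, inv_le_comm₀ (Real.exp_pos _) (by norm_num)]
      linarith [Real.exp_one_gt_d9]
    nlinarith [meanExceed_nonneg θ (fdrLevel α₂ n j)]
  · exact h.integral_softLoss_mul_exp_count_le hM0 hs1 _ _
  · exact h.integral_sq_mul_exp_count_le hs1 _ _

end NormalMeans

/-- A level below a satisfies αk ≥ n P(|Z| ≥ a), so the signal adds at most (1 - α)k/2 to the noise
mean αk. The mean then stays a fixed fraction below k, and each of at most n terms has the same
exponential bound. -/
theorem sum_exp_stepUp_le {n : ℕ} (θ : Fin n → ℝ) {α a : ℝ} (h0 : 0 < α)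
    (h1 : α < 1) (hS : signalSize θ ≤ (1 - α) / 2 * (n * gaussTail a)) :
    ∑ k ∈ (Finset.Icc 1 n).filter (fun k => fdrLevel α n k < a),
      Real.exp (1 + -((1 - α) / 4 * k) +
        (Real.exp ((1 - α) / 4) - 1) * meanExceed θ (fdrLevel α n k)) ≤
      n * Real.exp (1 - (1 - α) ^ 2 / 16 * (n * gaussTail a)) := by
  have hterm : ∀ k ∈ (Finset.Icc 1 n).filter (fun k => fdrLevel α n k < a),
      Real.exp (1 + -((1 - α) / 4 * k) +
        (Real.exp ((1 - α) / 4) - 1) * meanExceed θ (fdrLevel α n k)) ≤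
      Real.exp (1 - (1 - α) ^ 2 / 16 * (n * gaussTail a)) := by
    intro k hk
    rw [Finset.mem_filter, Finset.mem_Icc] at hk
    obtain ⟨⟨hk1, hkn⟩, hka⟩ := hk
    have hn : (0 : ℝ) < n := by exact_mod_cast hk1.trans hkn
    have hk0 : (0 : ℝ) < k := by exact_mod_cast hk1
    have hq := (fdrLevel_spec h0 h1 hk1 hkn).2
    have hT : n * gaussTail a ≤ α * k := by
      have := mul_le_mul_of_nonneg_left (gaussTail_anti hka.le) hn.le
      rw [hq] at this
      refine this.trans (le_of_eq ?_)
      field_simp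
    have hTk : n * gaussTail a ≤ k := hT.trans (by nlinarith)
    have hg : meanExceed θ (fdrLevel α n k) ≤ (1 + α) / 2 * k := by
      have := meanExceed_le θ (fdrLevel α n k)
      rw [hq, mul_div_cancel₀ _ hn.ne'] at this
      have h2 : (1 - α) / 2 * (n * gaussTail a) ≤ (1 - α) / 2 * k :=
        mul_le_mul_of_nonneg_left hTk (by linarith)
      linarith
    refine Real.exp_le_exp.2 ?_
    have he : 0 ≤ Real.exp ((1 - α) / 4) - 1 := by
      have := Real.one_le_exp (show 0 ≤ (1 - α) / 4 by linarith); linarith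
    have h3 := mul_le_mul_of_nonneg_left hg he
    have h4 := mul_le_mul_of_nonneg_right (exp_sub_one_mul_sub_le h0 h1) hk0.le
    have h5 : (1 - α) ^ 2 / 16 * (n * gaussTail a) ≤ (1 - α) ^ 2 / 16 * k :=
      mul_le_mul_of_nonneg_left hTk (by positivity)
    linarith
  refine (Finset.sum_le_card_nsmul _ _ _ hterm).trans ?_
  rw [nsmul_eq_mul]
  refine mul_le_mul_of_nonneg_right ?_ (Real.exp_pos _).le
  exact_mod_cast (Finset.card_filter_le _ _).trans (by simp)

/-- Of the 3/5 of the mean in the exponent, 1/2 covers 2j and leaves a summable exp(1 - j); the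
remaining 1/10 dominates G/10. -/
theorem sum_exp_stepDown_le {n : ℕ} (θ : Fin n → ℝ) {α : ℝ} (h0 : 0 < α) (h1 : α < 1) {k₀ : ℕ}
    (hkn : k₀ ≤ n) (hg : ∀ j ∈ Finset.Icc 2 k₀, 4 * (j : ℝ) ≤ meanExceed θ (fdrLevel α n j)) :
    ∑ j ∈ Finset.Icc 2 k₀, Real.exp (1 + j - 3 / 5 * meanExceed θ (fdrLevel α n j)) ≤
      Real.exp (-(meanExceed θ (fdrLevel α n 1) / 10)) := by
  set G := meanExceed θ (fdrLevel α n 1)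
  have : ∀ j ∈ Finset.Icc 2 k₀, Real.exp (1 + j - 3 / 5 * meanExceed θ (fdrLevel α n j)) ≤
      Real.exp (-(G / 10)) * Real.exp (1 - (j : ℝ)) := fun j hj => by
    have h4 := hg j hj
    rw [Finset.mem_Icc] at hj
    have hG : G ≤ meanExceed θ (fdrLevel α n j) :=
      meanExceed_anti θ (fdrLevel_anti h0 h1 le_rfl (by omega) (hj.2.trans hkn))
    rw [← Real.exp_add]
    exact Real.exp_le_exp.2 (by linarith)
  refine (Finset.sum_le_sum this).trans ?_
  rw [← Finset.mul_sum]
  exact mul_le_of_le_one_right (Real.exp_pos _).le (sum_exp_one_sub_le k₀)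

theorem exp_neg_le_inv {x : ℝ} (hx : 0 < x) : Real.exp (-x) ≤ 1 / x := by
  rw [Real.exp_neg, one_div]
  exact inv_anti₀ hx (by linarith [Real.add_one_le_exp x])

/-! ### Risk of the random threshold relative to the reference risk -/

/-- The risk at an inflated FDR level, compared with the risk at a reference threshold. -/
theorem softRisk_inflated_le {n : ℕ} (hn : 1 ≤ n) (θ : Fin n → ℝ) {α a lam₀ κ τ G : ℝ} (h0 : 0 < α)
    (h1 : α < 1) (ha : 0 < a) (hlam₀ : a ≤ lam₀) (h1lam₀ : 1 ≤ lam₀) (hκ : 0 ≤ κ) (hκ2 : κ ≤ 1 / 2)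
    (hτ : ∀ lam, lam₀ ≤ lam → lam ^ 2 * gaussTail (lam / 2) ≤ τ) {k : ℕ} (hk : 1 ≤ k) (hkn : k ≤ n)
    (hG : meanExceed θ (fdrLevel α n k) ≤ G * k) :
    softRisk ((1 + κ) * max (fdrLevel α n k) lam₀) θ ≤
      (1 + 2 * κ) ^ 2 * (softRisk lam₀ θ + 3 * (G / α) * (n * gaussSqExcess lam₀) +
        n * gaussExcess a) + signalSize θ * τ + n * gaussExcess a := by
  obtain ⟨hξ, hq⟩ := fdrLevel_spec h0 h1 hk hkn
  have hn' : (0 : ℝ) < n := by exact_mod_cast hn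
  have hk' : (0 : ℝ) < k := by exact_mod_cast hk
  have hG0 : 0 ≤ G := by
    by_contra hneg
    have := meanExceed_nonneg θ (fdrLevel α n k)
    nlinarith [not_le.1 hneg]
  set lam := max (fdrLevel α n k) lam₀ with hlam
  have hl : lam₀ ≤ lam := le_max_right _ _
  have hexc : meanExceed θ (fdrLevel α n k) ≤ (G / α * n) * gaussTail (fdrLevel α n k) := by
    rw [hq]
    refine hG.trans (le_of_eq ?_)
    field_simp
  have hA := softRisk_max_le (by linarith : 0 ≤ lam₀) hξ.le (by positivity) θ hexc
  have hB := softRisk_le_mul_add (h1lam₀.trans hl) (by nlinarith : lam ≤ (1 + κ) * lam) le_rfl hκ2 θ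
  have hv1 := gaussExcess_anti ha.le hlam₀
  have hv2 := gaussExcess_anti ha.le (show a ≤ (1 + κ) * lam by nlinarith)
  have hv1' := mul_le_mul_of_nonneg_left hv1 hn'.le
  have hv2' := mul_le_mul_of_nonneg_left hv2 hn'.le
  have hS := mul_le_mul_of_nonneg_left (hτ lam hl) (signalSize_nonneg θ)
  have hA' : softRisk lam θ ≤ softRisk lam₀ θ + 3 * (G / α) * (n * gaussSqExcess lam₀) +
      n * gaussExcess a := by
    have e : 3 * (G / α * n) * gaussSqExcess lam₀ = 3 * (G / α) * (n * gaussSqExcess lam₀) := by ring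
    rw [← hlam, e] at hA; linarith
  have hA'' := mul_le_mul_of_nonneg_left hA' (sq_nonneg (1 + 2 * κ))
  linarith

namespace NormalMeans

variable {Ω : Type*} [MeasurableSpace Ω] {P : Measure Ω} {n : ℕ}
  {X : Ω → Fin n → ℝ} {θ : Fin n → ℝ}

theorem integral_softLoss_random_le_softRisk (h : NormalMeans P X θ) (hn : 1 ≤ n) {α₁ α₂ : ℝ}
    (hα₁ : 0 < α₁) (hα₁1 : α₁ < 1) (hα₂ : 0 < α₂) (hα₂1 : α₂ < 1) {lamHat : Ω → ℝ}
    (hm : Measurable lamHat) {a lam₀ κ τ M x v w u L : ℝ} (ha : 0 < a) (hlam₀ : a ≤ lam₀)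
    (h1lam₀ : 1 ≤ lam₀) (hκ : 0 ≤ κ) (hκ2 : κ ≤ 1 / 2) (hM : 1 ≤ M)
    (hb : ∀ᵐ ω ∂P, stepUpThreshold α₁ (X ω) ≤ lamHat ω ∧
      lamHat ω ≤ (1 + κ) * stepDownThreshold α₂ (X ω))
    (haα : α₁ < n * gaussTail a) (hS : signalSize θ ≤ (1 - α₁) / 2 * (n * gaussTail a))
    (hτ : ∀ lam, lam₀ ≤ lam → lam ^ 2 * gaussTail (lam / 2) ≤ τ)
    (hx : softRisk lam₀ θ ≤ x) (hv : n * gaussExcess a ≤ v) (hw : n * gaussSqExcess lam₀ ≤ w)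
    (hu : signalSize θ * τ ≤ u)
    (hL : n * Real.exp (1 - (1 - α₁) ^ 2 / 16 * (n * gaussTail a)) ≤ L) :
    ∫ ω, softLoss (lamHat ω) (X ω) θ ∂P ≤
      ((1 + 2 * κ) ^ 2 * (x + 24 * M / α₂ * w + v) + u + 2 * v) +
      (5 / (2 * M) * ((1 + 2 * κ) ^ 2 * (x + v) + u + v) + (1 + 2 * κ) ^ 2 * (30 / α₂ * w)) +
      ((1 + 2 * κ) ^ 2 * (x + 3 * n / α₂ * w + v) + u + v + n) * L := by
  have hn' : (0 : ℝ) < n := by exact_mod_cast hn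
  set K := (1 + 2 * κ) ^ 2 with hK
  have hK0 : 0 ≤ K := sq_nonneg _
  have hx0 : 0 ≤ x := (softRisk_nonneg _ _).trans hx
  have hv0 : 0 ≤ v := (mul_nonneg hn'.le (gaussExcess_nonneg _)).trans hv
  have hw0 : 0 ≤ w := (mul_nonneg hn'.le (gaussSqExcess_nonneg _)).trans hw
  have hτ0 : 0 ≤ τ :=
    (mul_nonneg (sq_nonneg _) (gaussTail_nonneg _)).trans (hτ lam₀ le_rfl)
  have hu0 : 0 ≤ u := (mul_nonneg (signalSize_nonneg θ) hτ0).trans hu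
  -- This covers the step-up default ξ_1 when nothing is rejected.
  have ha1 : a ≤ fdrLevel α₁ n 1 := by
    refine (lt_of_gaussTail_lt ?_).le
    rw [(fdrLevel_spec hα₁ hα₁1 le_rfl hn).2, div_lt_iff₀ hn']
    simpa [mul_comm] using haα
  obtain ⟨k₀, hk1, hkn, hgk, hcase⟩ := exists_levelIndex hn θ hα₂ hα₂1 hM
  set G := meanExceed θ (fdrLevel α₂ n 1) with hG
  have hG0 : 0 ≤ G := meanExceed_nonneg _ _
  have hGn : G ≤ n := meanExceed_le_card _ _
  have main := h.integral_softLoss_random_le hn hα₁ hα₁1 hα₂ hα₂1 hm ha.le hlam₀ hκ hb ha1 hk1 hkn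
    (s := (1 - α₁) / 4) (by linarith) (by linarith)
  set RP := softRisk ((1 + κ) * max (fdrLevel α₂ n k₀) lam₀) θ with hRP
  set RM := softRisk ((1 + κ) * max (fdrLevel α₂ n 1) lam₀) θ with hRM
  have hRM0 : 0 ≤ RM := softRisk_nonneg _ _
  have bound : ∀ g : ℝ, 0 ≤ g → K * (softRisk lam₀ θ + 3 * (g / α₂) * (n * gaussSqExcess lam₀) +
        n * gaussExcess a) + signalSize θ * τ + n * gaussExcess a ≤
      K * (x + 3 * (g / α₂) * w + v) + u + v := fun g hg => by
    have : 0 ≤ 3 * (g / α₂) := by positivity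
    have h2 := mul_le_mul_of_nonneg_left hw this
    have h3 : softRisk lam₀ θ + 3 * (g / α₂) * (n * gaussSqExcess lam₀) + n * gaussExcess a ≤
      x + 3 * (g / α₂) * w + v := by linarith
    have h4 := mul_le_mul_of_nonneg_left h3 hK0
    linarith
  have bP : RP ≤ K * (x + 24 * M / α₂ * w + v) + u + v := by
    refine (softRisk_inflated_le hn θ hα₂ hα₂1 ha hlam₀ h1lam₀ hκ hκ2 hτ hk1 hkn hgk).trans
      ((bound _ (by linarith)).trans (le_of_eq ?_))
    ring
  have bM : RM ≤ K * (x + 3 * (G / α₂) * w + v) + u + v :=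
    (softRisk_inflated_le hn θ hα₂ hα₂1 ha hlam₀ h1lam₀ hκ hκ2 hτ le_rfl hn
      (by simp [hG])).trans (bound _ hG0)
  have bM' : RM ≤ K * (x + 3 * n / α₂ * w + v) + u + v := by
    refine bM.trans ?_
    have : 3 * (G / α₂) * w ≤ 3 * n / α₂ * w := by
      rw [mul_div_assoc]
      gcongr
    have := mul_le_mul_of_nonneg_left this hK0
    linarith
  have bHi : RM * ∑ j ∈ Finset.Icc 2 k₀, Real.exp (1 + j - 3 / 5 * meanExceed θ (fdrLevel α₂ n j)) ≤
      5 / (2 * M) * (K * (x + v) + u + v) + K * (30 / α₂ * w) := by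
    have hM0 : 0 < M := by linarith
    -- If k₀ = 1 there is nothing to fail. Otherwise the bound on RM grows linearly in G, and
    -- exp(-G/10) ≤ 10/G cancels that growth, while G ≥ 4M makes the part without G small.
    rcases hcase with rfl | ⟨h4M, h4j⟩
    · simp only [Finset.Icc_eq_empty (by norm_num : ¬ (2 : ℕ) ≤ 1), Finset.sum_empty, mul_zero]
      positivity
    · have hGpos : 0 < G := by linarith
      have hsum := sum_exp_stepDown_le θ hα₂ hα₂1 hkn h4j
      have hexp : Real.exp (-(G / 10)) ≤ 10 / G := by
        refine (exp_neg_le_inv (by positivity)).trans (le_of_eq ?_)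
        field_simp
      have h10 : 10 / G ≤ 5 / (2 * M) := by
        rw [div_le_div_iff₀ hGpos (by positivity)]; linarith
      calc _ ≤ RM * (10 / G) := mul_le_mul_of_nonneg_left (hsum.trans hexp) hRM0
        _ ≤ (K * (x + 3 * (G / α₂) * w + v) + u + v) * (10 / G) :=
            mul_le_mul_of_nonneg_right bM (by positivity)
        _ = 10 / G * (K * (x + v) + u + v) + K * (30 / α₂ * w) := by field_simp; ring
        _ ≤ _ := by
            have := mul_le_mul_of_nonneg_right h10 (show 0 ≤ K * (x + v) + u + v by positivity)
            linarith
  have bLo := (sum_exp_stepUp_le θ hα₁ hα₁1 hS).trans hL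
  have bLo2 : (RM + n) * ∑ k ∈ (Finset.Icc 1 n).filter (fun k => fdrLevel α₁ n k < a),
      Real.exp (1 + -((1 - α₁) / 4 * k) +
        (Real.exp ((1 - α₁) / 4) - 1) * meanExceed θ (fdrLevel α₁ n k)) ≤
      (K * (x + 3 * n / α₂ * w + v) + u + v + n) * L := by
    refine mul_le_mul (by linarith) bLo (Finset.sum_nonneg fun _ _ => (Real.exp_pos _).le) ?_
    positivity
  linarith

end NormalMeans

/-! ### Choice of the reference level -/

/-- The factor by which the risk of the random threshold can exceed the minimum risk, at accuracy
parameter `δ`. -/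
noncomputable def riskFactor (α δ : ℝ) : ℝ :=
  (1 + 8 * δ) ^ 2 * ((1 + 8 * δ) ^ 2 + 3 * δ ^ 2 + 24 * δ / α) + 3 * δ ^ 2 +
    (5 / 2 * δ * ((1 + 8 * δ) ^ 2 * ((1 + 8 * δ) ^ 2 + 3 * δ ^ 2) + 2 * δ ^ 2) +
      (1 + 8 * δ) ^ 2 * (30 / α * δ ^ 2)) + δ ^ 2

/-- The condition δa ≥ 2 places the levels (1 - 2δ)a and (1 - δ)a at least 2 apart, the gap that
yields unit losses. -/
theorem reference_levels {δ a : ℝ} (hδ : 0 < δ) (hδ1 : δ ≤ 1 / 16) (haδ : 2 / δ ≤ a) :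
    32 ≤ a ∧ 1 ≤ (1 - 2 * δ) * a ∧ (1 - 2 * δ) * a + 2 ≤ (1 - δ) * a ∧
    (1 - 2 * δ) * a ≤ (1 + δ) * a ∧ (1 + δ) * a ≤ (1 + 4 * δ) * ((1 - 2 * δ) * a) ∧
    a ≤ (1 + δ) * a ∧ ((1 + δ) * a) ^ 2 ≤ 2 * a ^ 2 := by
  rw [div_le_iff₀ hδ, mul_comm] at haδ
  have ha : 32 ≤ a := by nlinarith
  refine ⟨ha, by nlinarith, by linarith, by nlinarith, ?_, by nlinarith, ?_⟩
  · have : 0 ≤ δ * a * (1 - 8 * δ) := mul_nonneg (by linarith) (by linarith)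
    linarith
  · have : (1 + δ) ^ 2 ≤ 2 := by nlinarith
    rw [mul_pow]
    exact mul_le_mul_of_nonneg_right this (sq_nonneg a)

theorem one_add_eight_mul_sq_le {δ : ℝ} (hδ : 0 < δ) (hδ1 : δ ≤ 1 / 16) :
    (1 + 8 * δ) ^ 2 ≤ 9 / 4 := by nlinarith

namespace NormalMeans

variable {Ω : Type*} [MeasurableSpace Ω] {P : Measure Ω} {n : ℕ}
  {X : Ω → Fin n → ℝ} {θ : Fin n → ℝ}

/-- Consequences of the choice of the level `a` at which the expected number of exceedances of pure
noise is a multiple `A` of the minimum risk `ρ`. -/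
theorem reference_bounds [IsProbabilityMeasure P] (h : NormalMeans P X θ)
    {δ a A ρ : ℝ} (hδ : 0 < δ) (hδ1 : δ ≤ 1 / 16) (hρ : minSoftRisk P X θ = ρ) (hρ1 : 1 ≤ ρ)
    (hA : 2 / gaussTail 1 ≤ A) (ha : n * gaussTail a = A * ρ) (haδ : 2 / δ ≤ a)
    (hav : 2 * A / a ^ 2 ≤ δ ^ 2) (hD1 : 5 ≤ Real.exp (δ * a ^ 2 / 2))
    (hD2 : 4 * A / δ ^ 2 ≤ Real.exp (δ * a ^ 2 / 2))
    (htail : ∀ t, a / 4 ≤ t → 64 * (2 / gaussTail 1) * (t ^ 2 * gaussTail t) ≤ δ ^ 2) :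
    Real.exp (δ * a ^ 2 / 2) * (A * ρ) ≤ n * gaussTail ((1 - δ) * a) ∧
    signalSize θ ≤ 2 / gaussTail 1 * ρ ∧
    n * gaussExcess a ≤ δ ^ 2 * ρ ∧
    n * gaussSqExcess ((1 + δ) * a) ≤ δ ^ 2 * ρ ∧
    signalSize θ * (((1 + δ) * a) ^ 2 * gaussTail ((1 - 2 * δ) * a / 2)) ≤ δ ^ 2 * ρ ∧
    n * gaussExcess ((1 + δ) * a) ≤ δ ^ 2 * ρ ∧
    ρ ≤ softRisk ((1 + δ) * a) θ ∧
    softRisk ((1 + δ) * a) θ ≤ ((1 + 8 * δ) ^ 2 + 2 * δ ^ 2) * ρ := by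
  have hq1 := gaussTail_pos 1
  have hq1' := gaussTail_le_one 1
  have hC2 : 2 ≤ 2 / gaussTail 1 := by rw [le_div_iff₀ hq1]; linarith
  have hA2 : 2 ≤ A := hC2.trans hA
  obtain ⟨ha32, r1, r2, r3, r4, r5, r6⟩ := reference_levels hδ hδ1 haδ
  have ha0 : 0 < a := by linarith
  have hn0 : (0 : ℝ) ≤ n := by positivity
  set D := Real.exp (δ * a ^ 2 / 2) with hD
  have hD0 : 0 < D := Real.exp_pos _
  have hAρ : 0 ≤ A * ρ := mul_nonneg (by linarith) (by linarith)
  have hb : D * (A * ρ) ≤ n * gaussTail ((1 - δ) * a) := by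
    have hb0 : 0 < (1 - δ) * a := by linarith
    have h1 := gaussTail_add_le hb0 (show 0 ≤ δ * a by positivity)
    rw [show (1 - δ) * a + δ * a = a by ring] at h1
    have h2 : D * gaussTail a ≤ gaussTail ((1 - δ) * a) := by
      -- The step from (1 - δ)a to a gains the exponent (1 - δ)δa², which is at least δa²/2.
      have h3 : D * Real.exp (-((1 - δ) * a * (δ * a))) ≤ 1 := by
        rw [hD, ← Real.exp_add, Real.exp_le_one_iff]
        have := mul_le_mul_of_nonneg_right hδ1 (by positivity : 0 ≤ δ * a ^ 2)
        have : 0 ≤ δ * a ^ 2 := by positivity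
        linarith
      calc D * gaussTail a ≤ D * (Real.exp (-((1 - δ) * a * (δ * a))) * gaussTail ((1 - δ) * a)) :=
            mul_le_mul_of_nonneg_left h1 hD0.le
        _ = D * Real.exp (-((1 - δ) * a * (δ * a))) * gaussTail ((1 - δ) * a) := by ring
        _ ≤ 1 * gaussTail ((1 - δ) * a) :=
            mul_le_mul_of_nonneg_right h3 (gaussTail_nonneg _)
        _ = _ := one_mul _
    calc D * (A * ρ) = n * (D * gaussTail a) := by rw [← ha]; ring
      _ ≤ _ := mul_le_mul_of_nonneg_left h2 hn0
  have hS : signalSize θ ≤ 2 / gaussTail 1 * ρ := hρ ▸ h.signalSize_le_minSoftRisk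
  have hv : n * gaussExcess a ≤ δ ^ 2 * ρ := by
    calc n * gaussExcess a ≤ n * (2 / a ^ 2 * gaussTail a) :=
          mul_le_mul_of_nonneg_left (gaussExcess_le ha0) hn0
      _ = 2 / a ^ 2 * (n * gaussTail a) := by ring
      _ = 2 * A / a ^ 2 * ρ := by rw [ha]; ring
      _ ≤ _ := mul_le_mul_of_nonneg_right hav (by linarith)
  have hl := r5
  have hv' : n * gaussExcess ((1 + δ) * a) ≤ δ ^ 2 * ρ :=
    (mul_le_mul_of_nonneg_left (gaussExcess_anti ha0.le hl) hn0).trans hv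
  have hw : n * gaussSqExcess ((1 + δ) * a) ≤ δ ^ 2 * ρ := by
    have h1 := gaussTail_add_le ha0 (show 0 ≤ δ * a by positivity)
    rw [show a + δ * a = (1 + δ) * a by ring] at h1
    have h3 : Real.exp (-(a * (δ * a))) ≤ D⁻¹ := by
      rw [hD, ← Real.exp_neg]
      have : 0 ≤ δ * a ^ 2 := by positivity
      exact Real.exp_le_exp.2 (by linarith)
    have h4 : 2 + 2 / ((1 + δ) * a) ^ 2 ≤ 4 := by
      have : 2 / ((1 + δ) * a) ^ 2 ≤ 2 := by
        rw [div_le_iff₀ (by positivity)]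
        have := pow_le_pow_left₀ (by norm_num) (ha32.trans r5) 2
        linarith
      linarith
    have h5 : gaussTail ((1 + δ) * a) ≤ D⁻¹ * gaussTail a :=
      h1.trans (mul_le_mul_of_nonneg_right h3 (gaussTail_nonneg _))
    have h6 : 4 * A * D⁻¹ ≤ δ ^ 2 := by
      rw [← div_eq_mul_inv, div_le_iff₀ hD0]
      rw [div_le_iff₀ (by positivity)] at hD2
      linarith
    calc n * gaussSqExcess ((1 + δ) * a)
        ≤ n * ((2 + 2 / ((1 + δ) * a) ^ 2) * gaussTail ((1 + δ) * a)) :=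
          mul_le_mul_of_nonneg_left (gaussSqExcess_le (by linarith)) hn0
      _ ≤ n * (4 * (D⁻¹ * gaussTail a)) := by
          refine mul_le_mul_of_nonneg_left ?_ hn0
          exact mul_le_mul h4 h5 (gaussTail_nonneg _) (by norm_num)
      _ = 4 * D⁻¹ * (n * gaussTail a) := by ring
      _ = 4 * A * D⁻¹ * ρ := by rw [ha]; ring
      _ ≤ _ := mul_le_mul_of_nonneg_right h6 (by linarith)
  have hSq : signalSize θ * (((1 + δ) * a) ^ 2 * gaussTail ((1 - 2 * δ) * a / 2)) ≤ δ ^ 2 * ρ := by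
    have h1 : gaussTail ((1 - 2 * δ) * a / 2) ≤ gaussTail (a / 4) :=
      gaussTail_anti (by linarith [mul_le_mul_of_nonneg_right hδ1 ha0.le])
    have h2 : ((1 + δ) * a) ^ 2 ≤ 64 * (a / 4) ^ 2 :=
      r6.trans (by linarith [sq_nonneg a, show 64 * (a / 4) ^ 2 = 4 * a ^ 2 by ring])
    have h3 : ((1 + δ) * a) ^ 2 * gaussTail ((1 - 2 * δ) * a / 2) ≤
        64 * (a / 4) ^ 2 * gaussTail (a / 4) :=
      mul_le_mul h2 h1 (gaussTail_nonneg _) (by positivity)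
    have h4 := htail (a / 4) le_rfl
    have h5 := mul_le_mul hS h3 (mul_nonneg (sq_nonneg _) (gaussTail_nonneg _))
      (by positivity : 0 ≤ 2 / gaussTail 1 * ρ)
    have h6 := mul_le_mul_of_nonneg_right h4 (by linarith : 0 ≤ ρ)
    refine h5.trans (le_trans (le_of_eq ?_) h6)
    ring
  have hR1 : ρ ≤ softRisk ((1 + δ) * a) θ := hρ ▸ h.minSoftRisk_le (by linarith)
  refine ⟨hb, hS, hv, hw, hSq, hv', hR1, ?_⟩
  have hlarge : minSoftRisk P X θ < meanExceed θ ((1 - δ) * a) - signalSize θ := by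
    rw [hρ]
    have h1 := le_meanExceed θ ((1 - δ) * a)
    have h2 : 2 / gaussTail 1 * ρ ≤ A * ρ := mul_le_mul_of_nonneg_right hA (by linarith)
    have h3 : 5 * (A * ρ) ≤ D * (A * ρ) := mul_le_mul_of_nonneg_right hD1 hAρ
    have h4 : 2 * ρ ≤ A * ρ := mul_le_mul_of_nonneg_right hA2 (by linarith)
    linarith
  have := h.softRisk_le_minSoftRisk (μ := (1 - 2 * δ) * a) (b := (1 - δ) * a) (κ := 4 * δ)
    (lam₀ := (1 + δ) * a) r1 r2 r3 r4 (by linarith) hlarge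
  rw [hρ, show 2 * (4 * δ) = 8 * δ by ring] at this
  linarith

/-- The expected minimum loss is nearly as large as the minimum risk. -/
theorem mul_minSoftRisk_le_integral_minSoftLoss [IsProbabilityMeasure P] (h : NormalMeans P X θ)
    {δ a A ρ : ℝ} (hδ : 0 < δ) (hδ1 : δ ≤ 1 / 16) (hρ : minSoftRisk P X θ = ρ) (hρ1 : 1 ≤ ρ)
    (hA : 2 / gaussTail 1 ≤ A) (ha : n * gaussTail a = A * ρ) (haδ : 2 / δ ≤ a)
    (hav : 2 * A / a ^ 2 ≤ δ ^ 2) (hD1 : 5 ≤ Real.exp (δ * a ^ 2 / 2))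
    (hD2 : 4 * A / δ ^ 2 ≤ Real.exp (δ * a ^ 2 / 2))
    (hD3 : 160 * a ^ 2 ≤ Real.exp (δ * a ^ 2 / 2))
    (hD4 : 80 / δ ^ 2 ≤ Real.exp (δ * a ^ 2 / 2))
    (htail : ∀ t, a / 4 ≤ t → 64 * (2 / gaussTail 1) * (t ^ 2 * gaussTail t) ≤ δ ^ 2)
    (hexp : Real.exp (1 - ρ) ≤ δ ^ 2) :
    (1 - 12 * δ ^ 2) * ρ ≤ (1 + 8 * δ) ^ 2 * ∫ ω, minSoftLoss (X ω) θ ∂P := by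
  obtain ⟨hb, hS, hv, hw, hSq, hv', hR1, hR2⟩ :=
    h.reference_bounds hδ hδ1 hρ hρ1 hA ha haδ hav hD1 hD2 htail
  have hq1 := gaussTail_pos 1
  have hC2 : 2 ≤ 2 / gaussTail 1 := by
    rw [le_div_iff₀ hq1]; linarith [gaussTail_le_one 1]
  have hA2 : 2 ≤ A := hC2.trans hA
  obtain ⟨ha32, r1, r2, r3, r4, r5, r6⟩ := reference_levels hδ hδ1 haδ
  set D := Real.exp (δ * a ^ 2 / 2) with hD
  set R := softRisk ((1 + δ) * a) θ with hR
  set B := n * gaussTail ((1 - δ) * a) with hB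
  have hR0 : 0 ≤ R := by linarith
  have hAρ : 2 * ρ ≤ A * ρ := mul_le_mul_of_nonneg_right hA2 (by linarith)
  have hBρ : D * (2 * ρ) ≤ B := (mul_le_mul_of_nonneg_left hAρ (Real.exp_pos _).le).trans hb
  have hB10 : 10 * ρ ≤ B := by
    have := mul_le_mul_of_nonneg_right hD1 (by linarith : 0 ≤ 2 * ρ); linarith
  have hBS : signalSize θ ≤ B / 5 := by
    have h2 : 2 / gaussTail 1 * ρ ≤ A * ρ := mul_le_mul_of_nonneg_right hA (by linarith)
    have h3 : 5 * (A * ρ) ≤ D * (A * ρ) := mul_le_mul_of_nonneg_right hD1 (by linarith)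
    linarith
  have hDB : D ≤ B := (le_mul_of_one_le_right (Real.exp_pos _).le (by linarith)).trans hBρ
  have hBpos : 0 < B := by linarith
  have hc2 : 16 * ((1 + δ) * a) ^ 2 ≤ B / 5 := by linarith
  -- With c = B/5 and S ≤ B/5 the exponent of the failure term is at most 1 - B/5, hence at most 1 -
  -- ρ. The level c is also large compared with ρ, so R²/c is negligible.
  have main := h.softRisk_sub_le_integral_minSoftLoss (μ := (1 - 2 * δ) * a) (b := (1 - δ) * a)
    (κ := 4 * δ) (lam₀ := (1 + δ) * a) (c := B / 5) r1 r2 r3 r4 (by linarith) (by linarith) hc2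
  rw [show 2 * (4 * δ) = 8 * δ by ring] at main
  have hE : Real.exp (1 + (B / 5 + signalSize θ) - 3 / 5 * meanExceed θ ((1 - δ) * a)) ≤ δ ^ 2 := by
    refine le_trans (Real.exp_le_exp.2 ?_) hexp
    have h1 := le_meanExceed θ ((1 - δ) * a)
    linarith
  have hE' := mul_le_mul_of_nonneg_left hE hR0
  have hδ2 : δ ^ 2 ≤ 1 / 256 := by
    have := pow_le_pow_left₀ hδ.le hδ1 2; linarith
  have hK3 := one_add_eight_mul_sq_le hδ hδ1
  have hR4 : R ≤ 4 * ρ := hR2.trans (mul_le_mul_of_nonneg_right (by linarith) (by linarith))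
  have hsq : 2 / (B / 5) * R ^ 2 ≤ δ ^ 2 * ρ := by
    have h1 : R ^ 2 ≤ (4 * ρ) ^ 2 := pow_le_pow_left₀ hR0 hR4 2
    have h2 : 80 ≤ δ ^ 2 * D := by rwa [div_le_iff₀ (by positivity), mul_comm] at hD4
    have h3 : 160 * ρ ≤ δ ^ 2 * B := by
      have := mul_le_mul_of_nonneg_left hBρ (sq_nonneg δ)
      have := mul_le_mul_of_nonneg_right h2 (by linarith : 0 ≤ 2 * ρ)
      linarith
    rw [div_div_eq_mul_div, div_mul_eq_mul_div, div_le_iff₀ hBpos]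
    have := mul_le_mul_of_nonneg_right h3 (by linarith : 0 ≤ ρ)
    linarith
  -- The failure term takes δ²R; the two parts of the comparison remainder, the factor 8 and the
  -- product term take 1 + 1 + 8 + 1 = 11 times δ²ρ, for a total of 12.
  have hRδ : (1 - δ ^ 2) * ρ ≤ (1 - δ ^ 2) * R := mul_le_mul_of_nonneg_left hR1 (by linarith)
  linarith

/-- The risk of the random threshold is nearly as small as the minimum risk. -/
theorem integral_softLoss_random_le_minSoftRisk [IsProbabilityMeasure P] (h : NormalMeans P X θ)
    (hn : 1 ≤ n) {α₁ α₂ : ℝ} (hα₁ : 0 < α₁) (hα₁1 : α₁ < 1) (hα₂ : 0 < α₂) (hα₂1 : α₂ < 1)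
    {lamHat : Ω → ℝ} (hm : Measurable lamHat)
    {δ a A ρ : ℝ} (hδ : 0 < δ) (hδ1 : δ ≤ 1 / 16) (hρ : minSoftRisk P X θ = ρ) (hρ1 : 1 ≤ ρ)
    (hρn : ρ ≤ n)
    (hA : A = 4 / (1 - α₁) * (2 / gaussTail 1)) (ha : n * gaussTail a = A * ρ) (haδ : 2 / δ ≤ a)
    (hav : 2 * A / a ^ 2 ≤ δ ^ 2) (hD1 : 5 ≤ Real.exp (δ * a ^ 2 / 2))
    (hD2 : 4 * A / δ ^ 2 ≤ Real.exp (δ * a ^ 2 / 2))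
    (htail : ∀ t, a / 4 ≤ t → 64 * (2 / gaussTail 1) * (t ^ 2 * gaussTail t) ≤ δ ^ 2)
    (hb : ∀ᵐ ω ∂P, stepUpThreshold α₁ (X ω) ≤ lamHat ω ∧
      lamHat ω ≤ (1 + 4 * δ) * stepDownThreshold α₂ (X ω))
    (hL : (32 + 12 / α₂) * n ^ 3 * Real.exp (1 - (1 - α₁) ^ 2 / 16 * (A * ρ)) ≤ δ ^ 2) :
    ∫ ω, softLoss (lamHat ω) (X ω) θ ∂P ≤ riskFactor α₂ δ * ρ := by
  have hq1 := gaussTail_pos 1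
  have hC2 : 2 ≤ 2 / gaussTail 1 := by
    rw [le_div_iff₀ hq1]; linarith [gaussTail_le_one 1]
  have hα' : 0 < 1 - α₁ := by linarith
  have h4 : 4 ≤ 4 / (1 - α₁) := by rw [le_div_iff₀ hα']; linarith
  have hAC : 2 / gaussTail 1 ≤ A := by
    rw [hA]; exact le_mul_of_one_le_left (by linarith) (by linarith)
  obtain ⟨-, hS, hv, hw, -, -, hR1, hR2⟩ :=
    h.reference_bounds hδ hδ1 hρ hρ1 hAC ha haδ hav hD1 hD2 htail
  obtain ⟨ha32, r1, r2, r3, r4, r5, r6⟩ := reference_levels hδ hδ1 haδ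
  have hn' : (1 : ℝ) ≤ n := by exact_mod_cast hn
  have hSA : signalSize θ ≤ (1 - α₁) / 2 * (n * gaussTail a) := by
    rw [ha, hA]
    have : (1 - α₁) / 2 * (4 / (1 - α₁) * (2 / gaussTail 1) * ρ) = 2 * (2 / gaussTail 1 * ρ) := by
      field_simp
      norm_num
    rw [this]
    have : 0 ≤ 2 / gaussTail 1 * ρ := by positivity
    linarith
  set τ := δ ^ 2 / (2 / gaussTail 1) with hτdef
  have hτ : ∀ lam, (1 + δ) * a ≤ lam → lam ^ 2 * gaussTail (lam / 2) ≤ τ := fun lam hl => by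
    have h1 := htail (lam / 2) (by linarith)
    have h2 := mul_nonneg (sq_nonneg lam) (gaussTail_nonneg (lam / 2))
    rw [hτdef, le_div_iff₀ (by linarith)]
    have h3 := mul_nonneg (by linarith : 0 ≤ 2 / gaussTail 1) h2
    have e : 64 * (2 / gaussTail 1) * ((lam / 2) ^ 2 * gaussTail (lam / 2)) =
      16 * (2 / gaussTail 1 * (lam ^ 2 * gaussTail (lam / 2))) := by ring
    linarith
  have hu : signalSize θ * τ ≤ δ ^ 2 * ρ := by
    have hτ0 : 0 ≤ τ := by positivity
    refine (mul_le_mul_of_nonneg_right hS hτ0).trans (le_of_eq ?_)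
    rw [hτdef]; field_simp
  -- M = 1/δ balances the two errors: M times w is of order δρ, and the step-down failure factor
  -- 5/(2M) is of order δ.
  have main := h.integral_softLoss_random_le_softRisk hn hα₁ hα₁1 hα₂ hα₂1 hm (a := a)
    (lam₀ := (1 + δ) * a) (κ := 4 * δ) (τ := τ) (M := 1 / δ) (by linarith) r5
    (by linarith) (by linarith) (by linarith) (by rw [le_div_iff₀ hδ]; linarith) hb
    (by rw [ha]; linarith [mul_le_mul (hC2.trans hAC) hρ1 zero_le_one (by linarith)]) hSA hτ hR2 hv hw hu le_rfl
  rw [ha, show 2 * (4 * δ) = 8 * δ by ring] at main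
  refine main.trans ?_
  set K := (1 + 8 * δ) ^ 2 with hK
  set x := Real.exp (1 - (1 - α₁) ^ 2 / 16 * (A * ρ)) with hx
  have hx0 : 0 < x := Real.exp_pos _
  have hK3 : K ≤ 9 / 4 := one_add_eight_mul_sq_le hδ hδ1
  have hK0 : 0 ≤ K := sq_nonneg _
  have hδ2 : δ ^ 2 ≤ 1 / 256 := by
    have := pow_le_pow_left₀ hδ.le hδ1 2; linarith
  have hδρ : δ ^ 2 * ρ ≤ 1 / 256 * n := mul_le_mul hδ2 hρn (by linarith) (by norm_num)
  have hδρ0 : 0 ≤ δ ^ 2 * ρ := by positivity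
  -- On step-up failure the loss is bounded only polynomially, by order n²; another n counts the
  -- levels. The exponential in ρ absorbs n³.
  have hlast : (K * ((K + 2 * δ ^ 2) * ρ + 3 * n / α₂ * (δ ^ 2 * ρ) + δ ^ 2 * ρ) + δ ^ 2 * ρ +
      δ ^ 2 * ρ + n) * (n * x) ≤ δ ^ 2 * ρ := by
    have e1 : (K + 2 * δ ^ 2) * ρ ≤ 3 * n :=
      mul_le_mul (by linarith) hρn (by linarith) (by norm_num)
    have e2 : 3 * n / α₂ * (δ ^ 2 * ρ) ≤ 3 / α₂ * n ^ 2 := by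
      have : 3 * n / α₂ * (δ ^ 2 * ρ) ≤ 3 * n / α₂ * n :=
        mul_le_mul_of_nonneg_left (by linarith) (by positivity)
      refine this.trans (le_of_eq ?_); ring
    have e2' : 0 ≤ 3 / α₂ * (n : ℝ) ^ 2 := by positivity
    have hnn : (n : ℝ) ≤ n ^ 2 := by rw [sq]; exact le_mul_of_one_le_left (by linarith) hn'
    have e3 : K * ((K + 2 * δ ^ 2) * ρ + 3 * n / α₂ * (δ ^ 2 * ρ) + δ ^ 2 * ρ) ≤
        9 / 4 * (4 * n + 3 / α₂ * n ^ 2) :=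
      mul_le_mul hK3 (by linarith) (by positivity) (by norm_num)
    have e4 : K * ((K + 2 * δ ^ 2) * ρ + 3 * n / α₂ * (δ ^ 2 * ρ) + δ ^ 2 * ρ) + δ ^ 2 * ρ +
      δ ^ 2 * ρ + n ≤ (32 + 12 / α₂) * n ^ 2 := by
      have : (32 + 12 / α₂) * (n : ℝ) ^ 2 = 32 * n ^ 2 + 4 * (3 / α₂ * n ^ 2) := by ring
      rw [this]; linarith
    calc _ ≤ ((32 + 12 / α₂) * n ^ 2) * (n * x) := mul_le_mul_of_nonneg_right e4 (by positivity)
      _ = (32 + 12 / α₂) * n ^ 3 * x := by ring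
      _ ≤ δ ^ 2 := hL
      _ ≤ δ ^ 2 * ρ := le_mul_of_one_le_right (sq_nonneg _) hρ1
  have hfac : (K * ((K + 2 * δ ^ 2) * ρ + 24 * (1 / δ) / α₂ * (δ ^ 2 * ρ) + δ ^ 2 * ρ) + δ ^ 2 * ρ +
      2 * (δ ^ 2 * ρ)) + (5 / (2 * (1 / δ)) * (K * ((K + 2 * δ ^ 2) * ρ + δ ^ 2 * ρ) + δ ^ 2 * ρ +
      δ ^ 2 * ρ) + K * (30 / α₂ * (δ ^ 2 * ρ))) + δ ^ 2 * ρ = riskFactor α₂ δ * ρ := by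
    rw [riskFactor, ← hK]
    field_simp
    ring
  linarith

end NormalMeans

/-! ### Asymptotics -/

theorem sq_mul_gaussTail_le {t : ℝ} (ht : 0 < t) : t ^ 2 * gaussTail t ≤ 32 / t ^ 2 := by
  have h1 := gaussTail_le_exp t ht.le
  have h2 := Real.quadratic_le_exp_of_nonneg (show 0 ≤ t ^ 2 / 4 by positivity)
  have h3 : t ^ 4 / 32 ≤ Real.exp (t ^ 2 / 4) := by
    have : 0 ≤ t ^ 2 := sq_nonneg t
    nlinarith
  rw [le_div_iff₀ (by positivity)]
  have h4 : Real.exp (-(t ^ 2 / 4)) * Real.exp (t ^ 2 / 4) = 1 := by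
    rw [← Real.exp_add]; simp
  calc t ^ 2 * gaussTail t * t ^ 2 = 32 * (gaussTail t * (t ^ 4 / 32)) := by ring
    _ ≤ 32 * (Real.exp (-(t ^ 2 / 4)) * Real.exp (t ^ 2 / 4)) := by
        gcongr
    _ = 32 := by rw [h4]; norm_num

/-- All the largeness conditions on the level `a` hold eventually. -/
theorem eventually_reference_level {δ : ℝ} (hδ : 0 < δ) (A : ℝ) :
    ∀ᶠ a : ℝ in atTop, 2 / δ ≤ a ∧ 2 * A / a ^ 2 ≤ δ ^ 2 ∧ 5 ≤ Real.exp (δ * a ^ 2 / 2) ∧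
      4 * A / δ ^ 2 ≤ Real.exp (δ * a ^ 2 / 2) ∧ 160 * a ^ 2 ≤ Real.exp (δ * a ^ 2 / 2) ∧
      80 / δ ^ 2 ≤ Real.exp (δ * a ^ 2 / 2) ∧
      ∀ t, a / 4 ≤ t → 64 * (2 / gaussTail 1) * (t ^ 2 * gaussTail t) ≤ δ ^ 2 := by
  have hsq : Tendsto (fun a : ℝ => a ^ 2) atTop atTop := tendsto_pow_atTop two_ne_zero
  have hexp : Tendsto (fun a : ℝ => Real.exp (δ * a ^ 2 / 2)) atTop atTop :=
    Real.tendsto_exp_atTop.comp ((hsq.const_mul_atTop hδ).atTop_div_const (by norm_num))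
  have hinv : Tendsto (fun a : ℝ => 2 * A / a ^ 2) atTop (𝓝 0) := hsq.const_div_atTop _
  have hδ2 : 0 < δ ^ 2 := by positivity
  filter_upwards [eventually_ge_atTop (2 / δ), hinv.eventually (ge_mem_nhds hδ2),
    hexp.eventually_ge_atTop 5, hexp.eventually_ge_atTop (4 * A / δ ^ 2),
    hsq.eventually_ge_atTop (1280 / δ ^ 2), hexp.eventually_ge_atTop (80 / δ ^ 2),
    hsq.eventually_ge_atTop (16 * (64 * (2 / gaussTail 1) * 32 / δ ^ 2)),
    eventually_gt_atTop 0] with a h1 h2 h3 h4 h5 h6 h7 h8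
  refine ⟨h1, h2, h3, h4, ?_, h6, fun t ht => ?_⟩
  · have hq := Real.quadratic_le_exp_of_nonneg (show 0 ≤ δ * a ^ 2 / 2 by positivity)
    rw [div_le_iff₀ hδ2] at h5
    have h9 := mul_le_mul_of_nonneg_right h5 (sq_nonneg a)
    have : 0 ≤ δ * a ^ 2 / 2 := by positivity
    have e : (δ * a ^ 2 / 2) ^ 2 / 2 = a ^ 2 * δ ^ 2 * a ^ 2 / 8 := by ring
    linarith
  · have ht0 : 0 < t := by linarith
    have hq1 := gaussTail_pos 1
    refine (mul_le_mul_of_nonneg_left (sq_mul_gaussTail_le ht0) (by positivity)).trans ?_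
    have h9 : 64 * (2 / gaussTail 1) * 32 / δ ^ 2 ≤ t ^ 2 := by
      have := pow_le_pow_left₀ (by positivity) ht 2
      rw [div_pow] at this
      linarith
    rw [div_le_iff₀ hδ2] at h9
    rw [← mul_div_assoc, div_le_iff₀ (by positivity)]
    linarith

/-- Here log n ≪ ρ is used: log n ≤ (c/4)ρ turns exp(-cρ) into at most n⁻⁴. -/
theorem eventually_mul_cube_mul_exp_le {ρ : ℕ → ℝ} {c C τ : ℝ} (hc : 0 < c) (hC : 0 ≤ C) (hτ : 0 < τ)
    (hρ : ∀ d > 0, ∀ᶠ n : ℕ in atTop, Real.log n ≤ d * ρ n) :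
    ∀ᶠ n : ℕ in atTop, C * n ^ 3 * Real.exp (1 - c * ρ n) ≤ τ := by
  have hlim : Tendsto (fun n : ℕ => C * Real.exp 1 / (n : ℝ)) atTop (𝓝 0) :=
    tendsto_const_div_atTop_nhds_zero_nat _
  filter_upwards [hρ (c / 4) (by positivity), hlim.eventually (ge_mem_nhds hτ),
    eventually_ge_atTop 1] with n h1 h2 h3
  have hn : (0 : ℝ) < n := by exact_mod_cast h3
  have h4 : Real.exp (1 - c * ρ n) ≤ Real.exp 1 / n ^ 4 := by
    have : Real.exp 1 / (n : ℝ) ^ 4 = Real.exp (1 - 4 * Real.log n) := by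
      rw [Real.exp_sub, mul_comm, Real.exp_mul, Real.exp_log hn]
      norm_num
    rw [this]
    exact Real.exp_le_exp.2 (by linarith)
  refine (mul_le_mul_of_nonneg_left h4 (by positivity)).trans (le_trans (le_of_eq ?_) h2)
  field_simp

theorem tendsto_riskFactor (α : ℝ) :
    Tendsto (fun δ => riskFactor α δ * (1 + 8 * δ) ^ 2 / (1 - 12 * δ ^ 2)) (𝓝[>] 0) (𝓝 1) := by
  have hcont : ContinuousAt (fun δ => riskFactor α δ * (1 + 8 * δ) ^ 2 / (1 - 12 * δ ^ 2)) 0 := by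
    unfold riskFactor
    refine ContinuousAt.div (by fun_prop) (by fun_prop) (by norm_num)
  have := hcont.tendsto
  simp only [riskFactor] at this
  norm_num at this
  exact this.mono_left nhdsWithin_le_nhds

section Asymptotic

variable {Ω : ℕ → Type*} [∀ n, MeasurableSpace (Ω n)] {P : ∀ n, Measure (Ω n)}
  [∀ n, IsProbabilityMeasure (P n)] {θ : ∀ n, Fin n → ℝ} {X : ∀ n, Ω n → Fin n → ℝ}

theorem minSoftRisk_nonneg {Ω : Type*} [MeasurableSpace Ω] (P : Measure Ω) {n : ℕ}
    (X : Ω → Fin n → ℝ) (θ : Fin n → ℝ) : 0 ≤ minSoftRisk P X θ :=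
  Real.iInf_nonneg fun _ => integral_nonneg fun _ => softLoss_nonneg _ _ _

/-- Both the expected minimum loss and the risk of the random threshold are eventually within
factors near one of the minimum risk. -/
theorem eventually_risk_bounds (h : ∀ n, NormalMeans (P n) (X n) (θ n)) {α₁ α₂ : ℝ} (hα₁ : 0 < α₁)
    (hα₁1 : α₁ < 1) (hα₂ : 0 < α₂) (hα₂1 : α₂ < 1) {lamHat : ∀ n, Ω n → ℝ}
    (hm : ∀ n, Measurable (lamHat n)) {δ : ℝ} (hδ : 0 < δ) (hδ1 : δ ≤ 1 / 16)
    (hb : ∀ᶠ n in atTop, ∀ᵐ ω ∂(P n), stepUpThreshold α₁ (X n ω) ≤ lamHat n ω ∧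
      lamHat n ω ≤ (1 + 4 * δ) * stepDownThreshold α₂ (X n ω))
    (hlow : (fun n : ℕ => Real.log n) =o[atTop] fun n => minSoftRisk (P n) (X n) (θ n))
    (hupp : (fun n => minSoftRisk (P n) (X n) (θ n)) =o[atTop] fun n : ℕ => (n : ℝ)) :
    ∀ᶠ n in atTop, 1 ≤ minSoftRisk (P n) (X n) (θ n) ∧
      (1 - 12 * δ ^ 2) * minSoftRisk (P n) (X n) (θ n) ≤
        (1 + 8 * δ) ^ 2 * ∫ ω, minSoftLoss (X n ω) (θ n) ∂(P n) ∧
      ∫ ω, softLoss (lamHat n ω) (X n ω) (θ n) ∂(P n) ≤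
        riskFactor α₂ δ * minSoftRisk (P n) (X n) (θ n) := by
  set ρ : ℕ → ℝ := fun n => minSoftRisk (P n) (X n) (θ n) with hρ
  have hρ0 : ∀ n, 0 ≤ ρ n := fun n => minSoftRisk_nonneg _ _ _
  set A := 4 / (1 - α₁) * (2 / gaussTail 1) with hA
  have hq1 := gaussTail_pos 1
  have hα' : 0 < 1 - α₁ := by linarith
  have hA0 : 0 < A := by positivity
  have hAC : 2 / gaussTail 1 ≤ A := by
    rw [hA]
    refine le_mul_of_one_le_left (by positivity) ?_
    rw [le_div_iff₀ hα']; linarith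
  have hlog : ∀ d > 0, ∀ᶠ n : ℕ in atTop, Real.log n ≤ d * ρ n := fun d hd => by
    filter_upwards [hlow.def hd] with n hn
    rw [Real.norm_of_nonneg (hρ0 n)] at hn
    exact (le_abs_self _).trans hn
  have hsmall : ∀ d > 0, ∀ᶠ n : ℕ in atTop, ρ n ≤ d * n := fun d hd => by
    filter_upwards [hupp.def hd] with n hn
    rwa [Real.norm_of_nonneg (hρ0 n), Real.norm_of_nonneg (Nat.cast_nonneg n)] at hn
  have hρtop : Tendsto ρ atTop atTop := by
    refine tendsto_atTop_mono' atTop ?_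
      (Real.tendsto_log_atTop.comp tendsto_natCast_atTop_atTop)
    filter_upwards [hlog 1 one_pos] with n hn using by simpa using hn
  obtain ⟨T, hT⟩ := eventually_atTop.1 (eventually_reference_level hδ A)
  have hexp : Tendsto (fun n => Real.exp (1 - ρ n)) atTop (𝓝 0) :=
    Real.tendsto_exp_atBot.comp (by
      simpa [sub_eq_add_neg] using
        tendsto_atBot_add_const_left atTop (1 : ℝ) (tendsto_neg_atTop_atBot.comp hρtop))
  have hcA : 0 < (1 - α₁) ^ 2 / 16 * A := by positivity
  have hcube := eventually_mul_cube_mul_exp_le (C := 32 + 12 / α₂) (τ := δ ^ 2) hcA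
    (by positivity) (by positivity) hlog
  filter_upwards [hb, hρtop.eventually_ge_atTop 1, hsmall 1 one_pos,
    hsmall (gaussTail T / (2 * A)) (div_pos (gaussTail_pos T) (by positivity)),
    hexp.eventually (ge_mem_nhds (show 0 < δ ^ 2 by positivity)), hcube,
    eventually_ge_atTop 1] with n hbn h1 h2 h3 h4 h5 hn
  have hn' : (0 : ℝ) < n := by exact_mod_cast hn
  have h3' : A * ρ n / n ≤ gaussTail T / 2 := by
    rw [div_le_iff₀ hn']
    calc A * ρ n ≤ A * (gaussTail T / (2 * A) * n) := mul_le_mul_of_nonneg_left h3 hA0.le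
      _ = _ := by field_simp
  have hTpos := gaussTail_pos T
  have hT1 := gaussTail_le_one T
  -- The tail probability Aρ/n is eventually below that at T because ρ ≪ n, so a > T and all
  -- largeness conditions hold.
  obtain ⟨a, ha0, haq⟩ := exists_gaussTail_eq (p := A * ρ n / n)
    (div_pos (mul_pos hA0 (by linarith)) hn') (by linarith)
  have haT : T < a := lt_of_gaussTail_lt (by rw [haq]; linarith)
  obtain ⟨c1, c2, c3, c4, c5, c6, c7⟩ := hT a haT.le
  have hna : n * gaussTail a = A * ρ n := by rw [haq]; field_simp
  refine ⟨h1, ?_, ?_⟩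
  · exact (h n).mul_minSoftRisk_le_integral_minSoftLoss hδ hδ1 rfl h1 hAC hna c1 c2 c3 c4 c5 c6 c7 h4
  · refine (h n).integral_softLoss_random_le_minSoftRisk hn hα₁ hα₁1 hα₂ hα₂1 (hm n) hδ hδ1 rfl h1
      (by simpa using h2) rfl hna c1 c2 c3 c4 c7 hbn ?_
    rw [← mul_assoc]; exact h5

end Asymptotic

theorem theorem2
    (α₁ α₂ : ℝ) (hα₂ : 0 < α₂) (hα₂₁ : α₂ ≤ α₁) (hα₁ : α₁ < 1)
    (δ₁ δ₂ : ℕ → ℝ) (hδ₁ : ∀ n, 0 ≤ δ₁ n) (hδ₁₂ : ∀ n, δ₁ n ≤ δ₂ n)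
    (hδ₂ : Tendsto δ₂ atTop (𝓝 0))
    -- for each `n`, a probability space, a mean vector `θ`, and data `X` with independent
    -- components `X_i ~ N(θ_i, 1)`
    (Ω : ℕ → Type*) [∀ n, MeasurableSpace (Ω n)]
    (P : ∀ n, Measure (Ω n)) [∀ n, IsProbabilityMeasure (P n)]
    (θ : ∀ n, Fin n → ℝ) (X : ∀ n, Ω n → Fin n → ℝ)
    (hX_meas : ∀ n, Measurable (X n))
    (hX_indep : ∀ n, iIndepFun (fun i ω => X n ω i) (P n))
    (hX_law : ∀ n i, HasLaw (fun ω => X n ω i) (gaussianReal (θ n i) 1) (P n))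
    -- a random threshold level between the inflated step-up and step-down thresholds
    (lamHat : ∀ n, Ω n → ℝ) (hlam_meas : ∀ n, Measurable (lamHat n))
    (hlam : ∀ n, 1 ≤ n → ∀ᵐ ω ∂(P n),
      Real.sqrt (1 + δ₁ n) * stepUpThreshold α₁ (X n ω) ≤ lamHat n ω ∧
        lamHat n ω ≤ Real.sqrt (1 + δ₂ n) * stepDownThreshold α₂ (X n ω))
    -- `log n ≪ inf_{lam ≥ 0} E ‖s_lam(X) - θ‖² ≪ n`
    (hlow : (fun n : ℕ => Real.log n) =o[atTop] fun n => minSoftRisk (P n) (X n) (θ n))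
    (hupp : (fun n => minSoftRisk (P n) (X n) (θ n)) =o[atTop] fun n : ℕ => (n : ℝ)) :
    (∀ n, Integrable (fun ω => softLoss (lamHat n ω) (X n ω) (θ n)) (P n)) ∧
    (∀ n, Integrable (fun ω => minSoftLoss (X n ω) (θ n)) (P n)) ∧
    Tendsto
      (fun n => (∫ ω, softLoss (lamHat n ω) (X n ω) (θ n) ∂(P n)) /
        ∫ ω, minSoftLoss (X n ω) (θ n) ∂(P n))
      atTop (𝓝 1) := by

  have hα₁0 : 0 < α₁ := hα₂.trans_le hα₂₁
  have hα₂1 : α₂ < 1 := hα₂₁.trans_lt hα₁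
  have h : ∀ n, NormalMeans (P n) (X n) (θ n) := fun n => ⟨hX_meas n, hX_indep n, hX_law n⟩
  have hsqrt1 : ∀ n, 1 ≤ Real.sqrt (1 + δ₁ n) := fun n => by
    rw [Real.one_le_sqrt]; linarith [hδ₁ n]
  have hsqrt2 : ∀ n, 1 ≤ Real.sqrt (1 + δ₂ n) := fun n => by
    rw [Real.one_le_sqrt]; linarith [hδ₁ n, hδ₁₂ n]
  -- Since √(1 + δ₁) ≥ 1, the inflation of the lower bound can be dropped; only that of the upper
  -- bound must tend to one.
  have hbounds : ∀ n, 1 ≤ n → ∀ᵐ ω ∂(P n), 0 ≤ lamHat n ω ∧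
      stepUpThreshold α₁ (X n ω) ≤ lamHat n ω ∧ 0 ≤ stepDownThreshold α₂ (X n ω) := by
    intro n hn
    filter_upwards [hlam n hn] with ω hω
    have h0 := stepUpThreshold_nonneg hα₁0 hα₁ hn (X n ω)
    have h1 : stepUpThreshold α₁ (X n ω) ≤ lamHat n ω :=
      (le_mul_of_one_le_left h0 (hsqrt1 n)).trans hω.1
    refine ⟨h0.trans h1, h1, ?_⟩
    exact nonneg_of_mul_nonneg_right ((h0.trans h1).trans hω.2) (by linarith [hsqrt2 n])
  have hint : ∀ n, Integrable (fun ω => softLoss (lamHat n ω) (X n ω) (θ n)) (P n) := by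
    intro n
    rcases Nat.eq_zero_or_pos n with rfl | hn
    · simp [softLoss]
    · refine (h n).integrable_softLoss_random (hlam_meas n)
        (lam' := Real.sqrt (1 + δ₂ n) * fdrLevel α₂ n 1) ?_
        (mul_nonneg (Real.sqrt_nonneg _) (fdrLevel_spec hα₂ hα₂1 le_rfl hn).1.le)
      filter_upwards [hlam n hn, hbounds n hn] with ω hω hω2
      exact ⟨hω2.1, hω.2.trans (mul_le_mul_of_nonneg_left
        (stepDownThreshold_le hα₂ hα₂1 le_rfl hn (by simp)) (Real.sqrt_nonneg _))⟩
  refine ⟨hint, fun n => (h n).integrable_minSoftLoss, ?_⟩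
  have hle : ∀ n, 1 ≤ n → ∫ ω, minSoftLoss (X n ω) (θ n) ∂(P n) ≤
      ∫ ω, softLoss (lamHat n ω) (X n ω) (θ n) ∂(P n) := fun n hn => by
    refine integral_mono_ae (h n).integrable_minSoftLoss (hint n) ?_
    filter_upwards [hbounds n hn] with ω hω using minSoftLoss_le hω.1 _ _
  have hbδ : ∀ δ : ℝ, 0 < δ → ∀ᶠ n in atTop, ∀ᵐ ω ∂(P n),
      stepUpThreshold α₁ (X n ω) ≤ lamHat n ω ∧
        lamHat n ω ≤ (1 + 4 * δ) * stepDownThreshold α₂ (X n ω) := by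
    intro δ hδ
    have hs : Tendsto (fun n => Real.sqrt (1 + δ₂ n)) atTop (𝓝 1) := by
      have := (hδ₂.const_add 1).sqrt
      simpa using this
    filter_upwards [hs.eventually (ge_mem_nhds (show (1 : ℝ) < 1 + 4 * δ by linarith)),
      eventually_ge_atTop 1] with n hn hn1
    filter_upwards [hlam n hn1, hbounds n hn1] with ω hω hω2
    exact ⟨hω2.2.1, hω.2.trans (mul_le_mul_of_nonneg_right hn hω2.2.2)⟩
  rw [tendsto_order]
  constructor
  -- No random threshold beats the minimum loss, so the ratio is at least one as soon as the
  -- denominator is positive; δ = 1/16 suffices for that.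
  · intro c hc
    filter_upwards [eventually_risk_bounds h hα₁0 hα₁ hα₂ hα₂1 hlam_meas (δ := 1 / 16) (by norm_num)
      le_rfl (hbδ _ (by norm_num)) hlow hupp, eventually_ge_atTop 1] with n hn hn1
    obtain ⟨h1, h2, -⟩ := hn
    have hI : 0 < ∫ ω, minSoftLoss (X n ω) (θ n) ∂(P n) := by
      norm_num at h2
      linarith
    exact hc.trans_le ((one_le_div hI).2 (hle n hn1))
  · intro c hc
    -- δ is fixed before n → ∞, small enough that the quotient of the two factors around ρ is below
    -- c.
    obtain ⟨δ, hδc, hδ0, hδ1⟩ := (((tendsto_riskFactor α₂).eventually (gt_mem_nhds hc)).and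
      (Ioc_mem_nhdsGT (show (0 : ℝ) < 1 / 16 by norm_num))).exists
    have hδ2 : 0 < 1 - 12 * δ ^ 2 := by nlinarith
    filter_upwards [eventually_risk_bounds h hα₁0 hα₁ hα₂ hα₂1 hlam_meas hδ0 hδ1 (hbδ _ hδ0) hlow
      hupp] with n hn
    obtain ⟨h1, h2, h3⟩ := hn
    set ρ := minSoftRisk (P n) (X n) (θ n)
    set I := ∫ ω, minSoftLoss (X n ω) (θ n) ∂(P n)
    have hI : 0 < I := by
      have : 0 < (1 + 8 * δ) ^ 2 * I := (mul_pos hδ2 (by linarith)).trans_le h2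
      exact pos_of_mul_pos_right this (sq_nonneg _)
    have hF : 0 ≤ riskFactor α₂ δ := by
      unfold riskFactor; positivity
    refine lt_of_le_of_lt ?_ hδc
    rw [div_le_div_iff₀ hI hδ2]
    calc _ ≤ riskFactor α₂ δ * ρ * (1 - 12 * δ ^ 2) := mul_le_mul_of_nonneg_right h3 hδ2.le
      _ = riskFactor α₂ δ * ((1 - 12 * δ ^ 2) * ρ) := by ring
      _ ≤ riskFactor α₂ δ * ((1 + 8 * δ) ^ 2 * I) := mul_le_mul_of_nonneg_left h2 hF
      _ = _ := by ring
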